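/- Let $(X,\mathcal B,\mu)$ be a standard (atomless) probability space and let $\mathrm{Aut}(\mu)$ be its group of automorphisms, i.e. invertible measure-preserving transformations modulo equality a.e. On $\mathrm{Aut}(\mu\otimes\mu)$ consider the Halmos metric $$\rho(R,T)=\sum_i 2^{-i}\bigl((\mu\otimes\mu)(RA_i\,\Delta\,TA_i)+(\mu\otimes\mu)(R^{-1}A_i\,\Delta\,T^{-1}A_i)\bigr),$$ where $\{A_i\}$ is a fixed sequence of measurable sets that is dense in the algebra of measurable subsets of $X\times X$. For $S\in\mathrm{Aut}(\mu)$ let $\mathrm{Ext}(S)\subset\mathrm{Aut}(\mu\otimes\mu)$ be the set of extensions of $S$, i.e. of skew products $R(x,y)=(Sx,R_xy)$ with $\{R_x\}_{x\in X}$ a measurable family of automorphisms of $(X,\mu)$, with the topology induced by $\rho$. A set of extensions of $S$ is called generic if it contains a dense $G_\delta$ subset of $\mathrm{Ext}(S)$. An automorphism $T$ is identified with the unitary operator $f\mapsto f\circ T$ on $L^2$. An admissible function is an expression $P(T)=c\,\Theta+\sum_{i=0}^\infty c_iT^i$ with $c,c_i\ge 0$ and $c+\sum_{i=0}^\infty c_i=1$,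 where $\Theta$ is the orthogonal projection of $L^2$ onto the constants. We say that $P(T)$ is a weak limit of powers of $T$ if there is a sequence of natural numbers $n_j\to\infty$ with $T^{n_j}\to P(T)$ in the weak operator topology. **Theorem.** Let $S\in\mathrm{Aut}(\mu)$. 1. Let $P$ be an admissible function. If for some extension $\tilde R\in\mathrm{Ext}(S)$ the operator $P(\tilde R)$ is a weak limit of powers of $\tilde R$, then the set of all extensions $R\in\mathrm{Ext}(S)$ for which $P(R)$ is a weak limit of powers of $R$ is generic. 2. More generally, let $\mathcal F$ be an arbitrary family of admissible functions such that for each $P\in\mathcal F$ there is an extension $\tilde R_P\in\mathrm{Ext}(S)$ for which $P(\tilde R_P)$ is a weak limit of powers of $\tilde R_P$ (for instance, one and the same extension $\tilde R$ for all $P\in\mathcal F$). Then the set of all extensions $R\in\mathrm{Ext}(S)$ such that, for every $P\in\mathcal F$, the operator $P(R)$ is a weak limit of powers of $R$, is generic. -/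

import Mathlib

namespace TypicalExt

open MeasureTheory Filter Topology
open scoped symmDiff ENNReal

/-! ### Automorphisms of a probability space and the Halmos metric -/

/-- Invertible bimeasurable transformations preserving `μ` (pointwise representatives). -/
abbrev MPMap {Z : Type*} [MeasurableSpace Z] (μ : Measure Z) : Type _ :=
  {T : Z ≃ᵐ Z // MeasurePreserving T μ μ}

/-- Equality almost everywhere. -/
instance autSetoid {Z : Type*} [MeasurableSpace Z] (μ : Measure Z) : Setoid (MPMap μ) where
  r T T' := ⇑T.1 =ᵐ[μ] ⇑T'.1
  iseqv := ⟨fun _ => EventuallyEq.rfl, fun h => h.symm, fun h h' => h.trans h'⟩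

/-- `Aut μ`: automorphisms of `(Z, μ)`, identified when they agree almost everywhere. -/
def Aut {Z : Type*} [MeasurableSpace Z] (μ : Measure Z) : Type _ :=
  Quotient (autSetoid μ)

/-- The class of an invertible measure-preserving transformation. -/
def Aut.mk {Z : Type*} [MeasurableSpace Z] {μ : Measure Z} (T : MPMap μ) : Aut μ :=
  Quotient.mk (autSetoid μ) T

theorem MPMap.symm_mp {Z : Type*} [MeasurableSpace Z] {μ : Measure Z} (T : MPMap μ) :
    MeasurePreserving T.1.symm μ μ :=
  T.2.symm T.1

theorem MPMap.symm_ae_eq {Z : Type*} [MeasurableSpace Z] {μ : Measure Z} {T T' : MPMap μ}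
    (h : ⇑T.1 =ᵐ[μ] ⇑T'.1) : ⇑T.1.symm =ᵐ[μ] ⇑T'.1.symm := by
  have h2 := (MPMap.symm_mp T').quasiMeasurePreserving.ae h
  filter_upwards [h2] with z hz
  apply T.1.injective
  simp [hz]

theorem MPMap.image_ae_eq {Z : Type*} [MeasurableSpace Z] {μ : Measure Z} {T T' : MPMap μ}
    (h : ⇑T.1 =ᵐ[μ] ⇑T'.1) (B : Set Z) : (T.1 '' B : Set Z) =ᵐ[μ] (T'.1 '' B : Set Z) := by
  rw [MeasurableEquiv.image_eq_preimage_symm, MeasurableEquiv.image_eq_preimage_symm]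
  filter_upwards [MPMap.symm_ae_eq h] with z hz
  show (T.1.symm z ∈ B) = (T'.1.symm z ∈ B)
  rw [hz]

theorem MPMap.image_symm_ae_eq {Z : Type*} [MeasurableSpace Z] {μ : Measure Z} {T T' : MPMap μ}
    (h : ⇑T.1 =ᵐ[μ] ⇑T'.1) (B : Set Z) :
    (T.1.symm '' B : Set Z) =ᵐ[μ] (T'.1.symm '' B : Set Z) :=
  MPMap.image_ae_eq (T := ⟨T.1.symm, T.symm_mp⟩) (T' := ⟨T'.1.symm, T'.symm_mp⟩)
    (MPMap.symm_ae_eq h) B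

/-- A sequence of measurable sets which is dense in the algebra of measurable sets
(for the distance `μ (B ∆ C)`). -/
structure DenseFamily {Z : Type*} [MeasurableSpace Z] (μ : Measure Z) where
  /-- the sets of the family -/
  sets : ℕ → Set Z
  measurable : ∀ i, MeasurableSet (sets i)
  dense : ∀ B, MeasurableSet B → ∀ ε : ℝ, 0 < ε → ∃ i, μ.real (B ∆ sets i) < ε

/-- The `i`-th term `μ (S Aᵢ ∆ T Aᵢ) + μ (S⁻¹ Aᵢ ∆ T⁻¹ Aᵢ)` of the Halmos metric. -/
noncomputable def halmosTerm {Z : Type*} [MeasurableSpace Z] {μ : Measure Z}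
    (A : DenseFamily μ) (S T : MPMap μ) (i : ℕ) : ℝ :=
  μ.real ((S.1 '' A.sets i) ∆ (T.1 '' A.sets i)) +
    μ.real ((S.1.symm '' A.sets i) ∆ (T.1.symm '' A.sets i))

/-- The Halmos distance `∑ 2⁻ⁱ (μ (S Aᵢ ∆ T Aᵢ) + μ (S⁻¹ Aᵢ ∆ T⁻¹ Aᵢ))`; the family is indexed
from `0`, so the `i`-th weight is written `2 ^ (-(i + 1))`. -/
noncomputable def halmosDist {Z : Type*} [MeasurableSpace Z] {μ : Measure Z}
    (A : DenseFamily μ) (S T : MPMap μ) : ℝ :=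
  ∑' i, (1 / 2 : ℝ) ^ (i + 1) * halmosTerm A S T i

section HalmosMetric

variable {Z : Type*} [MeasurableSpace Z] {μ : Measure Z}

theorem halmosTerm_nonneg (A : DenseFamily μ) (S T : MPMap μ) (i : ℕ) :
    0 ≤ halmosTerm A S T i := by
  unfold halmosTerm; positivity

theorem halmosTerm_congr (A : DenseFamily μ) {S S' T T' : MPMap μ}
    (hS : ⇑S.1 =ᵐ[μ] ⇑S'.1) (hT : ⇑T.1 =ᵐ[μ] ⇑T'.1) (i : ℕ) :
    halmosTerm A S T i = halmosTerm A S' T' i := by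
  unfold halmosTerm
  congr 1
  · exact measureReal_congr
      ((MPMap.image_ae_eq hS _).symmDiff (MPMap.image_ae_eq hT _))
  · exact measureReal_congr
      ((MPMap.image_symm_ae_eq hS _).symmDiff (MPMap.image_symm_ae_eq hT _))

variable [IsProbabilityMeasure μ]

theorem halmosTerm_summable (A : DenseFamily μ) (S T : MPMap μ) :
    Summable fun i => (1 / 2 : ℝ) ^ (i + 1) * halmosTerm A S T i := by
  have hs : Summable fun i : ℕ => (1 / 2 : ℝ) ^ (i + 1) * 2 :=
    ((summable_nat_add_iff 1).2 summable_geometric_two).mul_right 2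
  refine Summable.of_nonneg_of_le
    (fun i => mul_nonneg (by positivity) (halmosTerm_nonneg A S T i)) (fun i => ?_) hs
  gcongr
  unfold halmosTerm
  linarith [measureReal_le_one (μ := μ) (s := (S.1 '' A.sets i) ∆ (T.1 '' A.sets i)),
    measureReal_le_one (μ := μ) (s := (S.1.symm '' A.sets i) ∆ (T.1.symm '' A.sets i))]

theorem halmosTerm_triangle (A : DenseFamily μ) (S T U : MPMap μ) (i : ℕ) :
    halmosTerm A S U i ≤ halmosTerm A S T i + halmosTerm A T U i := by
  unfold halmosTerm
  linarith [measureReal_symmDiff_le (μ := μ) (s := S.1 '' A.sets i) (t := T.1 '' A.sets i)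
      (U.1 '' A.sets i),
    measureReal_symmDiff_le (μ := μ) (s := S.1.symm '' A.sets i) (t := T.1.symm '' A.sets i)
      (U.1.symm '' A.sets i)]

theorem ae_eq_of_halmosDist_eq_zero [MeasurableSpace.CountablySeparated Z] (A : DenseFamily μ)
    (S T : MPMap μ) (h : halmosDist A S T = 0) : ⇑S.1 =ᵐ[μ] ⇑T.1 := by
  have h0 : ∀ i, halmosTerm A S T i = 0 := by
    intro i
    have hsum := (halmosTerm_summable A S T).hasSum
    rw [show ∑' i, (1 / 2 : ℝ) ^ (i + 1) * halmosTerm A S T i = 0 from h] at hsum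
    have h1 := (hasSum_zero_iff_of_nonneg fun i =>
      mul_nonneg (pow_nonneg one_half_pos.le (i + 1)) (halmosTerm_nonneg A S T i)).1 hsum
    have h2 := congrFun h1 i
    simpa using h2
  have key : ∀ B, MeasurableSet B → (S.1 ⁻¹' B : Set Z) =ᵐ[μ] (T.1 ⁻¹' B : Set Z) := by
    intro B hB
    rw [← measure_symmDiff_eq_zero_iff, ← measureReal_eq_zero_iff]
    refine le_antisymm (le_of_forall_pos_le_add fun ε hε => ?_) measureReal_nonneg
    obtain ⟨i, hi⟩ := A.dense B hB (ε / 2) (half_pos hε)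
    have hterm : μ.real ((S.1 ⁻¹' A.sets i) ∆ (T.1 ⁻¹' A.sets i)) = 0 := by
      have h3 := h0 i
      unfold halmosTerm at h3
      rw [← MeasurableEquiv.image_symm, ← MeasurableEquiv.image_symm]
      linarith [measureReal_nonneg (μ := μ) (s := (S.1 '' A.sets i) ∆ (T.1 '' A.sets i)),
        measureReal_nonneg (μ := μ) (s := (S.1.symm '' A.sets i) ∆ (T.1.symm '' A.sets i))]
    have hm : ∀ U : MPMap μ,
        μ.real ((U.1 ⁻¹' B) ∆ (U.1 ⁻¹' A.sets i)) = μ.real (B ∆ A.sets i) := by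
      intro U
      rw [← Set.preimage_symmDiff, measureReal_def, measureReal_def,
        U.2.measure_preimage (hB.symmDiff (A.measurable i)).nullMeasurableSet]
    have e1 := measureReal_symmDiff_le (μ := μ) (s := S.1 ⁻¹' B) (t := S.1 ⁻¹' A.sets i)
      (T.1 ⁻¹' B)
    have e2 := measureReal_symmDiff_le (μ := μ) (s := S.1 ⁻¹' A.sets i) (t := T.1 ⁻¹' A.sets i)
      (T.1 ⁻¹' B)
    have e3 := hm S
    have e4 := hm T
    rw [symmDiff_comm] at e4
    linarith
  exact Filter.EventuallyEq.of_forall_separating_preimage MeasurableSet key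

/-- `Aut μ` with the Halmos metric of a dense family. -/
@[reducible]
noncomputable def halmosMetric [MeasurableSpace.CountablySeparated Z] (A : DenseFamily μ) :
    MetricSpace (Aut μ) where
  dist S T := Quotient.liftOn₂ S T (halmosDist A) fun _ _ _ _ hS hT =>
    tsum_congr fun i => by rw [halmosTerm_congr A hS hT i]
  dist_self S := by
    induction S using Quotient.inductionOn with
    | _ S => simp [halmosDist, halmosTerm]
  dist_comm S T := by
    induction S, T using Quotient.inductionOn₂ with
    | _ S T => simp [halmosDist, halmosTerm, symmDiff_comm]
  dist_triangle S T U := by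
    induction S, T, U using Quotient.inductionOn₃ with
    | _ S T U =>
      show halmosDist A S U ≤ halmosDist A S T + halmosDist A T U
      unfold halmosDist
      rw [← (halmosTerm_summable A S T).tsum_add (halmosTerm_summable A T U)]
      refine (halmosTerm_summable A S U).tsum_le_tsum (fun i => ?_)
        ((halmosTerm_summable A S T).add (halmosTerm_summable A T U))
      rw [← mul_add]
      exact mul_le_mul_of_nonneg_left (halmosTerm_triangle A S T U i) (by positivity)
  eq_of_dist_eq_zero {S T} := by
    induction S, T using Quotient.inductionOn₂ with
    | _ S T => exact fun h => Quotient.sound (ae_eq_of_halmosDist_eq_zero A S T h)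

end HalmosMetric

/-! ### Extensions (skew products) -/

/-- A measurable family `{R_x}` of automorphisms of the fibre `(Y, ν)`. -/
structure MeasurableFamily (X : Type*) [MeasurableSpace X] {Y : Type*} [MeasurableSpace Y]
    (ν : Measure Y) where
  /-- the automorphism `R_x` -/
  fib : X → MPMap ν
  measurable_fib : Measurable fun p : X × Y => (fib p.1).1 p.2
  measurable_symm : Measurable fun p : X × Y => (fib p.1).1.symm p.2

/-- The skew product `R (x, y) = (s x, R_x y)`. -/
def skewProduct {X Y : Type*} [MeasurableSpace X] [MeasurableSpace Y]
    {μ : Measure X} {ν : Measure Y} [SFinite μ] [SFinite ν]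
    (s : MPMap μ) (F : MeasurableFamily X ν) : MPMap (μ.prod ν) :=
  ⟨{ toFun := fun p => (s.1 p.1, (F.fib p.1).1 p.2)
     invFun := fun p => (s.1.symm p.1, (F.fib (s.1.symm p.1)).1.symm p.2)
     left_inv := fun p => by simp
     right_inv := fun p => by simp
     measurable_toFun := (s.1.measurable.comp measurable_fst).prodMk F.measurable_fib
     measurable_invFun := (s.1.symm.measurable.comp measurable_fst).prodMk
       (F.measurable_symm.comp
         ((s.1.symm.measurable.comp measurable_fst).prodMk measurable_snd)) },
   s.2.skew_product F.measurable_fib (ae_of_all _ fun x => (F.fib x).2.map_eq)⟩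

/-- `Ext S`: all automorphisms of `(X × X, μ ⊗ μ)` which are skew products over `S` with
fibre `(X, μ)`. -/
def Ext {X : Type*} [MeasurableSpace X] {μ : Measure X} [SFinite μ] (S : Aut μ) :
    Set (Aut (μ.prod μ)) :=
  {R | ∃ (s : MPMap μ) (F : MeasurableFamily X μ), Aut.mk s = S ∧ Aut.mk (skewProduct s F) = R}

/-- `W` is a typical (generic) set of extensions of `S`: it contains a dense `G_δ` subset of the
space `Ext S`, whose topology is induced by the Halmos metric of `Aut (μ ⊗ μ)`. -/
def IsTypicalExt {X : Type*} [MeasurableSpace X] [StandardBorelSpace X] {μ : Measure X}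
    [IsProbabilityMeasure μ] (A : DenseFamily (μ.prod μ)) (S : Aut μ)
    (W : Set (Aut (μ.prod μ))) : Prop :=
  letI : MetricSpace (Aut (μ.prod μ)) := halmosMetric A
  ∃ G : Set (Ext S), IsGδ G ∧ Dense G ∧ ∀ R ∈ G, (R : Aut (μ.prod μ)) ∈ W

/-! ### Koopman operators, admissible functions, weak limits of powers -/

/-- The unitary operator `f ↦ f ∘ T` on `L²(μ)` of an automorphism `T`. -/
noncomputable def koopman {Z : Type*} [MeasurableSpace Z] {μ : Measure Z} (T : Aut μ) :
    Lp ℂ 2 μ →L[ℂ] Lp ℂ 2 μ :=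
  Quotient.liftOn T
    (fun T => (Lp.compMeasurePreservingₗᵢ ℂ T.1 T.2).toContinuousLinearMap)
    (fun T T' h => by
      ext1 f
      refine Lp.ext ?_
      have h1 := Lp.coeFn_compMeasurePreserving f T.2
      have h2 := Lp.coeFn_compMeasurePreserving f T'.2
      have h3 : f ∘ T.1 =ᵐ[μ] f ∘ T'.1 := by
        filter_upwards [show ⇑T.1 =ᵐ[μ] ⇑T'.1 from h] with z hz
        simp [hz]
      exact h1.trans (h3.trans h2.symm))

/-- `Θ`: the orthogonal projection of `L²(μ)` onto the constants. -/
noncomputable def Theta {Z : Type*} [MeasurableSpace Z] (μ : Measure Z) [IsFiniteMeasure μ] :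
    Lp ℂ 2 μ →L[ℂ] Lp ℂ 2 μ :=
  (Submodule.span ℂ {Lp.const 2 μ (1 : ℂ)}).starProjection

/-- The coefficients of an admissible function `P(T) = c Θ + ∑ cᵢ Tⁱ`:
`c, cᵢ ≥ 0` and `c + ∑ cᵢ = 1`. -/
structure AdmissibleFunction where
  /-- the coefficient `c` of `Θ` -/
  c : ℝ
  /-- the coefficients `cᵢ` of `Tⁱ` -/
  coeff : ℕ → ℝ
  c_nonneg : 0 ≤ c
  coeff_nonneg : ∀ i, 0 ≤ coeff i
  hasSum_coeff : HasSum coeff (1 - c)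

/-- The operator `P(T) = c Θ + ∑ cᵢ Tⁱ`; the series converges in operator norm. -/
noncomputable def AdmissibleFunction.eval (P : AdmissibleFunction)
    {Z : Type*} [MeasurableSpace Z] {μ : Measure Z} [IsFiniteMeasure μ] (T : Aut μ) :
    Lp ℂ 2 μ →L[ℂ] Lp ℂ 2 μ :=
  (P.c : ℂ) • Theta μ + ∑' i, (P.coeff i : ℂ) • koopman T ^ i

theorem norm_koopman_le {Z : Type*} [MeasurableSpace Z] {μ : Measure Z} (T : Aut μ) :
    ‖koopman T‖ ≤ 1 := by
  induction T using Quotient.inductionOn with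
  | _ T => exact LinearIsometry.norm_toContinuousLinearMap_le _

theorem AdmissibleFunction.summable_eval (P : AdmissibleFunction)
    {Z : Type*} [MeasurableSpace Z] {μ : Measure Z} (T : Aut μ) :
    Summable fun i => (P.coeff i : ℂ) • koopman T ^ i := by
  refine Summable.of_norm_bounded P.hasSum_coeff.summable fun i => ?_
  rw [norm_smul, Complex.norm_real, Real.norm_of_nonneg (P.coeff_nonneg i)]
  refine mul_le_of_le_one_right (P.coeff_nonneg i) ?_
  cases i with
  | zero => rw [pow_zero]; exact ContinuousLinearMap.norm_id_le
  | succ n =>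
    exact (norm_pow_le' _ n.succ_pos).trans (pow_le_one₀ (norm_nonneg _) (norm_koopman_le T))

/-- `Q` is a weak limit of powers of `T`: `T^{n_j} → Q` in the weak operator topology of `L²(μ)`
for some sequence `n_j → ∞`. -/
def IsWeakLimitOfPowers {Z : Type*} [MeasurableSpace Z] {μ : Measure Z} (T : Aut μ)
    (Q : Lp ℂ 2 μ →L[ℂ] Lp ℂ 2 μ) : Prop :=
  ∃ n : ℕ → ℕ, Tendsto n atTop atTop ∧
    ∀ f g : Lp ℂ 2 μ,
      Tendsto (fun j => inner ℂ ((koopman T ^ n j) f) g) atTop (𝓝 (inner ℂ (Q f) g))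

end TypicalExt

namespace TypicalExt

open MeasureTheory Filter Topology
open scoped symmDiff ENNReal ProbabilityTheory
set_option linter.unusedSectionVars false

/-! ### The group of invertible measure-preserving transformations -/

section Group

variable {Z : Type*} [MeasurableSpace Z] {m : Measure Z}

/-! The proof is a Baire category argument. With `S` represented by a fixed `s`, extensions are
exactly the classes of maps covering `s` everywhere (`IsOver.mk_mem_ext`,
`exists_isOver_of_mem_ext`). Halmos-Cauchy sequences of such maps converge to maps of the same kind,
so `Ext S` is complete (`completeSpace_ext`). Weak convergence of powers can be tested on the dense
family of sets, so it follows from membership in countably many open sets `nearSet A P N`.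
Coefficient sequences form a separable space and these conditions survive limits of coefficients, so
an arbitrary family reduces to a countable one (`exists_countable_dense_subfamily`,
`mem_nearSet_of_tendsto`). What remains is density: near any extension `R` there must be an
extension in `nearSet A P N`, given one extension `R₀` for which `P` is a weak limit of powers
(`exists_mem_nearSet`).

Over the aperiodic part of the base, a Rokhlin tower for `s` gives a fibrewise conjugation of `R₀`
that agrees with `R` off a small set (`exists_conjugate`). Conjugation does not affect weak limits
of powers, so this part of the construction inherits the good powers of `R₀`.

Over the periodic part conjugation is not available in this way, and the power is built by hand.
First `R` is made aperiodic upstairs without moving the images and preimages of finitely many test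
sets (`exists_aperiodic`). Then a tower of height about `n` is cut into cycles of lengths `n - i`,
where `i` is chosen with probability `w i` independently of the itinerary through the test sets
(`exists_cycles`). On a cycle of length `n - i` the new map `T` satisfies `T ^ n = T ^ i`, so `T ^
n` has nearly the correlations of `∑ w i T ^ i` (`exists_prescribed_power`). Closing up the cycles
keeps `T` over `s` only if `s ^ (n - i)` is the identity on the part of the base concerned. This is
where `R₀` is used again: its correlations over sets of the base force `c = 0` when periodic points
have positive measure (`c_eq_zero_of_periodicSet`), and force the good powers `n j` to be compatible
with every period whenever the coefficient of index `i` is nonzero (`eventually_act_sub_eq`). The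
two constructions are glued along an invariant set of the base (`exists_glue`). -/

instance : Group (MPMap m) where
  mul S T := ⟨T.1.trans S.1, S.2.comp T.2⟩
  one := ⟨MeasurableEquiv.refl Z, MeasurePreserving.id m⟩
  inv T := ⟨T.1.symm, T.symm_mp⟩
  mul_assoc _ _ _ := rfl
  one_mul _ := rfl
  mul_one _ := rfl
  inv_mul_cancel T := Subtype.ext (MeasurableEquiv.self_trans_symm T.1)

@[simp] theorem mul_apply (S T : MPMap m) (z : Z) : (S * T).1 z = S.1 (T.1 z) := rfl

@[simp] theorem one_apply (z : Z) : (1 : MPMap m).1 z = z := rfl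

theorem inv_val (T : MPMap m) : (T⁻¹).1 = T.1.symm := rfl

@[simp] theorem inv_apply_self (T : MPMap m) (z : Z) : (T⁻¹).1 (T.1 z) = z :=
  T.1.symm_apply_apply z

@[simp] theorem apply_inv_self (T : MPMap m) (z : Z) : T.1 ((T⁻¹).1 z) = z :=
  T.1.apply_symm_apply z

theorem coe_pow (T : MPMap m) (n : ℕ) : ⇑(T ^ n).1 = T.1^[n] := by
  induction n with
  | zero => rfl
  | succ n ih => ext z; rw [pow_succ, mul_apply, ih, Function.iterate_succ_apply]

theorem zpow_add_apply (T : MPMap m) (a b : ℤ) (z : Z) :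
    (T ^ (a + b)).1 z = (T ^ a).1 ((T ^ b).1 z) := by
  rw [zpow_add, mul_apply]

theorem measureReal_preimage (T : MPMap m) {B : Set Z} (hB : MeasurableSet B) :
    m.real (T.1 ⁻¹' B) = m.real B := by
  rw [measureReal_def, measureReal_def, T.2.measure_preimage hB.nullMeasurableSet]

theorem measureReal_image (T : MPMap m) {B : Set Z} (hB : MeasurableSet B) :
    m.real (T.1 '' B) = m.real B := by
  rw [MeasurableEquiv.image_eq_preimage_symm]
  exact measureReal_preimage T⁻¹ hB

/-- A measurable bijection of a standard Borel space is a measurable equivalence. -/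
noncomputable def measurableEquivOfBijective [StandardBorelSpace Z] (f : Z → Z)
    (hf : Measurable f) (hbij : Function.Bijective f) : Z ≃ᵐ Z where
  toEquiv := Equiv.ofBijective f hbij
  measurable_toFun := hf
  measurable_invFun := by
    intro s hs
    convert (hf.measurableEmbedding hbij.1).measurableSet_image.2 hs
    exact ((Equiv.ofBijective f hbij).image_eq_preimage_symm s).symm

/-- A bijection which is countably piecewise given by measure-preserving transformations. -/
theorem exists_mpMap_of_piecewise [StandardBorelSpace Z] {ι : Type*} [Countable ι]
    [MeasurableSpace ι] [MeasurableSingletonClass ι] (G : ι → MPMap m) (k : Z → ι)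
    (hk : Measurable k) (hbij : Function.Bijective fun z => (G (k z)).1 z) :
    ∃ T : MPMap m, ∀ z, T.1 z = (G (k z)).1 z := by
  set f : Z → Z := fun z => (G (k z)).1 z with hf
  have hmeas : Measurable f := by
    have h : Measurable fun p : ι × Z => (G p.1).1 p.2 :=
      measurable_from_prod_countable_right fun i => (G i).1.measurable
    exact h.comp (hk.prodMk measurable_id)
  have hemb := hmeas.measurableEmbedding hbij.1
  refine ⟨⟨measurableEquivOfBijective f hmeas hbij, hmeas, ?_⟩, fun z => rfl⟩
  ext S hS
  change (m.map f) S = m S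
  rw [Measure.map_apply hmeas hS]
  have hpiece : ∀ i, MeasurableSet (k ⁻¹' {i}) := fun i => hk (measurableSet_singleton i)
  have h1 : f ⁻¹' S = ⋃ i, (k ⁻¹' {i} ∩ (G i).1 ⁻¹' S) := by
    ext z; simp [hf]
  have h2 : S = ⋃ i, (f '' (k ⁻¹' {i}) ∩ S) := by
    rw [← Set.iUnion_inter, ← Set.image_iUnion, ← Set.preimage_iUnion]
    rw [Set.iUnion_of_singleton, Set.preimage_univ, Set.image_univ, hbij.2.range_eq,
      Set.univ_inter]
  have himg : ∀ i, f '' (k ⁻¹' {i}) = (G i).1 '' (k ⁻¹' {i}) := by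
    intro i
    refine Set.image_congr fun z hz => ?_
    simp only [Set.mem_preimage, Set.mem_singleton_iff] at hz
    simp [hf, hz]
  have hdis : Pairwise (Function.onFun Disjoint fun i => k ⁻¹' {i}) := by
    intro i j hij
    exact Disjoint.preimage _ (by simpa using hij)
  rw [h1, measure_iUnion (fun i j hij => (hdis hij).mono Set.inter_subset_left
    Set.inter_subset_left) fun i => (hpiece i).inter ((G i).1.measurable hS)]
  conv_rhs => rw [h2]
  rw [measure_iUnion]
  · refine tsum_congr fun i => ?_
    rw [himg i]
    have : k ⁻¹' {i} ∩ (G i).1 ⁻¹' S = (G i).1 ⁻¹' ((G i).1 '' (k ⁻¹' {i}) ∩ S) := by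
      rw [Set.preimage_inter, (G i).1.injective.preimage_image]
    rw [this, (G i).2.measure_preimage]
    exact (((G i).1.measurableSet_image.2 (hpiece i)).inter hS).nullMeasurableSet
  · intro i j hij
    exact ((Set.disjoint_image_iff hbij.1).2 (hdis hij)).mono Set.inter_subset_left
      Set.inter_subset_left
  · exact fun i => (hemb.measurableSet_image.2 (hpiece i)).inter hS

end Group

/-! ### Estimates for the Halmos distance -/

theorem symmDiff_preimage_subset_ne {Z Z' : Type*} (f g : Z → Z') (B : Set Z') :
    (f ⁻¹' B) ∆ (g ⁻¹' B) ⊆ {z | f z ≠ g z} := by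
  intro z hz hfg
  rw [Set.mem_symmDiff] at hz
  simp [hfg] at hz

section Halmos

variable {Z : Type*} [MeasurableSpace Z] {m : Measure Z}

theorem halmosTerm_eq (A : DenseFamily m) (R T : MPMap m) (i : ℕ) :
    halmosTerm A R T i = m.real (((R⁻¹).1 ⁻¹' A.sets i) ∆ ((T⁻¹).1 ⁻¹' A.sets i)) +
      m.real ((R.1 ⁻¹' A.sets i) ∆ (T.1 ⁻¹' A.sets i)) := by
  unfold halmosTerm
  simp only [MeasurableEquiv.image_eq_preimage_symm, MeasurableEquiv.symm_symm, inv_val]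

variable [IsProbabilityMeasure m]

theorem halmosTerm_le_two (A : DenseFamily m) (R T : MPMap m) (i : ℕ) :
    halmosTerm A R T i ≤ 2 := by
  unfold halmosTerm
  linarith [measureReal_le_one (μ := m) (s := (R.1 '' A.sets i) ∆ (T.1 '' A.sets i)),
    measureReal_le_one (μ := m) (s := (R.1.symm '' A.sets i) ∆ (T.1.symm '' A.sets i))]

/-- The first `K` weights add up to at most `1`, and every later term is at most `2`, so the tail is
geometric. Only finitely many sets of the family have to be controlled. -/
theorem halmosDist_le (A : DenseFamily m) (R T : MPMap m) {η : ℝ} (K : ℕ)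
    (h : ∀ i < K, halmosTerm A R T i ≤ η) (hη : 0 ≤ η) :
    halmosDist A R T ≤ η + 2 * (1 / 2) ^ K := by
  have hg := summable_geometric_two
  have hg1 : ∑' i : ℕ, (1 / 2 : ℝ) ^ i = 2 := tsum_geometric_two
  have hs := halmosTerm_summable A R T
  unfold halmosDist
  rw [← hs.sum_add_tsum_nat_add K]
  refine add_le_add ?_ ?_
  · calc ∑ i ∈ Finset.range K, (1 / 2 : ℝ) ^ (i + 1) * halmosTerm A R T i
        ≤ ∑ i ∈ Finset.range K, (1 / 2 : ℝ) ^ i * (η / 2) := by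
          refine Finset.sum_le_sum fun i hi => ?_
          rw [pow_succ, mul_assoc]
          refine mul_le_mul_of_nonneg_left ?_ (by positivity)
          linarith [h i (Finset.mem_range.1 hi)]
      _ = (∑ i ∈ Finset.range K, (1 / 2 : ℝ) ^ i) * (η / 2) := by rw [Finset.sum_mul]
      _ ≤ 2 * (η / 2) := by
          refine mul_le_mul_of_nonneg_right ?_ (by linarith)
          exact (hg.sum_le_tsum _ fun i _ => by positivity).trans hg1.le
      _ = η := by ring
  · calc ∑' i, (1 / 2 : ℝ) ^ (i + K + 1) * halmosTerm A R T (i + K)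
        ≤ ∑' i : ℕ, (1 / 2 : ℝ) ^ i * (1 / 2) ^ K := by
          refine ((summable_nat_add_iff K).2 hs).tsum_le_tsum (fun i => ?_) (hg.mul_right _)
          rw [pow_succ, pow_add, mul_assoc]
          refine mul_le_of_le_one_right (by positivity) ?_
          linarith [halmosTerm_le_two A R T (i + K)]
      _ = 2 * (1 / 2) ^ K := by rw [tsum_mul_right, hg1]

theorem halmosTerm_le_of_dist (A : DenseFamily m) (R T : MPMap m) (i : ℕ) :
    halmosTerm A R T i ≤ 2 ^ (i + 1) * halmosDist A R T := by
  have h := (halmosTerm_summable A R T).le_tsum i fun j _ =>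
    mul_nonneg (by positivity) (halmosTerm_nonneg A R T j)
  change _ ≤ halmosDist A R T at h
  calc halmosTerm A R T i
      = 2 ^ (i + 1) * ((1 / 2 : ℝ) ^ (i + 1) * halmosTerm A R T i) := by
        rw [← mul_assoc, ← mul_pow]; norm_num
    _ ≤ _ := by gcongr

/-- If the inverses differ at `z`, then `R` and `T` differ at the `R`-preimage of `z`. The
disagreement set of the inverses therefore lies in the `R`-image of that of the maps, which has the
same measure. -/
theorem halmosTerm_le_of_ne [StandardBorelSpace Z] (A : DenseFamily m) (R T : MPMap m) (i : ℕ) :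
    halmosTerm A R T i ≤ 2 * m.real {z | R.1 z ≠ T.1 z} := by
  have hmeas : MeasurableSet {z | R.1 z ≠ T.1 z} :=
    (measurableSet_eq_fun R.1.measurable T.1.measurable).compl
  rw [halmosTerm_eq, two_mul]
  refine add_le_add ?_ (measureReal_mono (symmDiff_preimage_subset_ne _ _ _))
  refine (measureReal_mono (symmDiff_preimage_subset_ne _ _ _)).trans ?_
  rw [← measureReal_image R hmeas]
  refine measureReal_mono fun z (hz : _ ≠ _) => ⟨(R⁻¹).1 z, fun h => hz ?_, apply_inv_self R z⟩
  rw [apply_inv_self] at h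
  conv_rhs => rw [h]
  rw [inv_apply_self]

/-- Transformations that are close in the Halmos metric move any measurable set in nearly the
same way. -/
theorem exists_symmDiff_lt (A : DenseFamily m) {B : Set Z} (hB : MeasurableSet B) {ε : ℝ}
    (hε : 0 < ε) : ∃ δ > 0, ∀ R T : MPMap m, halmosDist A R T < δ →
      m.real ((R.1 ⁻¹' B) ∆ (T.1 ⁻¹' B)) < ε ∧
      m.real (((R⁻¹).1 ⁻¹' B) ∆ ((T⁻¹).1 ⁻¹' B)) < ε := by
  obtain ⟨i, hi⟩ := A.dense B hB (ε / 4) (by linarith)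
  -- The factor undoes the `i`-th weight, so the `i`-th term is below `ε / 4`. Replacing `B` by the
  -- approximating set under each of the two maps costs two further errors of this size.
  refine ⟨ε / 4 / 2 ^ (i + 1), by positivity, fun R T h => ?_⟩
  have h1 := halmosTerm_le_of_dist A R T i
  have h2 : 2 ^ (i + 1) * halmosDist A R T < ε / 4 := by
    rw [lt_div_iff₀ (by positivity)] at h; linarith
  rw [halmosTerm_eq] at h1
  have key : ∀ U V : MPMap m, m.real ((U.1 ⁻¹' A.sets i) ∆ (V.1 ⁻¹' A.sets i)) < ε / 4 →
      m.real ((U.1 ⁻¹' B) ∆ (V.1 ⁻¹' B)) < ε := by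
    intro U V hUV
    have e1 := measureReal_symmDiff_le (μ := m) (s := U.1 ⁻¹' B) (t := U.1 ⁻¹' A.sets i)
      (V.1 ⁻¹' B)
    have e2 := measureReal_symmDiff_le (μ := m) (s := U.1 ⁻¹' A.sets i) (t := V.1 ⁻¹' A.sets i)
      (V.1 ⁻¹' B)
    have e3 := measureReal_preimage U (hB.symmDiff (A.measurable i))
    have e4 := measureReal_preimage V (hB.symmDiff (A.measurable i))
    rw [Set.preimage_symmDiff] at e3 e4
    rw [symmDiff_comm] at e4
    linarith
  refine ⟨key _ _ ?_, key _ _ ?_⟩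
  · linarith [measureReal_nonneg (μ := m) (s := ((R⁻¹).1 ⁻¹' A.sets i) ∆ ((T⁻¹).1 ⁻¹' A.sets i))]
  · linarith [measureReal_nonneg (μ := m) (s := (R.1 ⁻¹' A.sets i) ∆ (T.1 ⁻¹' A.sets i))]

end Halmos

/-! ### Transformations covering a transformation of the base -/

section Over

variable {X : Type*} [MeasurableSpace X] {μ : Measure X} [IsProbabilityMeasure μ]

/-- `R` covers the transformation `s` of the base. -/
def IsOver (s : MPMap μ) (R : MPMap (μ.prod μ)) : Prop :=
  ∀ z, (R.1 z).1 = s.1 z.1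

theorem IsOver.one : IsOver (1 : MPMap μ) 1 := fun _ => rfl

theorem IsOver.mul {s t : MPMap μ} {R T : MPMap (μ.prod μ)} (hR : IsOver s R)
    (hT : IsOver t T) : IsOver (s * t) (R * T) := fun z => by
  rw [mul_apply, hR, hT, mul_apply]

theorem IsOver.inv {s : MPMap μ} {R : MPMap (μ.prod μ)} (hR : IsOver s R) :
    IsOver s⁻¹ R⁻¹ := fun z => by
  have h := hR ((R⁻¹).1 z)
  rw [apply_inv_self] at h
  rw [h, inv_apply_self]

theorem IsOver.pow {s : MPMap μ} {R : MPMap (μ.prod μ)} (hR : IsOver s R) (n : ℕ) :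
    IsOver (s ^ n) (R ^ n) := by
  induction n with
  | zero => simpa using IsOver.one
  | succ n ih => rw [pow_succ, pow_succ]; exact ih.mul hR

theorem IsOver.zpow {s : MPMap μ} {R : MPMap (μ.prod μ)} (hR : IsOver s R) (n : ℤ) :
    IsOver (s ^ n) (R ^ n) := by
  cases n with
  | ofNat n => simpa using hR.pow n
  | negSucc n => rw [zpow_negSucc, zpow_negSucc]; exact (hR.pow _).inv

theorem isOver_skewProduct (s : MPMap μ) (F : MeasurableFamily X μ) :
    IsOver s (skewProduct s F) := fun _ => rfl

variable [StandardBorelSpace X]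

/-- Almost every fibre map of a measure-preserving transformation covering `s` preserves the
measure of the fibre. -/
theorem IsOver.ae_measurePreserving {s : MPMap μ} {R : MPMap (μ.prod μ)} (hR : IsOver s R) :
    ∀ᵐ x ∂μ, MeasurePreserving (fun y => (R.1 (x, y)).2) μ μ := by
  have hm : Measurable fun p : X × X => (R.1 p).2 := measurable_snd.comp R.1.measurable
  -- The kernel `κ` sends `x` to the image of `μ` under the fibre map at `x`. Uniqueness of
  -- disintegrations identifies it with the constant kernel almost everywhere.
  let κ : ProbabilityTheory.Kernel X X :=
    (ProbabilityTheory.Kernel.id ×ₖ ProbabilityTheory.Kernel.const X μ).map fun p => (R.1 p).2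
  have hκ : ∀ x, κ x = μ.map fun y => (R.1 (x, y)).2 := by
    intro x
    rw [ProbabilityTheory.Kernel.map_apply _ hm, ProbabilityTheory.Kernel.prod_apply,
      ProbabilityTheory.Kernel.id_apply, ProbabilityTheory.Kernel.const_apply,
      Measure.dirac_prod, Measure.map_map hm measurable_prodMk_left]
    rfl
  have : ProbabilityTheory.IsMarkovKernel κ := ProbabilityTheory.Kernel.IsMarkovKernel.map _ hm
  have heq : μ ⊗ₘ κ = μ ⊗ₘ (ProbabilityTheory.Kernel.const X μ) := by
    ext S hS
    rw [Measure.compProd_apply hS, Measure.compProd_apply hS]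
    -- Undoing `s` on the first coordinate after `R` leaves only the fibre maps.
    have hT : MeasurePreserving (fun p : X × X => (p.1, (R.1 p).2)) (μ.prod μ) (μ.prod μ) := by
      have h1 : MeasurePreserving (Prod.map s.1.symm id) (μ.prod μ) (μ.prod μ) :=
        s.symm_mp.prod (MeasurePreserving.id μ)
      convert h1.comp R.2 using 1
      ext p
      · simp [hR p]
      · simp
    have h2 := hT.measure_preimage hS.nullMeasurableSet
    rw [Measure.prod_apply hS, Measure.prod_apply (hT.measurable hS)] at h2
    simp only [ProbabilityTheory.Kernel.const_apply]
    rw [← h2]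
    refine lintegral_congr fun x => ?_
    rw [hκ, Measure.map_apply (f := fun y => (R.1 (x, y)).2) (hm.comp measurable_prodMk_left)
      (measurable_prodMk_left hS)]
    rfl
  filter_upwards [ProbabilityTheory.Kernel.ae_eq_of_compProd_eq heq] with x hx
  refine ⟨hm.comp measurable_prodMk_left, ?_⟩
  rw [← hκ, hx, ProbabilityTheory.Kernel.const_apply]

/-- An invertible measure-preserving transformation covering `s` is an extension of `s`. -/
theorem IsOver.mk_mem_ext {s : MPMap μ} {R : MPMap (μ.prod μ)} (hR : IsOver s R) :
    Aut.mk R ∈ Ext (Aut.mk s) := by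
  classical
  obtain ⟨N, hNsub, hNmeas, hN0⟩ := exists_measurable_superset_of_null
    (ae_iff.1 hR.ae_measurePreserving)
  let e : X → X ≃ᵐ X := fun x =>
    { toFun := fun y => (R.1 (x, y)).2
      invFun := fun y => ((R⁻¹).1 (s.1 x, y)).2
      left_inv := fun y => by
        have h : (s.1 x, (R.1 (x, y)).2) = R.1 (x, y) := Prod.ext (hR (x, y)).symm rfl
        dsimp only
        rw [h, inv_apply_self]
      right_inv := fun y => by
        have h : (x, ((R⁻¹).1 (s.1 x, y)).2) = (R⁻¹).1 (s.1 x, y) := by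
          refine Prod.ext ?_ rfl
          rw [hR.inv]
          exact (inv_apply_self s x).symm
        dsimp only
        rw [h, apply_inv_self]
      measurable_toFun := measurable_snd.comp (R.1.measurable.comp measurable_prodMk_left)
      measurable_invFun := measurable_snd.comp ((R⁻¹).1.measurable.comp measurable_prodMk_left) }
  have he : ∀ x, x ∉ N → MeasurePreserving (e x) μ μ := by
    intro x hx
    by_contra h
    exact hx (hNsub h)
  have hNm : MeasurableSet {p : X × X | p.1 ∈ N} := measurable_fst hNmeas
  -- On the null set `N` of bad fibres the map is replaced by the identity, which does not change
  -- the class.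
  let F : MeasurableFamily X μ :=
    { fib := fun x => if hx : x ∈ N then 1 else ⟨e x, he x hx⟩
      measurable_fib := by
        have h : (fun p : X × X => (if hx : p.1 ∈ N then (1 : MPMap μ)
            else ⟨e p.1, he p.1 hx⟩).1 p.2) =
            fun p => if p.1 ∈ N then p.2 else (R.1 p).2 := by
          ext p
          by_cases hp : p.1 ∈ N <;> simp [hp, e]
        rw [h]
        exact Measurable.ite hNm measurable_snd (measurable_snd.comp R.1.measurable)
      measurable_symm := by
        have h : (fun p : X × X => (if hx : p.1 ∈ N then (1 : MPMap μ)
            else ⟨e p.1, he p.1 hx⟩).1.symm p.2) =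
            fun p => if p.1 ∈ N then p.2 else ((R⁻¹).1 (s.1 p.1, p.2)).2 := by
          ext p
          by_cases hp : p.1 ∈ N
          · simp only [hp, dite_true, if_true]; rfl
          · simp only [hp, dite_false, if_false]; rfl
        rw [h]
        exact Measurable.ite hNm measurable_snd (measurable_snd.comp ((R⁻¹).1.measurable.comp
          ((s.1.measurable.comp measurable_fst).prodMk measurable_snd))) }
  refine ⟨s, F, rfl, Quotient.sound ?_⟩
  have hae : ∀ᵐ p : X × X ∂μ.prod μ, p.1 ∉ N :=
    Measure.quasiMeasurePreserving_fst.ae (compl_mem_ae_iff.2 hN0)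
  filter_upwards [hae] with p hp
  refine Prod.ext (hR p).symm ?_
  change ((F.fib p.1).1 p.2) = _
  simp only [F, hp, dite_false]
  rfl

/-- Every extension of the class of `s` is the class of a transformation covering `s`. -/
theorem exists_isOver_of_mem_ext {s : MPMap μ} {R : Aut (μ.prod μ)} (hR : R ∈ Ext (Aut.mk s)) :
    ∃ T : MPMap (μ.prod μ), IsOver s T ∧ Aut.mk T = R := by
  obtain ⟨s', F, hs, rfl⟩ := hR
  have hss : ⇑s'.1 =ᵐ[μ] ⇑s.1 := Quotient.exact hs
  refine ⟨skewProduct s F, isOver_skewProduct s F, Quotient.sound ?_⟩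
  filter_upwards [Measure.quasiMeasurePreserving_fst.ae hss] with p hp
  exact Prod.ext hp.symm rfl

/-! ### Realizing almost everywhere defined transformations -/

section Realize

variable [NullSingletonClass μ]

theorem not_countable_of_nullSingleton (μ : Measure X) [IsProbabilityMeasure μ]
    [NullSingletonClass μ] : ¬ Countable X := by
  intro h
  have h1 : μ Set.univ = 0 := Set.countable_univ.measure_zero μ
  simp at h1

/-- There is a copy of `X` inside a null subset of `X`. -/
theorem exists_null_embedding :
    ∃ κ : X → X, MeasurableEmbedding κ ∧ μ (Set.range κ) = 0 := by
  have hX : ¬ Countable X := not_countable_of_nullSingleton μ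
  have hRR : ¬ Countable (ℝ × ℝ) := by
    intro h
    exact not_countable (α := ℝ) (Function.Injective.countable (f := fun x : ℝ => (x, x))
      fun a b h => (Prod.ext_iff.1 h).1)
  have hR : ¬ Countable ℝ := not_countable
  let a : X ≃ᵐ ℝ × ℝ := PolishSpace.measurableEquivOfNotCountable hX hRR
  let b : X ≃ᵐ ℝ := PolishSpace.measurableEquivOfNotCountable hX hR
  -- Only countably many of the disjoint lines `{t} × ℝ` carry mass, so some line is null; it
  -- contains a Borel copy of `X`.
  have hc : Set.Countable {t : ℝ | 0 < μ {x | (a x).1 = t}} :=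
    Measure.countable_meas_level_set_pos (measurable_fst.comp a.measurable)
  obtain ⟨t, ht⟩ : ∃ t, t ∉ {t : ℝ | 0 < μ {x | (a x).1 = t}} := by
    by_contra! h
    exact not_countable (α := ℝ) (Set.countable_univ_iff.1 (hc.mono fun x _ => h x))
  simp only [Set.mem_ofPred_eq, not_lt, nonpos_iff_eq_zero] at ht
  refine ⟨fun x => a.symm (t, b x), ?_, measure_mono_null ?_ ht⟩
  · exact a.symm.measurableEmbedding.comp
      ((measurableEmbedding_prodMk_left t).comp b.measurableEmbedding)
  · rintro _ ⟨x, rfl⟩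
    simp

/-- A fibred form of the Schröder–Bernstein theorem. -/
theorem exists_fibred_embedding {κ : X → X} (hκ : MeasurableEmbedding κ) {N : Set (X × X)}
    (hN : MeasurableSet N) (hκN : ∀ z : X × X, (z.1, κ z.2) ∈ N) :
    ∃ β : X × X → X × X, MeasurableEmbedding β ∧ Set.range β = N ∧ ∀ z, (β z).1 = z.1 := by
  classical
  set f : X × X → X × X := Prod.map id κ with hf
  have hfinj : Function.Injective f := Function.injective_id.prodMap hκ.injective
  have hfm : Measurable f := measurable_id.prodMap hκ.measurable
  have hfe : MeasurableEmbedding f := hfm.measurableEmbedding hfinj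
  -- This is a Hilbert hotel: `A` is the disjoint union of `Nᶜ` and `f '' A`, so applying `f` on `A`
  -- and the identity elsewhere maps everything onto `N`. Since `f` fixes first coordinates, so does
  -- the resulting map.
  set A : Set (X × X) := ⋃ j : ℕ, f^[j] '' Nᶜ with hA
  have hfj : ∀ j : ℕ, MeasurableEmbedding f^[j] := fun j =>
    (hfm.iterate j).measurableEmbedding (hfinj.iterate j)
  have hAm : MeasurableSet A :=
    MeasurableSet.iUnion fun j => (hfj j).measurableSet_image.2 hN.compl
  have hAf : ∀ z ∈ A, f z ∈ A := by
    intro z hz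
    obtain ⟨j, w, hw, rfl⟩ := Set.mem_iUnion.1 hz
    refine Set.mem_iUnion.2 ⟨j + 1, w, hw, ?_⟩
    rw [Function.iterate_succ_apply']
  have hAN : ∀ z ∈ A, z ∈ N → ∃ w ∈ A, f w = z := by
    intro z hz hzN
    obtain ⟨j, w, hw, rfl⟩ := Set.mem_iUnion.1 hz
    cases j with
    | zero => exact absurd hzN hw
    | succ j =>
      exact ⟨f^[j] w, Set.mem_iUnion.2 ⟨j, w, hw, rfl⟩, (Function.iterate_succ_apply' f j w).symm⟩
  have hNA : ∀ z, z ∉ A → z ∈ N := by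
    intro z hz
    by_contra h
    exact hz (Set.mem_iUnion.2 ⟨0, z, h, rfl⟩)
  set β : X × X → X × X := fun z => if z ∈ A then f z else z with hβ
  have hβm : Measurable β := Measurable.ite hAm hfm measurable_id
  have hβinj : Function.Injective β := by
    intro z w hzw
    simp only [hβ] at hzw
    split_ifs at hzw with h1 h2 h2
    · exact hfinj hzw
    · exact absurd (hzw ▸ hAf z h1) h2
    · exact absurd (hzw ▸ hAf w h2) h1
    · exact hzw
  refine ⟨β, hβm.measurableEmbedding hβinj, ?_, ?_⟩
  · ext z
    constructor
    · rintro ⟨w, rfl⟩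
      by_cases hw : w ∈ A
      · simp only [hβ, hw, if_true]; exact hκN w
      · simp only [hβ, hw, if_false]; exact hNA w hw
    · intro hz
      by_cases hzA : z ∈ A
      · obtain ⟨w, hw, rfl⟩ := hAN z hzA hz
        exact ⟨w, by simp [hβ, hw]⟩
      · exact ⟨z, by simp [hβ, hzA]⟩
  · intro z
    simp only [hβ]
    split_ifs <;> simp [hf]

/-- A measure-preserving map of `X × X` which covers `s` and is invertible, both almost everywhere,
agrees almost everywhere with an everywhere invertible one which covers `s` everywhere. -/
theorem exists_isOver_ae_eq (s : MPMap μ) {r r' : X × X → X × X}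
    (hr : MeasurePreserving r (μ.prod μ) (μ.prod μ))
    (hr' : MeasurePreserving r' (μ.prod μ) (μ.prod μ))
    (h1 : ∀ᵐ z ∂μ.prod μ, r' (r z) = z) (hs : ∀ᵐ z ∂μ.prod μ, (r z).1 = s.1 z.1) :
    ∃ R : MPMap (μ.prod μ), IsOver s R ∧ ⇑R.1 =ᵐ[μ.prod μ] r := by
  classical
  obtain ⟨κ, hκ, hκ0⟩ := exists_null_embedding (μ := μ)
  set K := Set.range κ with hK
  have hKm : MeasurableSet K := hκ.measurableSet_range
  -- Besides the points where `r` misbehaves, everything touching `K` is discarded. The complements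
  -- of `G` and of its image `G'` then both contain all points with second coordinate in `K`, so
  -- each can be identified with `X × X` fibre by fibre, and one can be mapped onto the other over
  -- `s`.
  set G : Set (X × X) := {z | r' (r z) = z ∧ (r z).1 = s.1 z.1 ∧ z.2 ∉ K ∧ (r z).2 ∉ K} with hG
  have hGm : MeasurableSet G := by
    refine (measurableSet_eq_fun (hr'.measurable.comp hr.measurable) measurable_id).inter
      ((measurableSet_eq_fun (measurable_fst.comp hr.measurable)
        (s.1.measurable.comp measurable_fst)).inter ?_)
    exact (measurable_snd hKm.compl).inter ((measurable_snd.comp hr.measurable) hKm.compl)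
  have hKae : ∀ᵐ z : X × X ∂μ.prod μ, z.2 ∉ K :=
    Measure.quasiMeasurePreserving_snd.ae (compl_mem_ae_iff.2 hκ0)
  have hGae : ∀ᵐ z ∂μ.prod μ, z ∈ G := by
    filter_upwards [h1, hs, hKae, hr.quasiMeasurePreserving.ae hKae] with z a b c d
    exact ⟨a, b, c, d⟩
  set G' : Set (X × X) := {w | r' w ∈ G ∧ r (r' w) = w} with hG'
  have hG'm : MeasurableSet G' :=
    (hr'.measurable hGm).inter
      (measurableSet_eq_fun (hr.measurable.comp hr'.measurable) measurable_id)
  have hrG : ∀ z ∈ G, r z ∈ G' := fun z hz => by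
    refine ⟨?_, ?_⟩
    · rw [hz.1]; exact hz
    · rw [hz.1]
  obtain ⟨β, hβ, hβr, hβ1⟩ := exists_fibred_embedding hκ hGm.compl
    fun z hz => hz.2.2.1 ⟨z.2, rfl⟩
  obtain ⟨β', hβ', hβr', hβ1'⟩ := exists_fibred_embedding hκ hG'm.compl
    fun z hz => hz.1.2.2.2 (by rw [hz.2]; exact ⟨z.2, rfl⟩)
  let σ : X × X ≃ᵐ X × X := s.1.prodCongr (MeasurableEquiv.refl X)
  have hne : Nonempty X := by
    by_contra h
    rw [not_nonempty_iff] at h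
    exact not_countable_of_nullSingleton μ inferInstance
  obtain ⟨ψ, hψm, hψ⟩ := hβ.exists_measurable_extend (hβ'.measurable.comp σ.measurable)
    fun _ => inferInstance
  have hψ' : ∀ z, ψ (β z) = β' (σ z) := fun z => congrFun hψ z
  -- Off `G` this is `β' ∘ σ ∘ β⁻¹`, where `σ` acts as `s` on the base.
  set T : X × X → X × X := fun z => if z ∈ G then r z else ψ z with hT
  have hTm : Measurable T := Measurable.ite hGm hr.measurable hψm
  have hTβ : ∀ z, T (β z) = β' (σ z) := by
    intro z
    have : β z ∉ G := by
      have : β z ∈ Gᶜ := hβr ▸ Set.mem_range_self z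
      exact this
    simp only [hT, this, if_false, hψ']
  have hcases : ∀ z, z ∈ G ∨ ∃ w, β w = z := by
    intro z
    by_cases hz : z ∈ G
    · exact Or.inl hz
    · right
      have : z ∈ Set.range β := hβr ▸ hz
      exact this
  have hTG : ∀ z ∈ G, T z = r z := fun z hz => by simp [hT, hz]
  have hβG' : ∀ z, β' z ∉ G' := fun z => by
    have : β' z ∈ G'ᶜ := hβr' ▸ Set.mem_range_self z
    exact this
  have hTbij : Function.Bijective T := by
    constructor
    · intro z w hzw
      rcases hcases z with hz | ⟨z, rfl⟩ <;> rcases hcases w with hw | ⟨w, rfl⟩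
      · rw [hTG z hz, hTG w hw] at hzw
        rw [← hz.1, ← hw.1, hzw]
      · rw [hTG z hz, hTβ] at hzw
        exact absurd (hzw ▸ hrG z hz) (hβG' _)
      · rw [hTG w hw, hTβ] at hzw
        exact absurd (hzw ▸ hrG w hw) (hβG' _)
      · rw [hTβ, hTβ] at hzw
        rw [σ.injective (hβ'.injective hzw)]
    · intro w
      by_cases hw : w ∈ G'
      · exact ⟨r' w, by rw [hTG _ hw.1, hw.2]⟩
      · have : w ∈ Set.range β' := hβr' ▸ hw
        obtain ⟨z, rfl⟩ := this
        exact ⟨β (σ.symm z), by rw [hTβ, σ.apply_symm_apply]⟩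
  have hTae : T =ᵐ[μ.prod μ] r := hGae.mono fun z hz => hTG z hz
  refine ⟨⟨measurableEquivOfBijective T hTm hTbij, hTm, ?_⟩, ?_, hTae⟩
  · exact (Measure.map_congr hTae).trans hr.map_eq
  · intro z
    change (T z).1 = _
    rcases hcases z with hz | ⟨z, rfl⟩
    · rw [hTG z hz]; exact hz.2.1
    · rw [hTβ, hβ1', hβ1]; rfl

end Realize

end Over

/-! ### Completeness of the space of extensions -/

section Limits

variable {Z : Type*} [MeasurableSpace Z] {m : Measure Z} [IsProbabilityMeasure m]

section Metric

variable [MetricSpace Z] [SecondCountableTopology Z] [BorelSpace Z]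

/-- If the preimages of every measurable set form a Cauchy sequence, then the transformations form
a Cauchy sequence in measure. -/
theorem eventually_measureReal_dist_lt {r : ℕ → MPMap m}
    (hC : ∀ B, MeasurableSet B → ∀ ε : ℝ, 0 < ε → ∃ N, ∀ k ≥ N, ∀ l ≥ N,
      m.real (((r k).1 ⁻¹' B) ∆ ((r l).1 ⁻¹' B)) < ε) {ε : ℝ} (hε : 0 < ε) :
    ∃ N, ∀ k ≥ N, ∀ l ≥ N, m.real {z | ε ≤ dist ((r k).1 z) ((r l).1 z)} ≤ ε := by
  have hne : Nonempty Z := m.nonempty_of_neZero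
  set x : ℕ → Z := TopologicalSpace.denseSeq Z
  set C : ℕ → Set Z := fun j => Metric.ball (x j) (ε / 2) with hCdef
  have hCm : ∀ j, MeasurableSet (C j) := fun j => measurableSet_ball
  set D : ℕ → Set Z := fun J => (⋃ j < J, C j)ᶜ with hD
  have hDm : ∀ J, MeasurableSet (D J) := fun J =>
    (MeasurableSet.iUnion fun j => MeasurableSet.iUnion fun _ => hCm j).compl
  have hDanti : Antitone D := by
    intro a b hab
    refine Set.compl_subset_compl.2 (Set.iUnion₂_subset fun j hj => ?_)
    exact Set.subset_biUnion_of_mem (u := C) (show j ∈ {j | j < b} from lt_of_lt_of_le hj hab)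
  have hDempty : ⋂ J, D J = ∅ := by
    ext z
    simp only [Set.mem_iInter, Set.mem_empty_iff_false, iff_false, not_forall]
    obtain ⟨j, hj⟩ := (TopologicalSpace.denseRange_denseSeq Z).exists_dist_lt z
      (half_pos hε)
    refine ⟨j + 1, fun h => h ?_⟩
    exact Set.mem_biUnion (show j ∈ {i | i < j + 1} from Nat.lt_succ_self j) hj
  have hlim : Tendsto (fun J => m.real (D J)) atTop (𝓝 0) := by
    have h := tendsto_measure_iInter_atTop (μ := m) (fun J => (hDm J).nullMeasurableSet) hDanti
      ⟨0, measure_ne_top m _⟩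
    rw [hDempty, measure_empty] at h
    exact (ENNReal.tendsto_toReal ENNReal.zero_ne_top).comp h
  obtain ⟨J, hJ⟩ := (hlim.eventually (gt_mem_nhds (half_pos hε))).exists
  -- The first `J` balls miss mass less than `ε / 2`, and the `J` symmetric differences together
  -- contribute at most another `ε / 2`. Points sharing a ball of radius `ε / 2` are closer than
  -- `ε`.
  choose N hN using fun j => hC (C j) (hCm j) (ε / 2 / (J + 1)) (by positivity)
  refine ⟨(Finset.range J).sup N, fun k hk l hl => ?_⟩
  have hsub : {z | ε ≤ dist ((r k).1 z) ((r l).1 z)} ⊆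
      ((r k).1 ⁻¹' D J) ∪ ⋃ j ∈ Finset.range J, (((r k).1 ⁻¹' C j) ∆ ((r l).1 ⁻¹' C j)) := by
    intro z (hz : ε ≤ _)
    by_cases h : (r k).1 z ∈ D J
    · exact Or.inl h
    · right
      simp only [hD, Set.mem_compl_iff, not_not, Set.mem_iUnion] at h
      obtain ⟨j, hj, hzj⟩ := h
      refine Set.mem_biUnion (Finset.mem_coe.2 (Finset.mem_range.2 hj)) ?_
      refine Or.inl ⟨hzj, fun hlj => ?_⟩
      have h1 : dist ((r k).1 z) (x j) < ε / 2 := hzj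
      have h2 : dist ((r l).1 z) (x j) < ε / 2 := hlj
      linarith [dist_triangle_right ((r k).1 z) ((r l).1 z) (x j)]
  calc m.real {z | ε ≤ dist ((r k).1 z) ((r l).1 z)}
      ≤ m.real ((r k).1 ⁻¹' D J) +
        m.real (⋃ j ∈ Finset.range J, (((r k).1 ⁻¹' C j) ∆ ((r l).1 ⁻¹' C j))) :=
        (measureReal_mono hsub).trans (measureReal_union_le _ _)
    _ ≤ m.real (D J) + ∑ j ∈ Finset.range J, ε / 2 / (J + 1) := by
        refine add_le_add (measureReal_preimage _ (hDm J)).le ?_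
        refine (measureReal_biUnion_finset_le _ _).trans (Finset.sum_le_sum fun j hj => ?_)
        have hj' : N j ≤ (Finset.range J).sup N := Finset.le_sup hj
        exact (hN j k (hj'.trans hk) l (hj'.trans hl)).le
    _ ≤ ε / 2 + ε / 2 := by
        refine add_le_add hJ.le ?_
        rw [Finset.sum_const, Finset.card_range, nsmul_eq_mul, mul_div_assoc',
          div_le_iff₀ (by positivity)]
        nlinarith
    _ = ε := by ring

/-- A sequence of transformations which is Cauchy in measure has an almost everywhere convergent
subsequence. -/
theorem exists_subseq_ae_tendsto [CompleteSpace Z] {r : ℕ → MPMap m}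
    (hC : ∀ B, MeasurableSet B → ∀ ε : ℝ, 0 < ε → ∃ N, ∀ k ≥ N, ∀ l ≥ N,
      m.real (((r k).1 ⁻¹' B) ∆ ((r l).1 ⁻¹' B)) < ε) :
    ∃ φ : ℕ → ℕ, StrictMono φ ∧ ∃ g : Z → Z, Measurable g ∧
      ∀ᵐ z ∂m, Tendsto (fun k => (r (φ k)).1 z) atTop (𝓝 (g z)) := by
  have h : ∀ i : ℕ, ∃ N, ∀ k ≥ N, ∀ l ≥ k,
      m.real {z | (1 / 2 : ℝ) ^ i ≤ dist ((r k).1 z) ((r l).1 z)} ≤ (1 / 2 : ℝ) ^ i := by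
    intro i
    obtain ⟨N, hN⟩ := eventually_measureReal_dist_lt hC (ε := (1 / 2 : ℝ) ^ i) (by positivity)
    exact ⟨N, fun k hk l hl => hN k hk l (hk.trans hl)⟩
  obtain ⟨φ, hφ, hφP⟩ := extraction_forall_of_eventually' h
  refine ⟨φ, hφ, measurable_limit_of_tendsto_metrizable_ae
    (fun n => (r (φ n)).1.measurable.aemeasurable) ?_⟩
  -- Summability feeds Borel–Cantelli: for almost every `z`, consecutive distances along the
  -- subsequence are eventually dominated by a geometric series.
  have hsum : ∑' i, m {z | (1 / 2 : ℝ) ^ i ≤ dist ((r (φ i)).1 z) ((r (φ (i + 1))).1 z)} ≠ ∞ := by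
    refine ne_top_of_le_ne_top (b := ∑' i : ℕ, ENNReal.ofReal ((1 / 2 : ℝ) ^ i)) ?_ ?_
    · rw [← ENNReal.ofReal_tsum_of_nonneg (fun i => by positivity) summable_geometric_two]
      exact ENNReal.ofReal_ne_top
    · refine ENNReal.tsum_le_tsum fun i => ?_
      rw [← ENNReal.ofReal_toReal (measure_ne_top m _)]
      exact ENNReal.ofReal_le_ofReal (hφP i (φ (i + 1)) (hφ (Nat.lt_succ_self i)).le)
  filter_upwards [ae_eventually_notMem hsum] with z hz
  refine cauchySeq_tendsto_of_complete (cauchySeq_of_summable_dist ?_)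
  refine Summable.of_norm_bounded_eventually_nat summable_geometric_two ?_
  filter_upwards [hz] with i hi
  simp only [not_le] at hi
  rw [Real.norm_of_nonneg dist_nonneg]
  exact hi.le

/-- Finite Borel measures on a metric space are determined by integrals of bounded continuous
functions, and these integrals pass to the limit by dominated convergence. -/
theorem measurePreserving_of_ae_tendsto {r : ℕ → MPMap m} {g : Z → Z} (hg : Measurable g)
    (h : ∀ᵐ z ∂m, Tendsto (fun k => (r k).1 z) atTop (𝓝 (g z))) : MeasurePreserving g m m := by
  refine ⟨hg, ?_⟩
  have : IsProbabilityMeasure (m.map g) := Measure.isProbabilityMeasure_map hg.aemeasurable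
  refine ext_of_forall_integral_eq_of_IsFiniteMeasure fun f => ?_
  rw [integral_map hg.aemeasurable f.continuous.aestronglyMeasurable]
  have h1 : Tendsto (fun k => ∫ z, f ((r k).1 z) ∂m) atTop (𝓝 (∫ z, f (g z) ∂m)) := by
    refine tendsto_integral_of_dominated_convergence (fun _ => ‖f‖)
      (fun k => (f.continuous.measurable.comp (r k).1.measurable).aestronglyMeasurable)
      (integrable_const _) (fun k => ae_of_all _ fun z => f.norm_coe_le_norm _) ?_
    filter_upwards [h] with z hz
    exact (f.continuous.tendsto _).comp hz
  have h2 : ∀ k, ∫ z, f ((r k).1 z) ∂m = ∫ z, f z ∂m := fun k =>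
    (r k).2.integral_comp' (g := f)
  simp only [h2] at h1
  exact tendsto_nhds_unique h1 tendsto_const_nhds

/-- The indicator of `B` is approximated in `L¹` by a bounded continuous function, for which
dominated convergence applies. All maps preserve `m`, so composing with them does not change the
approximation error. -/
theorem tendsto_symmDiff_of_ae_tendsto {r : ℕ → MPMap m} {g : Z → Z}
    (hg : MeasurePreserving g m m)
    (h : ∀ᵐ z ∂m, Tendsto (fun k => (r k).1 z) atTop (𝓝 (g z))) {B : Set Z}
    (hB : MeasurableSet B) :
    Tendsto (fun k => m.real (((r k).1 ⁻¹' B) ∆ (g ⁻¹' B))) atTop (𝓝 0) := by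
  set b : Z → ℝ := B.indicator 1 with hb
  have hbm : Measurable b := measurable_one.indicator hB
  have hbi : Integrable b m := (integrable_const (1 : ℝ)).indicator hB
  rw [Metric.tendsto_atTop]
  intro ε hε
  obtain ⟨f, hf, hfi⟩ := hbi.exists_boundedContinuous_integral_sub_le (show 0 < ε / 4 by linarith)
  have h1 : Tendsto (fun k => ∫ z, ‖f ((r k).1 z) - f (g z)‖ ∂m) atTop (𝓝 (∫ _, (0 : ℝ) ∂m)) := by
    refine tendsto_integral_of_dominated_convergence (fun _ => ‖f‖ + ‖f‖) (fun k => ?_)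
      (integrable_const _) (fun k => ae_of_all _ fun z => ?_) ?_
    · exact ((f.continuous.measurable.comp (r k).1.measurable).sub
        (f.continuous.measurable.comp hg.measurable)).norm.aestronglyMeasurable
    · rw [norm_norm]
      exact (norm_sub_le _ _).trans (add_le_add (f.norm_coe_le_norm _) (f.norm_coe_le_norm _))
    · filter_upwards [h] with z hz
      have := (((f.continuous.tendsto _).comp hz).sub_const (f (g z))).norm
      simpa using this
  rw [integral_zero] at h1
  obtain ⟨N, hN⟩ := Metric.tendsto_atTop.1 h1 (ε / 4) (by linarith)
  refine ⟨N, fun k hk => ?_⟩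
  have hN' := hN k hk
  rw [Real.dist_eq, sub_zero, abs_of_nonneg (integral_nonneg fun z => norm_nonneg _)] at hN'
  rw [Real.dist_eq, sub_zero, abs_of_nonneg measureReal_nonneg]
  have hmeas : MeasurableSet (((r k).1 ⁻¹' B) ∆ (g ⁻¹' B)) :=
    ((r k).1.measurable hB).symmDiff (hg.measurable hB)
  have hid : Integrable (fun z => ‖b z - f z‖) m := (hbi.sub hfi).norm
  have hir : ∀ {u : Z → Z}, MeasurePreserving u m m →
      Integrable (fun z => ‖b (u z) - f (u z)‖) m ∧
      ∫ z, ‖b (u z) - f (u z)‖ ∂m = ∫ z, ‖b z - f z‖ ∂m := by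
    intro u hu
    refine ⟨hu.integrable_comp_of_integrable hid, ?_⟩
    have := integral_map (μ := m) hu.measurable.aemeasurable (f := fun z => ‖b z - f z‖)
      (by rw [hu.map_eq]; exact hid.aestronglyMeasurable)
    rw [hu.map_eq] at this
    exact this.symm
  have hik : Integrable (fun z => ‖f ((r k).1 z) - f (g z)‖) m :=
    (((r k).2.integrable_comp_of_integrable hfi).sub (hg.integrable_comp_of_integrable hfi)).norm
  obtain ⟨i1, e1⟩ := hir (r k).2
  obtain ⟨i2, e2⟩ := hir hg
  calc m.real (((r k).1 ⁻¹' B) ∆ (g ⁻¹' B))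
      = ∫ z, (((r k).1 ⁻¹' B) ∆ (g ⁻¹' B)).indicator 1 z ∂m := (integral_indicator_one hmeas).symm
    _ ≤ ∫ z, (‖b ((r k).1 z) - f ((r k).1 z)‖ + ‖f ((r k).1 z) - f (g z)‖ +
          ‖b (g z) - f (g z)‖) ∂m := by
        refine integral_mono ((integrable_const (1 : ℝ)).indicator hmeas) ((i1.add hik).add i2)
          fun z => ?_
        have h3 : (((r k).1 ⁻¹' B) ∆ (g ⁻¹' B)).indicator (1 : Z → ℝ) z =
            ‖b ((r k).1 z) - b (g z)‖ := by
          by_cases h1 : (r k).1 z ∈ B <;> by_cases h2 : g z ∈ B <;>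
            simp [hb, Set.indicator, Set.mem_symmDiff, h1, h2]
        rw [h3]
        have h4 : b ((r k).1 z) - b (g z) = (b ((r k).1 z) - f ((r k).1 z)) +
          (f ((r k).1 z) - f (g z)) - (b (g z) - f (g z)) := by ring
        rw [h4]
        exact (norm_sub_le _ _).trans (add_le_add_left (norm_add_le _ _) _)
    _ = (∫ z, ‖b z - f z‖ ∂m) + (∫ z, ‖f ((r k).1 z) - f (g z)‖ ∂m) + ∫ z, ‖b z - f z‖ ∂m := by
        have e3 := integral_add (i1.add hik) i2
        simp only [Pi.add_apply] at e3
        rw [e3, integral_add i1 hik, e1, e2]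
    _ < ε := by linarith

/-- The limits of a sequence of transformations and of its inverses are inverse to each other. -/
theorem ae_leftInverse_of_ae_tendsto {r : ℕ → MPMap m} {u u' : Z → Z}
    (hu : MeasurePreserving u m m) (hu' : MeasurePreserving u' m m)
    (h : ∀ᵐ z ∂m, Tendsto (fun k => (r k).1 z) atTop (𝓝 (u z)))
    (h' : ∀ᵐ z ∂m, Tendsto (fun k => ((r k)⁻¹).1 z) atTop (𝓝 (u' z))) :
    ∀ᵐ z ∂m, u' (u z) = z := by
  have : (fun z => u' (u z)) =ᵐ[m] id := by
    refine Filter.EventuallyEq.of_forall_separating_preimage MeasurableSet fun B hB => ?_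
    rw [← measure_symmDiff_eq_zero_iff, ← measureReal_eq_zero_iff]
    have t1 := tendsto_symmDiff_of_ae_tendsto (r := fun k => (r k)⁻¹) hu' h' hB
    have t2 := tendsto_symmDiff_of_ae_tendsto hu h (hu'.measurable hB)
    refine le_antisymm ?_ measureReal_nonneg
    refine ge_of_tendsto' (by simpa using t2.add t1) fun k => ?_
    have e1 := measureReal_preimage (r k)
      ((((r k)⁻¹).1.measurable hB).symmDiff (hu'.measurable hB))
    have e2 : (r k).1 ⁻¹' (((r k)⁻¹).1 ⁻¹' B) = id ⁻¹' B := by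
      ext z; simp
    rw [Set.preimage_symmDiff, e2] at e1
    rw [← e1]
    have e3 := measureReal_symmDiff_le (μ := m) (s := (fun z => u' (u z)) ⁻¹' B)
      (t := (r k).1 ⁻¹' (u' ⁻¹' B)) (id ⁻¹' B)
    rw [symmDiff_comm ((fun z => u' (u z)) ⁻¹' B) ((r k).1 ⁻¹' (u' ⁻¹' B)),
      symmDiff_comm ((r k).1 ⁻¹' (u' ⁻¹' B)) (id ⁻¹' B)] at e3
    exact e3
  exact this

end Metric

/-- Each term of the series tends to zero under a geometric majorant, so dominated convergence for
series applies. -/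
theorem tendsto_halmosDist (A : DenseFamily m) {r : ℕ → MPMap m} {R : MPMap m}
    (h : ∀ B, MeasurableSet B →
      Tendsto (fun k => m.real (((r k).1 ⁻¹' B) ∆ (R.1 ⁻¹' B))) atTop (𝓝 0))
    (h' : ∀ B, MeasurableSet B →
      Tendsto (fun k => m.real ((((r k)⁻¹).1 ⁻¹' B) ∆ ((R⁻¹).1 ⁻¹' B))) atTop (𝓝 0)) :
    Tendsto (fun k => halmosDist A (r k) R) atTop (𝓝 0) := by
  have hterm : ∀ i, Tendsto (fun k => halmosTerm A (r k) R i) atTop (𝓝 0) := by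
    intro i
    simp only [halmosTerm_eq]
    simpa using (h' _ (A.measurable i)).add (h _ (A.measurable i))
  have h0 : (0 : ℝ) = ∑' i : ℕ, (1 / 2 : ℝ) ^ (i + 1) * 0 := by simp
  rw [h0]
  refine tendsto_tsum_of_dominated_convergence (bound := fun i : ℕ => (1 / 2 : ℝ) ^ i)
    summable_geometric_two (fun i => (hterm i).const_mul _) (Eventually.of_forall fun k i => ?_)
  rw [Real.norm_of_nonneg (mul_nonneg (by positivity) (halmosTerm_nonneg _ _ _ _)), pow_succ,
    mul_assoc]
  refine mul_le_of_le_one_right (by positivity) ?_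
  linarith [halmosTerm_le_two A (r k) R i]

end Limits

section Complete

variable {X : Type*} [MeasurableSpace X] [StandardBorelSpace X] {μ : Measure X}
  [IsProbabilityMeasure μ] [NullSingletonClass μ]

/-- A Cauchy sequence of transformations covering `s` has a subsequence converging to a
transformation which covers `s`. -/
theorem exists_isOver_tendsto_subseq (A : DenseFamily (μ.prod μ)) (s : MPMap μ)
    (r : ℕ → MPMap (μ.prod μ)) (hr : ∀ k, IsOver s (r k))
    (hC : ∀ ε > 0, ∃ N, ∀ k ≥ N, ∀ l ≥ N, halmosDist A (r k) (r l) < ε) :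
    ∃ φ : ℕ → ℕ, StrictMono φ ∧ ∃ R : MPMap (μ.prod μ), IsOver s R ∧
      Tendsto (fun k => halmosDist A (r (φ k)) R) atTop (𝓝 0) := by
  let _ := upgradeStandardBorel X
  let _ := TopologicalSpace.upgradeIsCompletelyMetrizable X
  have hC1 : ∀ B, MeasurableSet B → ∀ ε : ℝ, 0 < ε → ∃ N, ∀ k ≥ N, ∀ l ≥ N,
      (μ.prod μ).real (((r k).1 ⁻¹' B) ∆ ((r l).1 ⁻¹' B)) < ε ∧
      (μ.prod μ).real ((((r k)⁻¹).1 ⁻¹' B) ∆ (((r l)⁻¹).1 ⁻¹' B)) < ε := by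
    intro B hB ε hε
    obtain ⟨δ, hδ, hδ'⟩ := exists_symmDiff_lt A hB hε
    obtain ⟨N, hN⟩ := hC δ hδ
    exact ⟨N, fun k hk l hl => hδ' _ _ (hN k hk l hl)⟩
  obtain ⟨φ, hφ, g, hgm, hg⟩ := exists_subseq_ae_tendsto (r := r) fun B hB ε hε => by
    obtain ⟨N, hN⟩ := hC1 B hB ε hε
    exact ⟨N, fun k hk l hl => (hN k hk l hl).1⟩
  -- An almost everywhere limit of invertible maps need not be invertible. The inverses are Cauchy
  -- as well, because the Halmos metric controls them, and their limit supplies the inverse of `g`.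
  obtain ⟨ψ, hψ, g', hg'm, hg'⟩ := exists_subseq_ae_tendsto (r := fun k => (r (φ k))⁻¹)
    fun B hB ε hε => by
      obtain ⟨N, hN⟩ := hC1 B hB ε hε
      exact ⟨N, fun k hk l hl =>
        (hN _ (hk.trans (hφ.id_le k)) _ (hl.trans (hφ.id_le l))).2⟩
  set q : ℕ → MPMap (μ.prod μ) := fun k => r (φ (ψ k)) with hq
  have hgq : ∀ᵐ z ∂μ.prod μ, Tendsto (fun k => (q k).1 z) atTop (𝓝 (g z)) := by
    filter_upwards [hg] with z hz
    exact hz.comp hψ.tendsto_atTop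
  have hgmp := measurePreserving_of_ae_tendsto hgm hgq
  have hg'mp := measurePreserving_of_ae_tendsto (r := fun k => (q k)⁻¹) hg'm hg'
  have h1 : ∀ᵐ z ∂μ.prod μ, g' (g z) = z := ae_leftInverse_of_ae_tendsto hgmp hg'mp hgq hg'
  -- The first coordinate is the same along the whole sequence, so it survives in the limit.
  have hover : ∀ᵐ z ∂μ.prod μ, (g z).1 = s.1 z.1 := by
    filter_upwards [hg] with z hz
    refine tendsto_nhds_unique ((continuous_fst.tendsto _).comp hz) ?_
    exact tendsto_const_nhds.congr fun k => (hr (φ k) z).symm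
  obtain ⟨R, hR, hRg⟩ := exists_isOver_ae_eq s hgmp hg'mp h1 hover
  have h2 : ∀ᵐ z ∂μ.prod μ, g (g' z) = z := by
    refine ae_leftInverse_of_ae_tendsto (r := fun k => (q k)⁻¹) hg'mp hgmp hg' ?_
    simpa only [inv_inv] using hgq
  have hRg' : ⇑(R⁻¹).1 =ᵐ[μ.prod μ] g' := by
    filter_upwards [h2, hg'mp.quasiMeasurePreserving.ae hRg] with z hz hz'
    rw [hz] at hz'
    conv_lhs => rw [← hz']
    rw [inv_apply_self]
  refine ⟨φ ∘ ψ, hφ.comp hψ, R, hR, tendsto_halmosDist A (fun B hB => ?_) fun B hB => ?_⟩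
  · exact tendsto_symmDiff_of_ae_tendsto (r := q) R.2 (by
      filter_upwards [hgq, hRg] with z hz hz'
      rwa [hz']) hB
  · exact tendsto_symmDiff_of_ae_tendsto (r := fun k => (q k)⁻¹) (R⁻¹).2 (by
      filter_upwards [hg', hRg'] with z hz hz'
      rwa [hz']) hB

/-- Representatives covering one common `s` reduce this to pointwise defined maps; a Cauchy sequence
with a convergent subsequence converges. -/
theorem completeSpace_ext (A : DenseFamily (μ.prod μ)) (S : Aut μ) :
    letI : MetricSpace (Aut (μ.prod μ)) := halmosMetric A
    CompleteSpace (Ext S) := by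
  let _ : MetricSpace (Aut (μ.prod μ)) := halmosMetric A
  refine Metric.complete_of_cauchySeq_tendsto fun u hu => ?_
  obtain ⟨s, rfl⟩ := Quotient.exists_rep S
  choose r hr hru using fun k => exists_isOver_of_mem_ext (u k).2
  have hdist : ∀ k l, dist (u k) (u l) = halmosDist A (r k) (r l) := by
    intro k l
    rw [Subtype.dist_eq, ← hru k, ← hru l]
    rfl
  obtain ⟨φ, hφ, R, hR, hlim⟩ := exists_isOver_tendsto_subseq A s r hr fun ε hε => by
    obtain ⟨N, hN⟩ := Metric.cauchySeq_iff.1 hu ε hε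
    exact ⟨N, fun k hk l hl => by rw [← hdist]; exact hN k hk l hl⟩
  refine ⟨⟨Aut.mk R, hR.mk_mem_ext⟩, tendsto_nhds_of_cauchySeq_of_subseq hu hφ.tendsto_atTop ?_⟩
  rw [tendsto_iff_dist_tendsto_zero]
  refine hlim.congr fun k => ?_
  rw [Function.comp_apply, Subtype.dist_eq, ← hru]
  rfl

end Complete

/-! ### Correlations -/

section Correlations

variable {Z : Type*} [MeasurableSpace Z] {m : Measure Z}

/-- The correlation `m (T⁻ⁿ B ∩ C)`. -/
noncomputable def MPMap.corr (T : MPMap m) (n : ℕ) (B C : Set Z) : ℝ :=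
  m.real ((T ^ n).1 ⁻¹' B ∩ C)

theorem MPMap.pow_ae_eq {T T' : MPMap m} (h : ⇑T.1 =ᵐ[m] ⇑T'.1) (n : ℕ) :
    ⇑(T ^ n).1 =ᵐ[m] ⇑(T' ^ n).1 := by
  induction n with
  | zero => rfl
  | succ n ih =>
    filter_upwards [h, T'.2.quasiMeasurePreserving.ae ih] with z hz hz'
    rw [pow_succ, pow_succ, mul_apply, mul_apply, hz, hz']

theorem MPMap.corr_congr {T T' : MPMap m} (h : ⇑T.1 =ᵐ[m] ⇑T'.1) (n : ℕ) (B C : Set Z) :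
    T.corr n B C = T'.corr n B C := by
  refine measureReal_congr (EventuallyEq.inter ?_ EventuallyEq.rfl)
  exact (MPMap.pow_ae_eq h n).preimage B

/-- The correlation `m (T⁻ⁿ B ∩ C)` of an automorphism. -/
noncomputable def Aut.corr (T : Aut m) (n : ℕ) (B C : Set Z) : ℝ :=
  Quotient.liftOn T (fun T => T.corr n B C) fun _ _ h => MPMap.corr_congr h n B C

theorem Aut.corr_mk (T : MPMap m) (n : ℕ) (B C : Set Z) :
    (Aut.mk T).corr n B C = T.corr n B C := rfl

/-- The value `c m(B) m(C) + ∑ cᵢ m (T⁻ⁱ B ∩ C)`. -/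
noncomputable def AdmissibleFunction.corr (P : AdmissibleFunction) (T : Aut m) (B C : Set Z) : ℝ :=
  P.c * (m.real B * m.real C) + ∑' i, P.coeff i * T.corr i B C

theorem Aut.corr_nonneg (T : Aut m) (n : ℕ) (B C : Set Z) : 0 ≤ T.corr n B C := by
  induction T using Quotient.inductionOn with
  | _ T => exact measureReal_nonneg

variable [IsProbabilityMeasure m]

theorem Aut.corr_le_one (T : Aut m) (n : ℕ) (B C : Set Z) : T.corr n B C ≤ 1 := by
  induction T using Quotient.inductionOn with
  | _ T => exact measureReal_le_one

theorem AdmissibleFunction.summable_mul (P : AdmissibleFunction) {x : ℕ → ℝ}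
    (h0 : ∀ i, 0 ≤ x i) (h1 : ∀ i, x i ≤ 1) : Summable fun i => P.coeff i * x i :=
  Summable.of_nonneg_of_le (fun i => mul_nonneg (P.coeff_nonneg i) (h0 i))
    (fun i => mul_le_of_le_one_right (P.coeff_nonneg i) (h1 i)) P.hasSum_coeff.summable

theorem abs_measureReal_inter_sub_le {B B' C C' : Set Z} (hB : MeasurableSet B)
    (hB' : MeasurableSet B') (hC : MeasurableSet C) (hC' : MeasurableSet C') :
    |m.real (B ∩ C) - m.real (B' ∩ C')| ≤ m.real (B ∆ B') + m.real (C ∆ C') := by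
  have h1 := abs_measureReal_sub_le_measureReal_symmDiff (μ := m) (hB.inter hC).nullMeasurableSet
    (hB'.inter hC').nullMeasurableSet
  refine h1.trans ((measureReal_mono ?_).trans (measureReal_union_le _ _))
  intro z hz
  simp only [Set.mem_symmDiff, Set.mem_inter_iff, Set.mem_union] at hz ⊢
  tauto

theorem abs_measureReal_sub_le' {B B' : Set Z} (hB : MeasurableSet B)
    (hB' : MeasurableSet B') : |m.real B - m.real B'| ≤ m.real (B ∆ B') :=
  abs_measureReal_sub_le_measureReal_symmDiff hB.nullMeasurableSet hB'.nullMeasurableSet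

theorem Aut.abs_corr_sub_le (T : Aut m) (n : ℕ) {B B' C C' : Set Z} (hB : MeasurableSet B)
    (hB' : MeasurableSet B') (hC : MeasurableSet C) (hC' : MeasurableSet C') :
    |T.corr n B C - T.corr n B' C'| ≤ m.real (B ∆ B') + m.real (C ∆ C') := by
  induction T using Quotient.inductionOn with
  | _ T =>
    refine (abs_measureReal_inter_sub_le ((T ^ n).1.measurable hB) ((T ^ n).1.measurable hB')
      hC hC').trans_eq ?_
    rw [← Set.preimage_symmDiff, measureReal_preimage _ (hB.symmDiff hB')]

/-- The value is a convex combination of `m(B) m(C)` and the correlations, each of which obeys this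
bound; the weights `c` and `1 - c` add up to one. -/
theorem AdmissibleFunction.abs_corr_sub_le (P : AdmissibleFunction) (T : Aut m)
    {B B' C C' : Set Z} (hB : MeasurableSet B) (hB' : MeasurableSet B') (hC : MeasurableSet C)
    (hC' : MeasurableSet C') :
    |P.corr T B C - P.corr T B' C'| ≤ m.real (B ∆ B') + m.real (C ∆ C') := by
  set d := m.real (B ∆ B') + m.real (C ∆ C') with hd
  have hs := fun B C => P.summable_mul (x := fun i => T.corr i B C)
    (fun i => T.corr_nonneg i B C) fun i => T.corr_le_one i B C
  have h1 : |m.real B * m.real C - m.real B' * m.real C'| ≤ d := by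
    have e1 := abs_le.1 (abs_measureReal_sub_le' (m := m) hB hB')
    have e2 := abs_le.1 (abs_measureReal_sub_le' (m := m) hC hC')
    have := measureReal_le_one (μ := m) (s := B')
    have := measureReal_le_one (μ := m) (s := C)
    have := measureReal_nonneg (μ := m) (s := B')
    have := measureReal_nonneg (μ := m) (s := C)
    rw [abs_le]
    constructor <;> nlinarith
  have h2 : |∑' i, P.coeff i * T.corr i B C - ∑' i, P.coeff i * T.corr i B' C'| ≤
      (1 - P.c) * d := by
    rw [← (hs B C).tsum_sub (hs B' C'), ← Real.norm_eq_abs]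
    refine tsum_of_norm_bounded (P.hasSum_coeff.mul_right d) fun i => ?_
    rw [← mul_sub, norm_mul, Real.norm_of_nonneg (P.coeff_nonneg i), Real.norm_eq_abs]
    exact mul_le_mul_of_nonneg_left (T.abs_corr_sub_le i hB hB' hC hC') (P.coeff_nonneg i)
  unfold AdmissibleFunction.corr
  have h3 : |P.c * (m.real B * m.real C) - P.c * (m.real B' * m.real C')| ≤ P.c * d := by
    rw [← mul_sub, abs_mul, abs_of_nonneg P.c_nonneg]
    exact mul_le_mul_of_nonneg_left h1 P.c_nonneg
  rw [abs_le] at h2 h3 ⊢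
  constructor <;> linarith

/-! ### Weak limits of powers in terms of correlations -/

theorem koopman_pow_mk (T : MPMap m) (n : ℕ) :
    koopman (Aut.mk T) ^ n = koopman (Aut.mk (T ^ n)) := by
  induction n with
  | zero =>
    rw [pow_zero, pow_zero]
    ext1 f
    refine Lp.ext ?_
    exact (Lp.coeFn_compMeasurePreserving f (1 : MPMap m).2).symm
  | succ n ih =>
    rw [pow_succ', ih]
    ext1 f
    refine Lp.ext ?_
    have h1 := Lp.coeFn_compMeasurePreserving f (T ^ (n + 1)).2
    have h2 := Lp.coeFn_compMeasurePreserving (koopman (Aut.mk (T ^ n)) f) T.2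
    have h3 := T.2.quasiMeasurePreserving.ae (Lp.coeFn_compMeasurePreserving f (T ^ n).2)
    refine h2.trans ?_
    refine EventuallyEq.trans ?_ h1.symm
    filter_upwards [h3] with z hz
    rw [pow_succ]
    exact hz

theorem inner_koopman_pow (T : Aut m) (n : ℕ) {B C : Set Z} (hB : MeasurableSet B)
    (hC : MeasurableSet C) :
    inner ℂ ((koopman T ^ n) (indicatorConstLp 2 hB (measure_ne_top m _) (1 : ℂ)))
      (indicatorConstLp 2 hC (measure_ne_top m _) (1 : ℂ)) = (T.corr n B C : ℂ) := by
  induction T using Quotient.inductionOn with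
  | _ T =>
    have h1 : (koopman (Aut.mk T) ^ n) (indicatorConstLp 2 hB (measure_ne_top m _) (1 : ℂ)) =
        indicatorConstLp 2 ((T ^ n).1.measurable hB) (measure_ne_top m _) (1 : ℂ) := by
      rw [koopman_pow_mk]
      exact Lp.indicatorConstLp_compMeasurePreserving hB _ 1 (T ^ n).2
    change inner ℂ ((koopman (Aut.mk T) ^ n) _) _ = ((Aut.mk T).corr n B C : ℂ)
    rw [h1, L2.inner_indicatorConstLp_indicatorConstLp]
    simp [Aut.corr_mk, MPMap.corr]

theorem inner_theta {B C : Set Z} (hB : MeasurableSet B) (hC : MeasurableSet C) :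
    inner ℂ (Theta m (indicatorConstLp 2 hB (measure_ne_top m _) (1 : ℂ)))
      (indicatorConstLp 2 hC (measure_ne_top m _) (1 : ℂ)) = (m.real B * m.real C : ℂ) := by
  have hnorm : ‖Lp.const 2 m (1 : ℂ)‖ = 1 := by
    rw [Lp.norm_const] <;> simp
  unfold Theta
  rw [Submodule.starProjection_unit_singleton _ hnorm, ← indicatorConstLp_univ,
    inner_smul_left, L2.inner_indicatorConstLp_indicatorConstLp,
    L2.inner_indicatorConstLp_indicatorConstLp]
  simp

/-- This translates operators into correlations of sets, where the rest of the argument takes place.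
All coefficients are real, so the conjugation in the first argument of the inner product has no
effect. -/
theorem inner_eval (P : AdmissibleFunction) (T : Aut m) {B C : Set Z} (hB : MeasurableSet B)
    (hC : MeasurableSet C) :
    inner ℂ (P.eval T (indicatorConstLp 2 hB (measure_ne_top m _) (1 : ℂ)))
      (indicatorConstLp 2 hC (measure_ne_top m _) (1 : ℂ)) = (P.corr T B C : ℂ) := by
  set f := indicatorConstLp 2 hB (measure_ne_top m B) (1 : ℂ)
  set g := indicatorConstLp 2 hC (measure_ne_top m C) (1 : ℂ)
  have h1 : HasSum (fun i => inner ℂ (((P.coeff i : ℂ) • koopman T ^ i) f) g)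
      (inner ℂ ((∑' i, (P.coeff i : ℂ) • koopman T ^ i) f) g) := by
    -- The inner product is conjugate linear in its first argument, so the series is summed with the
    -- arguments exchanged and then conjugated.
    have h2 := (P.summable_eval T).hasSum
    have h3 := h2.mapL (ContinuousLinearMap.apply ℂ (Lp ℂ 2 m) f)
    have h4 := h3.mapL (innerSL ℂ g)
    have h5 := Complex.hasSum_conj'.2 h4
    simp only [innerSL_apply_apply, ContinuousLinearMap.apply_apply, inner_conj_symm] at h5
    exact h5
  unfold AdmissibleFunction.eval
  rw [add_apply, inner_add_left, smul_apply,
    inner_smul_left, inner_theta hB hC, ← h1.tsum_eq]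
  unfold AdmissibleFunction.corr
  rw [Complex.ofReal_add, Complex.ofReal_mul, Complex.ofReal_mul, Complex.ofReal_tsum,
    Complex.conj_ofReal]
  congr 1
  refine tsum_congr fun i => ?_
  rw [smul_apply, inner_smul_left, inner_koopman_pow T i hB hC,
    Complex.conj_ofReal, Complex.ofReal_mul]

end Correlations

section WeakLimits

variable {Z : Type*} [MeasurableSpace Z] {m : Measure Z} [IsProbabilityMeasure m]

theorem IsWeakLimitOfPowers.exists_tendsto_corr {T : Aut m} {P : AdmissibleFunction}
    (h : IsWeakLimitOfPowers T (P.eval T)) :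
    ∃ n : ℕ → ℕ, Tendsto n atTop atTop ∧ ∀ B C, MeasurableSet B → MeasurableSet C →
      Tendsto (fun j => T.corr (n j) B C) atTop (𝓝 (P.corr T B C)) := by
  obtain ⟨n, hn, h⟩ := h
  refine ⟨n, hn, fun B C hB hC => ?_⟩
  have h1 := h (indicatorConstLp 2 hB (measure_ne_top m _) 1)
    (indicatorConstLp 2 hC (measure_ne_top m _) 1)
  simp only [inner_koopman_pow _ _ hB hC, inner_eval _ _ hB hC] at h1
  exact (Complex.continuous_re.tendsto _).comp h1

/-- Pointwise convergence of equi-Lipschitz functions holds on a closed set. -/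
theorem isClosed_tendsto_of_lipschitz {E : Type*} [SeminormedAddCommGroup E] {φ : ℕ → E → ℂ}
    {ψ : E → ℂ} {K : ℝ} (hφ : ∀ j f g, ‖φ j f - φ j g‖ ≤ K * ‖f - g‖)
    (hψ : ∀ f g, ‖ψ f - ψ g‖ ≤ K * ‖f - g‖) :
    IsClosed {f | Tendsto (fun j => φ j f) atTop (𝓝 (ψ f))} := by
  refine isClosed_of_closure_subset fun f hf => ?_
  rw [Set.mem_ofPred_eq, Metric.tendsto_atTop]
  intro ε hε
  have hK : 0 < 3 * (|K| + 1) := by positivity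
  obtain ⟨g, hg, hfg⟩ := Metric.mem_closure_iff.1 hf (ε / (3 * (|K| + 1))) (by positivity)
  have h1 : K * ‖f - g‖ ≤ ε / 3 := by
    rw [dist_eq_norm, lt_div_iff₀ hK] at hfg
    have : K * ‖f - g‖ ≤ |K| * ‖f - g‖ :=
      mul_le_mul_of_nonneg_right (le_abs_self K) (norm_nonneg _)
    nlinarith [norm_nonneg (f - g)]
  obtain ⟨N, hN⟩ := Metric.tendsto_atTop.1 hg (ε / 3) (by linarith)
  refine ⟨N, fun j hj => ?_⟩
  have h2 := hN j hj
  have h3 := hφ j f g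
  have h4 := hψ g f
  rw [norm_sub_rev g f] at h4
  rw [dist_eq_norm] at h2 ⊢
  have h5 : φ j f - ψ f = (φ j f - φ j g) + (φ j g - ψ g) + (ψ g - ψ f) := by ring
  rw [h5]
  have h6 := norm_add_le ((φ j f - φ j g) + (φ j g - ψ g)) (ψ g - ψ f)
  have h7 := norm_add_le (φ j f - φ j g) (φ j g - ψ g)
  linarith

theorem norm_koopman_pow_le (T : Aut m) (n : ℕ) : ‖koopman T ^ n‖ ≤ 1 := by
  cases n with
  | zero => rw [pow_zero]; exact ContinuousLinearMap.norm_id_le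
  | succ n =>
    exact (norm_pow_le' _ n.succ_pos).trans (pow_le_one₀ (norm_nonneg _) (norm_koopman_le T))

/-- Weak convergence of powers can be tested on measurable sets. -/
theorem isWeakLimitOfPowers_of_tendsto_corr {T : Aut m} {P : AdmissibleFunction} {n : ℕ → ℕ}
    (hn : Tendsto n atTop atTop) (h : ∀ B C, MeasurableSet B → MeasurableSet C →
      Tendsto (fun j => T.corr (n j) B C) atTop (𝓝 (P.corr T B C))) :
    IsWeakLimitOfPowers T (P.eval T) := by
  refine ⟨n, hn, ?_⟩
  set Q := P.eval T with hQ
  have hlip : ∀ (U : Lp ℂ 2 m →L[ℂ] Lp ℂ 2 m) (K : ℝ), ‖U‖ ≤ K → ∀ f f' g : Lp ℂ 2 m,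
      ‖inner ℂ (U f) g - inner ℂ (U f') g‖ ≤ K * ‖g‖ * ‖f - f'‖ := by
    intro U K hU f f' g
    rw [← inner_sub_left, ← map_sub]
    refine (norm_inner_le_norm _ _).trans ?_
    have h1 : ‖U (f - f')‖ ≤ K * ‖f - f'‖ := U.le_of_opNorm_le hU _
    calc _ ≤ K * ‖f - f'‖ * ‖g‖ := mul_le_mul_of_nonneg_right h1 (norm_nonneg _)
      _ = _ := by ring
  have hlip' : ∀ (U : Lp ℂ 2 m →L[ℂ] Lp ℂ 2 m) (K : ℝ), ‖U‖ ≤ K → ∀ f g g' : Lp ℂ 2 m,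
      ‖inner ℂ (U f) g - inner ℂ (U f) g'‖ ≤ K * ‖f‖ * ‖g - g'‖ := by
    intro U K hU f g g'
    rw [← inner_sub_right]
    refine (norm_inner_le_norm _ _).trans ?_
    exact mul_le_mul_of_nonneg_right (U.le_of_opNorm_le hU _) (norm_nonneg _)
  -- A uniform operator bound makes convergence a closed condition in each argument separately, so
  -- linearity and density of simple functions reduce everything to indicators.
  have hK : ∀ j, ‖koopman T ^ n j‖ ≤ max 1 ‖Q‖ := fun j =>
    (norm_koopman_pow_le T _).trans (le_max_left _ _)
  have hKQ : ‖Q‖ ≤ max 1 ‖Q‖ := le_max_right _ _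
  have hind : ∀ (a : ℂ) {B : Set Z} (hB : MeasurableSet B),
      indicatorConstLp 2 hB (measure_ne_top m _) a =
        a • indicatorConstLp 2 hB (measure_ne_top m _) (1 : ℂ) := by
    intro a B hB
    refine Lp.ext ?_
    filter_upwards [indicatorConstLp_coeFn (p := 2) (hs := hB) (hμs := measure_ne_top m _) (c := a),
      Lp.coeFn_smul a (indicatorConstLp 2 hB (measure_ne_top m _) (1 : ℂ)),
      indicatorConstLp_coeFn (p := 2) (hs := hB) (hμs := measure_ne_top m _) (c := (1 : ℂ))]
      with z h1 h2 h3
    rw [h1, h2, Pi.smul_apply, h3]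
    by_cases hz : z ∈ B <;> simp [hz]
  intro f g
  refine Lp.induction (by simp) (motive := fun f : Lp ℂ 2 m => Tendsto
    (fun j => inner ℂ ((koopman T ^ n j) f) g) atTop (𝓝 (inner ℂ (Q f) g))) ?_ ?_ ?_ f
  · intro a B hB hB'
    rw [Lp.simpleFunc.coe_indicatorConst, hind a hB]
    simp only [map_smul, inner_smul_left]
    refine Tendsto.const_mul _ ?_
    refine Lp.induction (by simp) (motive := fun g : Lp ℂ 2 m => Tendsto
      (fun j => inner ℂ ((koopman T ^ n j) (indicatorConstLp 2 hB (measure_ne_top m _) (1 : ℂ))) g)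
      atTop (𝓝 (inner ℂ (Q (indicatorConstLp 2 hB (measure_ne_top m _) (1 : ℂ))) g))) ?_ ?_ ?_ g
    · intro b C hC hC'
      rw [Lp.simpleFunc.coe_indicatorConst, hind b hC]
      simp only [inner_smul_right]
      refine Tendsto.const_mul _ ?_
      simp only [inner_koopman_pow _ _ hB hC, hQ, inner_eval _ _ hB hC]
      exact (Complex.continuous_ofReal.tendsto _).comp (h B C hB hC)
    · intro g₁ g₂ hg₁ hg₂ _ h1 h2
      simp only [inner_add_right]
      exact h1.add h2
    · exact isClosed_tendsto_of_lipschitz (fun j => hlip' _ _ (hK j) _) (hlip' _ _ hKQ _)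
  · intro f₁ f₂ hf₁ hf₂ _ h1 h2
    simp only [map_add, inner_add_left]
    exact h1.add h2
  · exact isClosed_tendsto_of_lipschitz (fun j f f' => hlip _ _ (hK j) f f' g)
      fun f f' => hlip _ _ hKQ f f' g

/-! ### Open conditions and reduction to countable families -/

/-- The automorphisms for which some power of order at least `N` is `1 / (N + 1)`-close to `P`, when
tested on the first `N` sets of the family. -/
def nearSet (A : DenseFamily m) (P : AdmissibleFunction) (N : ℕ) : Set (Aut m) :=
  {T | ∃ n ≥ N, ∀ i < N, ∀ k < N,
    |T.corr n (A.sets i) (A.sets k) - P.corr T (A.sets i) (A.sets k)| < 1 / (N + 1 : ℝ)}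

/-- The powers selected for successive `N` form the required sequence. For arbitrary sets,
approximating both of them in the two correlations costs four errors of `ε / 5`, and closeness on
the family costs the fifth. -/
theorem isWeakLimitOfPowers_of_mem_nearSet (A : DenseFamily m) {P : AdmissibleFunction}
    {T : Aut m} (h : ∀ N, T ∈ nearSet A P N) : IsWeakLimitOfPowers T (P.eval T) := by
  choose n hn hnear using h
  refine isWeakLimitOfPowers_of_tendsto_corr
    (tendsto_atTop_mono hn tendsto_id) fun B C hB hC => ?_
  rw [Metric.tendsto_atTop]
  intro ε hε
  obtain ⟨i, hi⟩ := A.dense B hB (ε / 5) (by linarith)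
  obtain ⟨k, hk⟩ := A.dense C hC (ε / 5) (by linarith)
  obtain ⟨M, hM⟩ := exists_nat_gt (5 / ε)
  refine ⟨max M (max (i + 1) (k + 1)), fun j hj => ?_⟩
  have h1 := hnear j i (by omega) k (by omega)
  have h2 : 1 / (j + 1 : ℝ) < ε / 5 := by
    rw [div_lt_div_iff₀ (by positivity) (by norm_num)]
    have : (M : ℝ) ≤ j := by exact_mod_cast (le_max_left _ _).trans hj
    rw [div_lt_iff₀ hε] at hM
    nlinarith
  have h3 := T.abs_corr_sub_le (n j) hB (A.measurable i) hC (A.measurable k)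
  have h4 := P.abs_corr_sub_le T hB (A.measurable i) hC (A.measurable k)
  rw [Real.dist_eq]
  rw [abs_lt] at h1 ⊢
  rw [abs_le] at h3 h4
  constructor <;> linarith

/-- Convergence of the individual coefficients alone would allow mass to escape to infinity. Since
`c` converges too, the total mass of the coefficients converges, so tails are eventually as small as
those of `Q`. -/
theorem tendsto_tsum_coeff {P : ℕ → AdmissibleFunction} {Q : AdmissibleFunction}
    (hc : Tendsto (fun k => (P k).c) atTop (𝓝 Q.c))
    (hcoeff : ∀ i, Tendsto (fun k => (P k).coeff i) atTop (𝓝 (Q.coeff i)))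
    {x : ℕ → ℝ} (h0 : ∀ i, 0 ≤ x i) (h1 : ∀ i, x i ≤ 1) :
    Tendsto (fun k => ∑' i, (P k).coeff i * x i) atTop (𝓝 (∑' i, Q.coeff i * x i)) := by
  rw [Metric.tendsto_atTop]
  intro ε hε
  obtain ⟨I, hI⟩ := ((Q.hasSum_coeff.tendsto_sum_nat).eventually
    (lt_mem_nhds (show 1 - Q.c - ε / 5 < 1 - Q.c by linarith))).exists
  have hA : Tendsto (fun k => ∑ i ∈ Finset.range I, (P k).coeff i) atTop
      (𝓝 (∑ i ∈ Finset.range I, Q.coeff i)) := tendsto_finsetSum _ fun i _ => hcoeff i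
  have hB : Tendsto (fun k => ∑ i ∈ Finset.range I, (P k).coeff i * x i) atTop
      (𝓝 (∑ i ∈ Finset.range I, Q.coeff i * x i)) :=
    tendsto_finsetSum _ fun i _ => (hcoeff i).mul_const _
  obtain ⟨N1, hN1⟩ := Metric.tendsto_atTop.1 hA (ε / 5) (by linarith)
  obtain ⟨N2, hN2⟩ := Metric.tendsto_atTop.1 hB (ε / 5) (by linarith)
  obtain ⟨N3, hN3⟩ := Metric.tendsto_atTop.1 hc (ε / 5) (by linarith)
  have key : ∀ R : AdmissibleFunction, ∑ i ∈ Finset.range I, R.coeff i * x i ≤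
      ∑' i, R.coeff i * x i ∧ ∑' i, R.coeff i * x i ≤
      ∑ i ∈ Finset.range I, R.coeff i * x i + (1 - R.c - ∑ i ∈ Finset.range I, R.coeff i) := by
    intro R
    have hs := R.summable_mul h0 h1
    have e1 := hs.sum_add_tsum_nat_add I
    have e2 := R.hasSum_coeff.summable.sum_add_tsum_nat_add I
    rw [R.hasSum_coeff.tsum_eq] at e2
    have e3 : 0 ≤ ∑' i, R.coeff (i + I) * x (i + I) :=
      tsum_nonneg fun i => mul_nonneg (R.coeff_nonneg _) (h0 _)
    have e4 : ∑' i, R.coeff (i + I) * x (i + I) ≤ ∑' i, R.coeff (i + I) :=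
      ((summable_nat_add_iff I).2 hs).tsum_le_tsum
        (fun i => mul_le_of_le_one_right (R.coeff_nonneg _) (h1 _))
        ((summable_nat_add_iff I).2 R.hasSum_coeff.summable)
    constructor <;> linarith
  refine ⟨max N1 (max N2 N3), fun k hk => ?_⟩
  have a1 := hN1 k (by omega)
  have a2 := hN2 k (by omega)
  have a3 := hN3 k (by omega)
  rw [Real.dist_eq, abs_lt] at *
  have b1 := key (P k)
  have b2 := key Q
  constructor <;> linarith

/-- Lets a countable dense subfamily control the whole family: for a fixed automorphism, the
finitely many correlations tested depend continuously on the coefficients. -/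
theorem mem_nearSet_of_tendsto (A : DenseFamily m) {P : ℕ → AdmissibleFunction}
    {Q : AdmissibleFunction} (hc : Tendsto (fun k => (P k).c) atTop (𝓝 Q.c))
    (hcoeff : ∀ i, Tendsto (fun k => (P k).coeff i) atTop (𝓝 (Q.coeff i))) {T : Aut m}
    (h : ∀ k N, T ∈ nearSet A (P k) N) (N : ℕ) : T ∈ nearSet A Q N := by
  have h1 : ∀ B C, Tendsto (fun k => (P k).corr T B C) atTop (𝓝 (Q.corr T B C)) := fun B C =>
    (hc.mul_const _).add (tendsto_tsum_coeff hc hcoeff (fun i => T.corr_nonneg i B C)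
      fun i => T.corr_le_one i B C)
  have h2 : ∀ᶠ k in atTop, ∀ i ∈ Finset.range N, ∀ l ∈ Finset.range N,
      |(P k).corr T (A.sets i) (A.sets l) - Q.corr T (A.sets i) (A.sets l)| <
        1 / (2 * (N + 1 : ℝ)) := by
    refine (Finset.eventually_all _).2 fun i _ => (Finset.eventually_all _).2 fun l _ => ?_
    have := (h1 (A.sets i) (A.sets l)).eventually (Metric.ball_mem_nhds _
      (show 0 < 1 / (2 * (N + 1 : ℝ)) by positivity))
    simpa [Metric.mem_ball, Real.dist_eq] using this
  obtain ⟨k, hk⟩ := h2.exists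
  -- With this index the tolerance is at most half of `1 / (N + 1)`; the other half pays for
  -- replacing `P k` by `Q`.
  obtain ⟨n, hn, hnear⟩ := h k (2 * N + 2)
  refine ⟨n, by omega, fun i hi l hl => ?_⟩
  have a1 := hnear i (by omega) l (by omega)
  have a2 := hk i (Finset.mem_range.2 hi) l (Finset.mem_range.2 hl)
  have a3 : 1 / (((2 * N + 2 : ℕ) : ℝ) + 1) ≤ 1 / (2 * (N + 1 : ℝ)) := by
    refine one_div_le_one_div_of_le (by positivity) ?_
    push_cast; linarith
  have a4 : 1 / (N + 1 : ℝ) = 1 / (2 * (N + 1 : ℝ)) + 1 / (2 * (N + 1 : ℝ)) := by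
    field_simp; norm_num
  rw [abs_lt] at *
  constructor <;> linarith

/-- Any family of admissible functions has a countable subfamily which is dense for the pointwise
convergence of the coefficients. -/
theorem exists_countable_dense_subfamily (F : Set AdmissibleFunction) :
    ∃ F₀ ⊆ F, F₀.Countable ∧ ∀ Q ∈ F, ∃ P : ℕ → AdmissibleFunction, (∀ k, P k ∈ F₀) ∧
      Tendsto (fun k => (P k).c) atTop (𝓝 Q.c) ∧
      ∀ i, Tendsto (fun k => (P k).coeff i) atTop (𝓝 (Q.coeff i)) := by
  rcases F.eq_empty_or_nonempty with rfl | hF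
  · exact ⟨∅, subset_rfl, Set.countable_empty, by simp⟩
  have : Nonempty F := hF.to_subtype
  let ι : F → ℝ × (ℕ → ℝ) := fun P => (P.1.c, P.1.coeff)
  -- A topology induced from a second countable space is second countable, hence separable.
  let _ : TopologicalSpace F := TopologicalSpace.induced ι inferInstance
  have hι : IsInducing ι := ⟨rfl⟩
  have := hι.secondCountableTopology
  refine ⟨Set.range fun k => (TopologicalSpace.denseSeq F k).1, ?_, Set.countable_range _, ?_⟩
  · rintro _ ⟨k, rfl⟩
    exact (TopologicalSpace.denseSeq F k).2
  · intro Q hQ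
    have hmem : (⟨Q, hQ⟩ : F) ∈ closure (Set.range (TopologicalSpace.denseSeq F)) :=
      TopologicalSpace.denseRange_denseSeq F _
    obtain ⟨P, hP, hlim⟩ := mem_closure_iff_seq_limit.1 hmem
    refine ⟨fun k => (P k).1, fun k => ?_, ?_⟩
    · obtain ⟨l, hl⟩ := hP k
      exact ⟨l, congrArg Subtype.val hl⟩
    · have h1 := (hι.continuous.tendsto _).comp hlim
      rw [nhds_prod_eq] at h1
      refine ⟨tendsto_fst.comp h1, fun i => ?_⟩
      have h2 := tendsto_snd.comp h1
      exact (tendsto_pi_nhds.1 h2) i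

/-! ### Continuity of correlations -/

/-- In the induction the error for `n` is pulled back by `R`, which preserves its measure. Then `R`
and `T` are compared on the fixed preimage of `B` under `T ^ n`. -/
theorem exists_symmDiff_pow_lt (A : DenseFamily m) (T : MPMap m) {B : Set Z}
    (hB : MeasurableSet B) (n : ℕ) {ε : ℝ} (hε : 0 < ε) :
    ∃ δ > 0, ∀ R : MPMap m, halmosDist A R T < δ →
      m.real (((R ^ n).1 ⁻¹' B) ∆ ((T ^ n).1 ⁻¹' B)) < ε := by
  induction n generalizing ε with
  | zero => exact ⟨1, one_pos, fun R _ => by simpa using hε⟩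
  | succ n ih =>
    obtain ⟨δ₁, hδ₁, h₁⟩ := ih (half_pos hε)
    obtain ⟨δ₂, hδ₂, h₂⟩ := exists_symmDiff_lt A ((T ^ n).1.measurable hB) (half_pos hε)
    refine ⟨min δ₁ δ₂, lt_min hδ₁ hδ₂, fun R hR => ?_⟩
    have a1 := h₁ R (hR.trans_le (min_le_left _ _))
    have a2 := (h₂ R T (hR.trans_le (min_le_right _ _))).1
    have a3 := measureReal_preimage R
      (((R ^ n).1.measurable hB).symmDiff ((T ^ n).1.measurable hB))
    rw [Set.preimage_symmDiff] at a3
    have e : ∀ U : MPMap m, (U ^ (n + 1)).1 ⁻¹' B = U.1 ⁻¹' ((U ^ n).1 ⁻¹' B) := by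
      intro U; rw [pow_succ]; rfl
    rw [e, e]
    have a4 := measureReal_symmDiff_le (μ := m) (s := R.1 ⁻¹' ((R ^ n).1 ⁻¹' B))
      (t := R.1 ⁻¹' ((T ^ n).1 ⁻¹' B)) (T.1 ⁻¹' ((T ^ n).1 ⁻¹' B))
    linarith

variable [MeasurableSpace.CountablySeparated Z]

theorem continuous_corr (A : DenseFamily m) (n : ℕ) {B C : Set Z} (hB : MeasurableSet B)
    (hC : MeasurableSet C) :
    letI : MetricSpace (Aut m) := halmosMetric A
    Continuous fun T : Aut m => T.corr n B C := by
  let _ : MetricSpace (Aut m) := halmosMetric A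
  refine Metric.continuous_iff.2 fun T ε hε => ?_
  induction T using Quotient.inductionOn with
  | _ T =>
    obtain ⟨δ, hδ, h⟩ := exists_symmDiff_pow_lt A T hB n hε
    refine ⟨δ, hδ, fun R => ?_⟩
    induction R using Quotient.inductionOn with
    | _ R =>
      intro hR
      have h1 := abs_measureReal_inter_sub_le (m := m) ((R ^ n).1.measurable hB)
        ((T ^ n).1.measurable hB) hC hC
      rw [symmDiff_self, Set.bot_eq_empty, measureReal_empty, add_zero] at h1
      exact h1.trans_lt (h R hR)

/-- Weierstrass test: the coefficients themselves are a summable majorant. -/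
theorem AdmissibleFunction.continuous_corr (A : DenseFamily m) (P : AdmissibleFunction)
    {B C : Set Z} (hB : MeasurableSet B) (hC : MeasurableSet C) :
    letI : MetricSpace (Aut m) := halmosMetric A
    Continuous fun T : Aut m => P.corr T B C := by
  let _ : MetricSpace (Aut m) := halmosMetric A
  refine continuous_const.add (continuous_tsum (u := P.coeff)
    (fun i => continuous_const.mul (TypicalExt.continuous_corr A i hB hC))
    P.hasSum_coeff.summable fun i T => ?_)
  rw [norm_mul, Real.norm_of_nonneg (P.coeff_nonneg i), Real.norm_of_nonneg (T.corr_nonneg _ _ _)]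
  exact mul_le_of_le_one_right (P.coeff_nonneg i) (T.corr_le_one _ _ _)

theorem isOpen_nearSet (A : DenseFamily m) (P : AdmissibleFunction) (N : ℕ) :
    letI : MetricSpace (Aut m) := halmosMetric A
    IsOpen (nearSet A P N) := by
  let _ : MetricSpace (Aut m) := halmosMetric A
  have h : nearSet A P N = ⋃ n ≥ N, ⋂ i ∈ Finset.range N, ⋂ k ∈ Finset.range N,
      {T | |T.corr n (A.sets i) (A.sets k) - P.corr T (A.sets i) (A.sets k)| <
        1 / (N + 1 : ℝ)} := by
    ext T
    simp [nearSet]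
  rw [h]
  refine isOpen_biUnion fun n _ => isOpen_biInter_finset fun i _ =>
    isOpen_biInter_finset fun k _ => ?_
  exact isOpen_lt (((continuous_corr A n (A.measurable i) (A.measurable k)).sub
    (P.continuous_corr A (A.measurable i) (A.measurable k))).abs) continuous_const

end WeakLimits

/-! ### The Baire category argument -/

section Generic

variable {X : Type*} [MeasurableSpace X] [StandardBorelSpace X] {μ : Measure X}
  [IsProbabilityMeasure μ] [NullSingletonClass μ]

/-- The reduction to the density of the open sets `nearSet`. -/
theorem isTypicalExt_of_dense (A : DenseFamily (μ.prod μ)) (S : Aut μ)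
    (F : Set AdmissibleFunction)
    (h : ∀ P ∈ F, ∀ N, ∀ R ∈ Ext S, ∀ ε : ℝ, 0 < ε → ∃ R' ∈ Ext S, R' ∈ nearSet A P N ∧
      (halmosMetric A).dist R R' < ε) :
    IsTypicalExt A S {R | ∀ P ∈ F, IsWeakLimitOfPowers R (P.eval R)} := by
  let _ : MetricSpace (Aut (μ.prod μ)) := halmosMetric A
  have : CompleteSpace (Ext S) := completeSpace_ext A S
  obtain ⟨F₀, hF₀, hc, hdense⟩ := exists_countable_dense_subfamily F
  have hopen : ∀ P N, IsOpen {R : Ext S | (R : Aut (μ.prod μ)) ∈ nearSet A P N} := fun P N =>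
    (isOpen_nearSet A P N).preimage continuous_subtype_val
  refine ⟨⋂ P ∈ F₀, ⋂ N : ℕ, {R : Ext S | (R : Aut (μ.prod μ)) ∈ nearSet A P N}, ?_, ?_, ?_⟩
  · exact IsGδ.biInter hc fun P _ => IsGδ.iInter_of_isOpen fun N => hopen P N
  · refine dense_biInter_of_Gδ (fun P _ => IsGδ.iInter_of_isOpen fun N => hopen P N) hc
      fun P hP => dense_iInter_of_isOpen (fun N => hopen P N) fun N => ?_
    rw [Metric.dense_iff]
    intro R ε hε
    obtain ⟨R', hR', hnear, hd⟩ := h P (hF₀ hP) N R R.2 ε hε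
    refine ⟨⟨R', hR'⟩, ?_, hnear⟩
    rw [Metric.mem_ball, dist_comm]
    exact hd
  · intro R hR Q hQ
    simp only [Set.mem_iInter] at hR
    obtain ⟨P, hP, h1, h2⟩ := hdense Q hQ
    exact isWeakLimitOfPowers_of_mem_nearSet A fun N =>
      mem_nearSet_of_tendsto A h1 h2 (fun k N => hR (P k) (hP k) N) N

end Generic

/-! ### Uniform coordinates on atomless spaces -/

section Uniform

/-- The jump of the distribution function at a point is the mass of that point. -/
theorem continuous_cdf (ν : Measure ℝ) [IsProbabilityMeasure ν] [NullSingletonClass ν] :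
    Continuous (ProbabilityTheory.cdf ν) := by
  rw [continuous_iff_continuousAt]
  intro x
  have hmono := (ProbabilityTheory.cdf ν).mono
  rw [hmono.continuousAt_iff_leftLim_eq_rightLim, StieltjesFunction.rightLim_eq]
  have h := (ProbabilityTheory.cdf ν).measure_singleton x
  rw [ProbabilityTheory.measure_cdf, measure_singleton, eq_comm, ENNReal.ofReal_eq_zero] at h
  exact le_antisymm (hmono.leftLim_le le_rfl) (by linarith)

/-- By continuity all levels in `(0, 1)` are attained. The sublevel set contains the half-line
ending at a point of level `t` and is contained in those ending at points of any higher level. -/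
theorem measureReal_cdf_le (ν : Measure ℝ) [IsProbabilityMeasure ν] [NullSingletonClass ν] {t : ℝ}
    (h0 : 0 < t) (h1 : t < 1) : ν.real {x | ProbabilityTheory.cdf ν x ≤ t} = t := by
  set F := ProbabilityTheory.cdf ν with hF
  have hsurj : ∀ t, 0 < t → t < 1 → ∃ x, F x = t := by
    intro t h0 h1
    refine mem_range_of_exists_le_of_exists_ge (continuous_cdf ν) ?_ ?_
    · exact ((ProbabilityTheory.tendsto_cdf_atBot ν).eventually (gt_mem_nhds h0)).exists.imp
        fun _ h => h.le
    · exact ((ProbabilityTheory.tendsto_cdf_atTop ν).eventually (lt_mem_nhds h1)).exists.imp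
        fun _ h => h.le
  refine le_antisymm (le_of_forall_gt_imp_ge_of_dense fun t' ht' => ?_) ?_
  · rcases lt_or_ge t' 1 with h | h
    · obtain ⟨x, hx⟩ := hsurj t' (h0.trans ht') h
      rw [← hx, hF, ProbabilityTheory.cdf_eq_real]
      refine measureReal_mono fun y (hy : F y ≤ t) => ?_
      by_contra hxy
      have := F.mono (not_le.1 hxy).le
      linarith
    · exact measureReal_le_one.trans h
  · obtain ⟨x, hx⟩ := hsurj t h0 h1
    conv_lhs => rw [← hx, hF, ProbabilityTheory.cdf_eq_real]
    exact measureReal_mono fun y (hy : y ≤ x) => hx ▸ F.mono hy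

theorem map_cdf (ν : Measure ℝ) [IsProbabilityMeasure ν] [NullSingletonClass ν] :
    ν.map (ProbabilityTheory.cdf ν) = volume.restrict (Set.Ioc 0 1) := by
  have hm : Measurable (ProbabilityTheory.cdf ν) := (continuous_cdf ν).measurable
  have : IsProbabilityMeasure (ν.map (ProbabilityTheory.cdf ν)) :=
    Measure.isProbabilityMeasure_map hm.aemeasurable
  refine Measure.ext_of_Iic _ _ fun t => ?_
  rw [Measure.map_apply hm measurableSet_Iic, Measure.restrict_apply measurableSet_Iic]
  have hpre : ProbabilityTheory.cdf ν ⁻¹' Set.Iic t = {x | ProbabilityTheory.cdf ν x ≤ t} := rfl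
  rw [hpre]
  rcases le_or_gt 1 t with h1 | h1
  · have e1 : {x | ProbabilityTheory.cdf ν x ≤ t} = Set.univ :=
      Set.eq_univ_of_forall fun x => (ProbabilityTheory.cdf_le_one ν x).trans h1
    have e2 : Set.Iic t ∩ Set.Ioc 0 1 = Set.Ioc 0 1 :=
      Set.inter_eq_right.2 fun x hx => hx.2.trans h1
    rw [e1, e2]
    simp
  rcases lt_or_ge 0 t with h0 | h0
  · have e2 : Set.Iic t ∩ Set.Ioc 0 1 = Set.Ioc 0 t := by
      ext x
      simp only [Set.mem_inter_iff, Set.mem_Iic, Set.mem_Ioc]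
      constructor
      · exact fun h => ⟨h.2.1, h.1⟩
      · exact fun h => ⟨h.2, h.1, h.2.trans h1.le⟩
    rw [e2, Real.volume_Ioc, sub_zero, ← measureReal_cdf_le ν h0 h1, ofReal_measureReal,
      measureReal_cdf_le ν h0 h1]
  · have e2 : Set.Iic t ∩ Set.Ioc 0 1 = ∅ := by
      ext x
      simp only [Set.mem_inter_iff, Set.mem_Iic, Set.mem_Ioc, Set.mem_empty_iff_false, iff_false]
      rintro ⟨h, h', _⟩
      linarith
    rw [e2, measure_empty, ← measureReal_eq_zero_iff]
    refine le_antisymm (le_of_forall_gt_imp_ge_of_dense fun t' ht' => ?_) measureReal_nonneg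
    rcases lt_or_ge t' 1 with h | h
    · rw [← measureReal_cdf_le ν ht' h]
      exact measureReal_mono fun x (hx : _ ≤ t) => (hx.trans h0).trans ht'.le
    · exact measureReal_le_one.trans h

variable {Z : Type*} [MeasurableSpace Z] [StandardBorelSpace Z]

/-- An atomless standard probability space has an almost everywhere invertible coordinate which is
uniformly distributed on the unit interval. -/
theorem exists_uniform_coordinate (m : Measure Z) [IsProbabilityMeasure m]
    [NullSingletonClass m] :
    ∃ h : Z → ℝ, Measurable h ∧ m.map h = volume.restrict (Set.Ioc 0 1) ∧
      ∃ q : ℝ → Z, Measurable q ∧ ∀ᵐ z ∂m, q (h z) = z := by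
  have hne : Nonempty Z := m.nonempty_of_neZero
  set e := embeddingReal Z
  have he : MeasurableEmbedding e := measurableEmbedding_embeddingReal Z
  set ν := m.map e with hν
  have : IsProbabilityMeasure ν := Measure.isProbabilityMeasure_map he.measurable.aemeasurable
  have : NullSingletonClass ν := ⟨fun x => by
    rw [hν, he.map_apply]
    exact (Set.subsingleton_singleton.preimage he.injective).measure_zero m⟩
  set F := ProbabilityTheory.cdf ν with hF
  have hFm : Measurable F := (continuous_cdf ν).measurable
  have hlaw : m.map (F ∘ e) = volume.restrict (Set.Ioc 0 1) := by
    rw [← Measure.map_map hFm he.measurable, ← map_cdf ν]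
  refine ⟨F ∘ e, hFm.comp he.measurable, hlaw, ?_⟩
  -- Injectivity of `F` fails only on flat intervals. Each of these contains a rational, and each
  -- level of `F ∘ e` is null because its law has no atoms.
  set N : Set Z := ⋃ r : ℚ, {z | F (e z) = F r ∧ e z < r} with hN
  have hN0 : m N = 0 := by
    refine measure_iUnion_null fun r => ?_
    have h1 : m ((F ∘ e) ⁻¹' {F r}) = 0 := by
      rw [← Measure.map_apply (hFm.comp he.measurable) (measurableSet_singleton _), hlaw]
      exact measure_singleton _
    exact measure_mono_null (fun z hz => hz.1) h1
  have hNm : MeasurableSet N := MeasurableSet.iUnion fun r =>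
    (measurableSet_eq_fun (hFm.comp he.measurable) measurable_const).inter
      (measurableSet_lt he.measurable measurable_const)
  have hlt : ∀ z w : Z, z ∉ N → e z < e w → F (e z) ≠ F (e w) := by
    intro z w hz hzw heq
    obtain ⟨r, hr1, hr2⟩ := exists_rat_btwn hzw
    refine hz (Set.mem_iUnion.2 ⟨r, le_antisymm (F.mono hr1.le) ?_, hr1⟩)
    rw [heq]
    exact F.mono hr2.le
  have hinj : Function.Injective fun z : ↥(Nᶜ) => F (e z) := by
    intro z w hzw
    rcases lt_trichotomy (e z) (e w) with h | h | h
    · exact absurd hzw (hlt z w z.2 h)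
    · exact Subtype.ext (he.injective h)
    · exact absurd hzw.symm (hlt w z w.2 h)
  have : StandardBorelSpace ↥(Nᶜ) := hNm.compl.standardBorel
  have hemb : MeasurableEmbedding fun z : ↥(Nᶜ) => F (e z) :=
    (hFm.comp (he.measurable.comp measurable_subtype_coe)).measurableEmbedding hinj
  obtain ⟨q, hq, hqe⟩ := hemb.exists_measurable_extend (f := fun z : ↥(Nᶜ) => F (e z))
    (g := fun z : ↥(Nᶜ) => (z : Z)) measurable_subtype_coe fun _ => hne
  refine ⟨q, hq, ?_⟩
  filter_upwards [compl_mem_ae_iff.2 hN0] with z hz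
  exact congrFun hqe ⟨z, hz⟩

/-- A finite atomless measure can be split in given proportions. -/
theorem exists_split (m : Measure Z) [IsFiniteMeasure m] [NullSingletonClass m] {w : ℕ → ℝ}
    (hw : ∀ i, 0 ≤ w i) {d : ℕ} (hd : ∑ i ∈ Finset.range (d + 1), w i = 1)
    (hd' : ∀ i > d, w i = 0) :
    ∃ ι : Z → ℕ, Measurable ι ∧ (∀ z, w (ι z) ≠ 0) ∧
      ∀ i, m.real (ι ⁻¹' {i}) = w i * m.real Set.univ := by
  classical
  obtain ⟨i₀, hi₀⟩ : ∃ i, w i ≠ 0 := by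
    by_contra! h
    simp [h] at hd
  rcases eq_or_ne m 0 with rfl | hm
  · exact ⟨fun _ => i₀, measurable_const, fun _ => hi₀, fun i => by simp⟩
  have : NeZero m := ⟨hm⟩
  set c := m Set.univ with hc
  have hc0 : c ≠ 0 := by simpa [hc] using hm
  have hct : c ≠ ∞ := measure_ne_top m _
  set ν := c⁻¹ • m with hν
  have : IsProbabilityMeasure ν := isProbabilityMeasureSMul
  have : NullSingletonClass ν := ⟨fun x => by simp [hν]⟩
  obtain ⟨h, hh, hlaw, -⟩ := exists_uniform_coordinate ν
  set W : ℕ → ℝ := fun i => ∑ k ∈ Finset.range (i + 1), w k with hW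
  have hWmono : Monotone W := fun a b hab =>
    Finset.sum_le_sum_of_subset_of_nonneg (by gcongr) fun i _ _ => hw i
  have hW1 : ∀ i, W i ≤ 1 := by
    intro i
    rcases le_total i d with hi | hi
    · exact (hWmono hi).trans hd.le
    · have : W i = W d := by
        refine (Finset.sum_subset (by gcongr) fun k _ hk => hd' k ?_).symm
        simpa using hk
      exact (this.trans hd).le
  have hW0 : ∀ i, 0 ≤ W i := fun i => Finset.sum_nonneg fun k _ => hw k
  have hcdf : ∀ i, ν.real {z | h z ≤ W i} = W i := by
    intro i
    have e1 : {z | h z ≤ W i} = h ⁻¹' Set.Iic (W i) := rfl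
    rw [e1, measureReal_def, ← Measure.map_apply hh measurableSet_Iic, hlaw,
      Measure.restrict_apply measurableSet_Iic]
    have e2 : Set.Iic (W i) ∩ Set.Ioc 0 1 = Set.Ioc 0 (W i) := by
      ext x
      simp only [Set.mem_inter_iff, Set.mem_Iic, Set.mem_Ioc]
      exact ⟨fun h => ⟨h.2.1, h.1⟩, fun h => ⟨h.2, h.1, h.2.trans (hW1 i)⟩⟩
    rw [e2, Real.volume_Ioc, sub_zero, ENNReal.toReal_ofReal (hW0 i)]
  have hle : ∀ i, MeasurableSet {z | h z ≤ W i} := fun i => measurableSet_le hh measurable_const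
  -- These are the preimages of consecutive intervals of lengths `w i`, bounded by the partial sums.
  set D : ℕ → Set Z := fun i => {z | h z ≤ W i ∧ ∀ k < i, W k < h z} with hD
  have hDm : ∀ i, MeasurableSet (D i) := by
    intro i
    have : D i = {z | h z ≤ W i} ∩ ⋂ k, ⋂ (_ : k < i), {z | h z ≤ W k}ᶜ := by
      ext z; simp [hD]
    rw [this]
    exact (hle i).inter (MeasurableSet.iInter fun k => MeasurableSet.iInter fun _ => (hle k).compl)
  have hDν : ∀ i, ν.real (D i) = w i := by
    intro i
    cases i with
    | zero =>
      have : D 0 = {z | h z ≤ W 0} := by ext z; simp [hD]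
      rw [this, hcdf]
      simp [hW]
    | succ i =>
      have : D (i + 1) = {z | h z ≤ W (i + 1)} \ {z | h z ≤ W i} := by
        ext z
        simp only [hD, Set.mem_ofPred_eq, Set.mem_sdiff, not_le]
        refine and_congr_right fun _ => ⟨fun h => h i (Nat.lt_succ_self i), fun h k hk => ?_⟩
        exact (hWmono (Nat.lt_succ_iff.1 hk)).trans_lt h
      have hsub : {z | h z ≤ W i} ⊆ {z | h z ≤ W (i + 1)} := fun z hz =>
        le_trans (show h z ≤ W i from hz) (hWmono (Nat.le_succ i))
      rw [this, measureReal_sdiff hsub (hle i), hcdf, hcdf]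
      simp [hW, Finset.sum_range_succ _ (i + 1)]
  have hDdis : ∀ i k z, z ∈ D i → z ∈ D k → i = k := by
    intro i k z hi hk
    by_contra hne
    rcases lt_or_gt_of_ne hne with h | h
    · exact absurd hi.1 (not_le.2 (hk.2 i h))
    · exact absurd hk.1 (not_le.2 (hi.2 k h))
  -- The default `i₀` has positive weight. It is used only on a null set, so that labels of weight
  -- zero never occur, even at exceptional points.
  have hex : ∀ z, ∃ i, (z ∈ D i ∧ w i ≠ 0) ∨ (i = i₀ ∧ ∀ k, z ∈ D k → w k = 0) := by
    intro z
    by_cases h : ∃ i, z ∈ D i ∧ w i ≠ 0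
    · obtain ⟨i, hi⟩ := h
      exact ⟨i, Or.inl hi⟩
    · push Not at h
      exact ⟨i₀, Or.inr ⟨rfl, h⟩⟩
  have hfull : ∀ᵐ z ∂ν, ∃ i, z ∈ D i := by
    have h1 : ν.real {z | h z ≤ W d} = 1 := (hcdf d).trans hd
    have h2 : ∀ᵐ z ∂ν, h z ≤ W d := by
      rw [ae_iff]
      have := prob_compl_eq_zero_iff (μ := ν) (hle d)
      refine this.2 ?_
      rw [← ofReal_measureReal, h1, ENNReal.ofReal_one]
    filter_upwards [h2] with z hz
    have hz' : ∃ i, h z ≤ W i := ⟨d, hz⟩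
    exact ⟨Nat.find hz', Nat.find_spec hz', fun k hk => not_le.1 (Nat.find_min hz' hk)⟩
  have hnull : ∀ᵐ z ∂ν, ∀ i, w i = 0 → z ∉ D i := by
    rw [ae_all_iff]
    intro i
    by_cases hi : w i = 0
    · have := (measureReal_eq_zero_iff (μ := ν)).1 ((hDν i).trans hi)
      filter_upwards [compl_mem_ae_iff.2 this] with z hz _
      exact hz
    · simp [hi]
  set ι : Z → ℕ := fun z => Nat.find (hex z) with hι
  have hιm : Measurable ι := by
    refine measurable_find hex fun i => ?_
    refine MeasurableSet.union ((hDm i).inter (MeasurableSet.const _))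
      (MeasurableSet.inter (MeasurableSet.const _) ?_)
    have : {z | ∀ k, z ∈ D k → w k = 0} = ⋂ k, {z | z ∈ D k → w k = 0} := by
      ext z; simp
    change MeasurableSet {z | ∀ k, z ∈ D k → w k = 0}
    rw [this]
    refine MeasurableSet.iInter fun k => ?_
    by_cases hk : w k = 0
    · simp [hk]
    · have : {z | z ∈ D k → w k = 0} = (D k)ᶜ := by
        ext z; simp [hk]
      rw [this]
      exact (hDm k).compl
  have hιae : ∀ i, (ι ⁻¹' {i} : Set Z) =ᵐ[ν] D i := by
    intro i
    filter_upwards [hfull, hnull] with z hz hz'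
    obtain ⟨k, hk⟩ := hz
    have hspec : z ∈ D (ι z) := by
      rcases Nat.find_spec (hex z) with h | h
      · exact h.1
      · exact absurd hk (hz' k (h.2 k hk))
    apply propext
    change ι z = i ↔ z ∈ D i
    exact ⟨fun h => h ▸ hspec, fun h => hDdis _ _ z hspec h⟩
  refine ⟨ι, hιm, fun z => ?_, fun i => ?_⟩
  · rcases Nat.find_spec (hex z) with h | h
    · exact h.2
    · change w (Nat.find (hex z)) ≠ 0
      rw [h.1]; exact hi₀
  · have h1 := (measureReal_congr (hιae i)).trans (hDν i)
    rw [hν, measureReal_ennreal_smul_apply, ENNReal.toReal_inv] at h1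
    have h2 : c.toReal ≠ 0 := ENNReal.toReal_ne_zero.2 ⟨hc0, hct⟩
    rw [← h1, measureReal_def m Set.univ]
    change _ = c.toReal⁻¹ * m.real (ι ⁻¹' {i}) * c.toReal
    field_simp

/-- A finite atomless measure can be split in given proportions, independently of a countable
partition. -/
theorem exists_split_partition (m : Measure Z) [IsFiniteMeasure m] [NullSingletonClass m]
    {κ : Type*} [Countable κ] [MeasurableSpace κ] [MeasurableSingletonClass κ] {π : Z → κ}
    (hπ : Measurable π) {w : ℕ → ℝ} (hw : ∀ i, 0 ≤ w i) {d : ℕ}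
    (hd : ∑ i ∈ Finset.range (d + 1), w i = 1) (hd' : ∀ i > d, w i = 0) :
    ∃ ι : Z → ℕ, Measurable ι ∧ (∀ z, w (ι z) ≠ 0) ∧
      ∀ k i, m.real (π ⁻¹' {k} ∩ ι ⁻¹' {i}) = w i * m.real (π ⁻¹' {k}) := by
  choose ι hιm hιw hι using fun k => exists_split (m.restrict (π ⁻¹' {k})) hw hd hd'
  refine ⟨fun z => ι (π z) z, ?_, fun z => hιw _ _, fun k i => ?_⟩
  · have h : Measurable fun p : κ × Z => ι p.1 p.2 := measurable_from_prod_countable_right hιm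
    exact h.comp (hπ.prodMk measurable_id)
  · have h := hι k i
    rw [measureReal_restrict_apply (hιm k (measurableSet_singleton i)),
      measureReal_restrict_apply MeasurableSet.univ, Set.univ_inter] at h
    rw [← h]
    congr 1
    ext z
    simp only [Set.mem_inter_iff, Set.mem_preimage, Set.mem_singleton_iff]
    constructor
    · rintro ⟨rfl, h'⟩; exact ⟨h', rfl⟩
    · rintro ⟨h', rfl⟩; exact ⟨rfl, h'⟩

end Uniform

/-! ### An aperiodic transformation of the fibres -/

section Aperiodic

variable {X : Type*} [MeasurableSpace X] [StandardBorelSpace X] {μ : Measure X}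
  [IsProbabilityMeasure μ] [NullSingletonClass μ]

/-- Passing from the interval to the circle makes rotations available, and with them an aperiodic
transformation of the fibre. -/
theorem exists_circle_coordinate (μ : Measure X) [IsProbabilityMeasure μ]
    [NullSingletonClass μ] :
    ∃ (h : X → UnitAddCircle) (q : UnitAddCircle → X), MeasurePreserving h μ volume ∧
      MeasurePreserving q volume μ ∧ (∀ᵐ x ∂μ, q (h x) = x) ∧ ∀ᵐ c, h (q c) = c := by
  obtain ⟨h, hh, hlaw, q, hq, hqh⟩ := exists_uniform_coordinate μ
  have hmk := UnitAddCircle.measurePreserving_mk 0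
  rw [zero_add] at hmk
  have h1 : MeasurePreserving (fun x => (h x : UnitAddCircle)) μ volume := by
    refine ⟨hmk.measurable.comp hh, ?_⟩
    rw [← hmk.map_eq, ← hlaw, Measure.map_map hmk.measurable hh]
    rfl
  have hq' : Measurable fun c : UnitAddCircle => q (AddCircle.measurableEquivIoc 1 0 c) :=
    hq.comp (measurable_subtype_coe.comp (AddCircle.measurableEquivIoc 1 0).measurable)
  have hIoc : ∀ᵐ x ∂μ, h x ∈ Set.Ioc (0 : ℝ) 1 := by
    refine ae_of_ae_map hh.aemeasurable (p := fun u => u ∈ Set.Ioc (0 : ℝ) 1) ?_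
    rw [hlaw]
    exact ae_restrict_mem measurableSet_Ioc
  have h2 : ∀ᵐ x ∂μ, q (AddCircle.measurableEquivIoc 1 0 (h x : UnitAddCircle)) = x := by
    filter_upwards [hqh, hIoc] with x hx hx'
    have : ((AddCircle.measurableEquivIoc (1 : ℝ) 0 (h x : UnitAddCircle) : Set.Ioc (0 : ℝ) (0 + 1))
        : ℝ) = h x :=
      congrArg Subtype.val (AddCircle.equivIoc_coe_eq (p := (1 : ℝ)) (a := 0) (x := h x)
        (by simpa using hx'))
    rw [this, hx]
  refine ⟨_, _, h1, ⟨hq', ?_⟩, h2, ?_⟩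
  · rw [← h1.map_eq, Measure.map_map hq' h1.measurable]
    exact (Measure.map_congr h2).trans Measure.map_id
  · rw [← h1.map_eq]
    refine (ae_map_iff h1.measurable.aemeasurable
      (measurableSet_eq_fun (h1.measurable.comp hq') measurable_id)).2 ?_
    filter_upwards [h2] with x hx
    exact congrArg (fun x => (h x : UnitAddCircle)) hx

theorem exists_infinite_order : ∃ a : UnitAddCircle, ∀ k : ℕ, 1 ≤ k → k • a ≠ 0 := by
  refine ⟨((√2 : ℝ) : UnitAddCircle), fun k hk h => ?_⟩
  rw [← AddCircle.coe_nsmul, AddCircle.coe_eq_zero_iff] at h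
  obtain ⟨n, hn⟩ := h
  have hirr := irrational_sqrt_two.natCast_mul (m := k) (by omega)
  refine hirr ⟨n, ?_⟩
  simpa using hn

/-- There is a transformation which covers the identity and is aperiodic. -/
theorem exists_isOver_one_aperiodic (μ : Measure X) [IsProbabilityMeasure μ]
    [NullSingletonClass μ] :
    ∃ W : MPMap (μ.prod μ), IsOver 1 W ∧ ∀ᵐ z ∂μ.prod μ, ∀ k : ℕ, 1 ≤ k → (W ^ k).1 z ≠ z := by
  obtain ⟨h, q, hh, hq, hqh, hhq⟩ := exists_circle_coordinate μ
  obtain ⟨a, ha⟩ := exists_infinite_order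
  have hrot : ∀ b : UnitAddCircle, MeasurePreserving (fun x => q (h x + b)) μ μ := fun b =>
    hq.comp ((measurePreserving_add_right volume b).comp hh)
  have hcomp : ∀ b : UnitAddCircle, ∀ᵐ x ∂μ, h (q (h x + b)) = h x + b := fun b =>
    ((measurePreserving_add_right volume b).comp hh).quasiMeasurePreserving.ae hhq
  have hinv : ∀ᵐ z : X × X ∂μ.prod μ, q (h (q (h z.2 + a)) + -a) = z.2 := by
    refine Measure.quasiMeasurePreserving_snd.ae
      (p := fun y => q (h (q (h y + a)) + -a) = y) ?_
    filter_upwards [hcomp a, hqh] with y h1 h2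
    rw [h1, add_neg_cancel_right, h2]
  -- The model is the identity on the base times a rotation of infinite order, read in the circle
  -- coordinate; it is only invertible almost everywhere before this correction.
  obtain ⟨W, hW, hWe⟩ := exists_isOver_ae_eq (μ := μ) 1
    (r := Prod.map id fun y => q (h y + a)) (r' := Prod.map id fun y => q (h y + -a))
    ((MeasurePreserving.id μ).prod (hrot a)) ((MeasurePreserving.id μ).prod (hrot (-a)))
    (hinv.mono fun z hz => Prod.ext rfl hz) (ae_of_all _ fun z => rfl)
  refine ⟨W, hW, ?_⟩
  have hstep : ∀ᵐ z ∂μ.prod μ, h (W.1 z).2 = h z.2 + a := by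
    filter_upwards [hWe, Measure.quasiMeasurePreserving_snd.ae (hcomp a)] with z h1 h2
    rw [h1]
    exact h2
  have hall : ∀ᵐ z ∂μ.prod μ, ∀ k : ℕ, h (W.1 ((W ^ k).1 z)).2 = h ((W ^ k).1 z).2 + a :=
    ae_all_iff.2 fun k => (W ^ k).2.quasiMeasurePreserving.ae hstep
  filter_upwards [hall] with z hz k hk hper
  have hk' : ∀ k : ℕ, h ((W ^ k).1 z).2 = h z.2 + k • a := by
    intro k
    induction k with
    | zero => simp
    | succ k ih => rw [pow_succ', mul_apply, hz, ih, succ_nsmul, add_assoc]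
  have h1 := hk' k
  rw [hper] at h1
  exact ha k hk (by simpa using h1.symm)

end Aperiodic

/-! ### Orbits, induced transformations and towers -/

section Orbits

variable {Z : Type*} [MeasurableSpace Z] {m : Measure Z}

/-- The action of `ℤ` generated by a transformation. -/
def act (R : MPMap m) (k : ℤ) (z : Z) : Z := (R ^ k).1 z

theorem act_add (R : MPMap m) (a b : ℤ) (z : Z) : act R (a + b) z = act R a (act R b z) :=
  zpow_add_apply R a b z

@[simp] theorem act_zero (R : MPMap m) (z : Z) : act R 0 z = z := rfl

theorem act_one (R : MPMap m) (z : Z) : act R 1 z = R.1 z := by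
  rw [act, zpow_one]

theorem act_natCast (R : MPMap m) (n : ℕ) (z : Z) : act R n z = (R ^ n).1 z := by
  rw [act, zpow_natCast]

@[simp] theorem act_neg_act (R : MPMap m) (k : ℤ) (z : Z) : act R (-k) (act R k z) = z := by
  rw [← act_add, neg_add_cancel, act_zero]

@[simp] theorem act_act_neg (R : MPMap m) (k : ℤ) (z : Z) : act R k (act R (-k) z) = z := by
  rw [← act_add, add_neg_cancel, act_zero]

theorem act_inv (R : MPMap m) (k : ℤ) (z : Z) : act R⁻¹ k z = act R (-k) z := by
  rw [act, act, inv_zpow']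

theorem act_injective (R : MPMap m) (k : ℤ) : Function.Injective (act R k) := (R ^ k).1.injective

theorem measurable_act (R : MPMap m) (k : ℤ) : Measurable (act R k) := (R ^ k).1.measurable

theorem measurableSet_act (R : MPMap m) (k : ℤ) {E : Set Z} (hE : MeasurableSet E) :
    MeasurableSet {z | act R k z ∈ E} := measurable_act R k hE

theorem measureReal_act (R : MPMap m) (k : ℤ) {E : Set Z} (hE : MeasurableSet E) :
    m.real {z | act R k z ∈ E} = m.real E := measureReal_preimage (R ^ k) hE

theorem quasiMeasurePreserving_act (R : MPMap m) (k : ℤ) :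
    Measure.QuasiMeasurePreserving (act R k) m m := (R ^ k).2.quasiMeasurePreserving

/-! ### Induced transformations -/

section Induced

variable {κ : Type*} (W : MPMap m) (π : Z → κ) (C : Set κ)

/-- The colour of `z` lies in `C` and is visited infinitely often in the past and in the future. -/
def IsRecurrent (z : Z) : Prop :=
  π z ∈ C ∧ (∀ N : ℕ, ∃ t ≥ N, π (act W t z) = π z) ∧ ∀ N : ℕ, ∃ t ≥ N, π (act W (-t) z) = π z

theorem isRecurrent_inv (z : Z) : IsRecurrent W⁻¹ π C z ↔ IsRecurrent W π C z := by
  simp only [IsRecurrent, act_inv, neg_neg]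
  tauto

variable {W π C}

/-- A shift of time by `k` is absorbed by asking for visits later than `N + |k|`. -/
theorem IsRecurrent.act {z : Z} (h : IsRecurrent W π C z) {k : ℤ}
    (hk : π (TypicalExt.act W k z) = π z) : IsRecurrent W π C (TypicalExt.act W k z) := by
  refine ⟨hk ▸ h.1, fun N => ?_, fun N => ?_⟩
  · obtain ⟨t, ht, hπ⟩ := h.2.1 (N + k.natAbs)
    refine ⟨(t - k).toNat, by omega, ?_⟩
    rw [← act_add, hk, ← hπ]
    congr 2
    omega
  · obtain ⟨t, ht, hπ⟩ := h.2.2 (N + k.natAbs)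
    refine ⟨(t + k).toNat, by omega, ?_⟩
    rw [← act_add, hk, ← hπ]
    congr 2
    omega

variable (W π C)

-- The value `0` at non-recurrent points makes the return map the identity there, so that it becomes
-- a bijection of the whole space and not merely almost everywhere.
open Classical in
theorem exists_returnTime (z : Z) : ∃ t : ℕ, (¬ IsRecurrent W π C z ∧ t = 0) ∨
    (IsRecurrent W π C z ∧ 1 ≤ t ∧ π (act W t z) = π z) := by
  by_cases h : IsRecurrent W π C z
  · obtain ⟨t, ht, hπ⟩ := h.2.1 1
    exact ⟨t, Or.inr ⟨h, ht, hπ⟩⟩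
  · exact ⟨0, Or.inl ⟨h, rfl⟩⟩

open Classical in
/-- The first return time to the set of points of the same colour. -/
noncomputable def returnTime (z : Z) : ℕ := Nat.find (exists_returnTime W π C z)

variable {W π C}

theorem returnTime_of_not {z : Z} (h : ¬ IsRecurrent W π C z) : returnTime W π C z = 0 := by
  classical
  rcases Nat.find_spec (exists_returnTime W π C z) with h' | h'
  · exact h'.2
  · exact absurd h'.1 h

theorem returnTime_spec {z : Z} (h : IsRecurrent W π C z) :
    1 ≤ returnTime W π C z ∧ π (act W (returnTime W π C z) z) = π z := by
  classical
  rcases Nat.find_spec (exists_returnTime W π C z) with h' | h'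
  · exact absurd h h'.1
  · exact h'.2

theorem lt_returnTime {z : Z} {u : ℕ} (h1 : 1 ≤ u) (hu : u < returnTime W π C z) :
    π (act W u z) ≠ π z := by
  classical
  intro h
  by_cases hz : IsRecurrent W π C z
  · exact Nat.find_min (exists_returnTime W π C z) hu (Or.inr ⟨hz, h1, h⟩)
  · rw [returnTime_of_not hz] at hu
    omega

theorem returnTime_eq {z : Z} (h : IsRecurrent W π C z) {t : ℕ} (h1 : 1 ≤ t)
    (ht : π (act W t z) = π z) (hmin : ∀ u : ℕ, 1 ≤ u → u < t → π (act W u z) ≠ π z) :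
    returnTime W π C z = t := by
  have hs := returnTime_spec h
  rcases lt_trichotomy (returnTime W π C z) t with h' | h' | h'
  · exact absurd hs.2 (hmin _ hs.1 h')
  · exact h'
  · exact absurd ht (lt_returnTime h1 h')

variable (W π C)

/-- The return map to the set of points of the same colour. -/
noncomputable def returnMap (z : Z) : Z := act W (returnTime W π C z) z

theorem colour_returnMap (z : Z) : π (returnMap W π C z) = π z := by
  by_cases h : IsRecurrent W π C z
  · exact (returnTime_spec h).2
  · rw [returnMap, returnTime_of_not h, Nat.cast_zero, act_zero]

/-- Time reversal: an earlier return in backward time would be an earlier return in forward time.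
Two-sided recurrence ensures that the returned point is again recurrent. -/
theorem returnMap_inv_returnMap (z : Z) : returnMap W⁻¹ π C (returnMap W π C z) = z := by
  by_cases h : IsRecurrent W π C z
  · have hs := returnTime_spec h
    have hw : IsRecurrent W⁻¹ π C (returnMap W π C z) :=
      (isRecurrent_inv W π C _).2 (h.act hs.2)
    have : returnTime W⁻¹ π C (returnMap W π C z) = returnTime W π C z := by
      refine returnTime_eq hw hs.1 ?_ fun u h1 hu => ?_
      · rw [act_inv, returnMap, act_neg_act, hs.2]
      · rw [act_inv, colour_returnMap W π C, returnMap, ← act_add]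
        rw [show (-(u : ℤ) + (returnTime W π C z : ℤ)) = ((returnTime W π C z - u : ℕ) : ℤ) by
          omega]
        exact lt_returnTime (W := W) (π := π) (C := C) (by omega) (by omega)
    rw [returnMap, this, act_inv, returnMap, act_neg_act]
  · have h0 : returnMap W π C z = z := by
      rw [returnMap, returnTime_of_not h, Nat.cast_zero, act_zero]
    rw [h0, returnMap, returnTime_of_not fun h' => h ((isRecurrent_inv W π C z).1 h'),
      Nat.cast_zero, act_zero]

theorem returnMap_bijective : Function.Bijective (returnMap W π C) := by
  refine Function.bijective_iff_has_inverse.2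
    ⟨returnMap W⁻¹ π C, returnMap_inv_returnMap W π C, fun z => ?_⟩
  have := returnMap_inv_returnMap W⁻¹ π C z
  rwa [inv_inv] at this

variable [Countable κ] [MeasurableSpace κ] [MeasurableSingletonClass κ] {π}

theorem measurableSet_isRecurrent (hπ : Measurable π) :
    MeasurableSet {z | IsRecurrent W π C z} := by
  have h1 : ∀ k : ℤ, MeasurableSet {z | π (act W k z) = π z} := fun k =>
    measurableSet_eq_fun (hπ.comp (measurable_act W k)) hπ
  have h2 : {z | IsRecurrent W π C z} = π ⁻¹' C ∩
      ((⋂ N : ℕ, ⋃ t : ℕ, ⋃ (_ : t ≥ N), {z | π (act W t z) = π z}) ∩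
      ⋂ N : ℕ, ⋃ t : ℕ, ⋃ (_ : t ≥ N), {z | π (act W (-t) z) = π z}) := by
    ext z
    simp [IsRecurrent]
  rw [h2]
  refine (hπ (Set.to_countable C).measurableSet).inter (MeasurableSet.inter ?_ ?_)
  · exact MeasurableSet.iInter fun N => MeasurableSet.iUnion fun t =>
      MeasurableSet.iUnion fun _ => h1 t
  · exact MeasurableSet.iInter fun N => MeasurableSet.iUnion fun t =>
      MeasurableSet.iUnion fun _ => h1 (-t)

theorem measurable_returnTime (hπ : Measurable π) : Measurable (returnTime W π C) := by
  classical
  refine measurable_find _ fun t => ?_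
  have h := measurableSet_isRecurrent W C hπ
  refine MeasurableSet.union (h.compl.inter (MeasurableSet.const _)) (h.inter
    ((MeasurableSet.const _).inter ?_))
  exact measurableSet_eq_fun (hπ.comp (measurable_act W t)) hπ

/-- Poincaré recurrence for `W` and for `W⁻¹`, applied to each of the countably many colour classes.
-/
theorem ae_isRecurrent [IsFiniteMeasure m] (hπ : Measurable π) :
    ∀ᵐ z ∂m, π z ∈ C → IsRecurrent W π C z := by
  have h : ∀ U : MPMap m, ∀ᵐ z ∂m, ∀ N : ℕ, ∃ t ≥ N, π (act U t z) = π z := by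
    intro U
    have h1 : ∀ c : κ, ∀ᵐ z ∂m, z ∈ π ⁻¹' {c} → ∃ᶠ n in atTop, U.1^[n] z ∈ π ⁻¹' {c} := fun c =>
      U.2.conservative.ae_mem_imp_frequently_image_mem
        (hπ (measurableSet_singleton c)).nullMeasurableSet
    filter_upwards [ae_all_iff.2 h1] with z hz N
    obtain ⟨t, ht, h'⟩ := frequently_atTop.1 (hz (π z) rfl) N
    refine ⟨t, ht, ?_⟩
    rw [act_natCast, coe_pow]
    exact h'
  filter_upwards [h W, h W⁻¹] with z h1 h2 hC
  refine ⟨hC, h1, ?_⟩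
  simpa only [act_inv] using h2

/-- The transformation induced by `W` on each of the sets `π ⁻¹' {c}`, `c ∈ C`. -/
theorem exists_induced [StandardBorelSpace Z] [IsFiniteMeasure m] (hπ : Measurable π) :
    ∃ Φ : MPMap m, (∀ z, ∃ k : ℤ, Φ.1 z = act W k z) ∧ (∀ z, π (Φ.1 z) = π z) ∧
      (∀ z, π z ∉ C → Φ.1 z = z) ∧
      ∀ᵐ z ∂m, π z ∈ C → ∃ t : ℕ, 1 ≤ t ∧ Φ.1 z = act W t z ∧
        ∀ u : ℕ, 1 ≤ u → u < t → π (act W u z) ≠ π z := by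
  obtain ⟨Φ, hΦ⟩ := exists_mpMap_of_piecewise (fun k : ℤ => W ^ k)
    (fun z => (returnTime W π C z : ℤ)) (measurable_from_top.comp (measurable_returnTime W C hπ))
    (returnMap_bijective W π C)
  have hΦ' : ∀ z, Φ.1 z = returnMap W π C z := hΦ
  refine ⟨Φ, fun z => ⟨_, hΦ z⟩, fun z => ?_, fun z hz => ?_, ?_⟩
  · rw [hΦ', colour_returnMap W π C]
  · rw [hΦ', returnMap, returnTime_of_not fun h => hz h.1, Nat.cast_zero, act_zero]
  · filter_upwards [ae_isRecurrent W C hπ] with z hz hC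
    exact ⟨_, (returnTime_spec (hz hC)).1, hΦ z, fun u => lt_returnTime⟩

end Induced

/-! ### Markers and Rokhlin towers -/

/-- A set which is disjoint from its first `H - 1` translates has measure at most `1 / H`. -/
theorem mul_measureReal_le_one [IsProbabilityMeasure m] (R : MPMap m) {H : ℕ} {E : Set Z}
    (hE : MeasurableSet E) (hsep : ∀ z ∈ E, ∀ t : ℕ, 1 ≤ t → t < H → act R t z ∉ E) :
    H * m.real E ≤ 1 := by
  have h1 : m.real (⋃ a ∈ Finset.range H, {z | act R (-a) z ∈ E}) =
      ∑ a ∈ Finset.range H, m.real {z | act R (-a) z ∈ E} := by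
    refine measureReal_biUnion_finset ?_ fun a _ => measurableSet_act R _ hE
    have key : ∀ a b : ℕ, b < H → a < b → ∀ z, act R (-a) z ∈ E → act R (-b) z ∈ E → False := by
      intro a b hb hab z ha hb'
      refine hsep _ hb' (b - a) (by omega) (by omega) ?_
      rw [← act_add]
      convert ha using 2
      omega
    intro a ha b hb hab
    refine Set.disjoint_left.2 fun z hza hzb => ?_
    rcases lt_or_gt_of_ne hab with h | h
    · exact key a b (Finset.mem_range.1 hb) h z hza hzb
    · exact key b a (Finset.mem_range.1 ha) h z hzb hza
  simp only [measureReal_act R _ hE, Finset.sum_const, Finset.card_range, nsmul_eq_mul] at h1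
  rw [← h1]
  exact measureReal_le_one

/-- A set of aperiodic points contains a separated set which meets every orbit with bounded gaps. -/
theorem exists_marker [StandardBorelSpace Z] (R : MPMap m) (M : ℕ) {A : Set Z}
    (hA : MeasurableSet A) (hap : ∀ z ∈ A, ∀ k : ℕ, 1 ≤ k → act R k z ≠ z) (hM : 1 ≤ M) :
    ∃ E ⊆ A, MeasurableSet E ∧ (∀ z ∈ E, ∀ t : ℕ, 1 ≤ t → t < M → act R t z ∉ E) ∧
      ∀ z ∈ A, ∃ t : ℕ, t < M ∧ (act R t z ∈ E ∨ act R (-t) z ∈ E) := by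
  obtain ⟨f, hf⟩ := exists_surjective_nat (ℚ × ℚ)
  set e := embeddingReal Z
  have he : MeasurableEmbedding e := measurableEmbedding_embeddingReal Z
  set I : ℕ → Set ℝ := fun n => Set.Ioo ((f n).1 : ℝ) (f n).2 with hI
  -- Each `C n` is separated because the next `M - 1` iterates of its points avoid the interval `I
  -- n`. Aperiodicity ensures that these sets cover `A`, since a rational interval can isolate a
  -- point from finitely many others.
  set C : ℕ → Set Z := fun n =>
    {z | z ∈ A ∧ e z ∈ I n ∧ ∀ t : ℕ, t < M → 1 ≤ t → e (act R t z) ∉ I n} with hC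
  have hCm : ∀ n, MeasurableSet (C n) := by
    intro n
    have h : C n = A ∩ (e ⁻¹' I n ∩ ⋂ t : ℕ, ⋂ (_ : t < M), ⋂ (_ : 1 ≤ t),
        ((fun z => e (act R t z)) ⁻¹' I n)ᶜ) := by
      ext z
      simp only [hC, Set.mem_ofPred_eq, Set.mem_inter_iff, Set.mem_preimage, Set.mem_iInter,
        Set.mem_compl_iff]
    rw [h]
    refine hA.inter ((he.measurable measurableSet_Ioo).inter (MeasurableSet.iInter fun t =>
      MeasurableSet.iInter fun _ => MeasurableSet.iInter fun _ => ?_))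
    exact ((he.measurable.comp (measurable_act R t)) measurableSet_Ioo).compl
  have hcover : ∀ z ∈ A, ∃ n, z ∈ C n := by
    intro z hz
    have hopen : IsOpen (⋂ t ∈ Finset.Ico 1 M, ({e (act R t z)}ᶜ : Set ℝ)) :=
      isOpen_biInter_finset fun t _ => isOpen_compl_singleton
    have hmem : e z ∈ ⋂ t ∈ Finset.Ico 1 M, ({e (act R t z)}ᶜ : Set ℝ) := by
      simp only [Set.mem_iInter, Set.mem_compl_iff, Set.mem_singleton_iff]
      intro t ht h
      exact hap z hz t (Finset.mem_Ico.1 ht).1 (he.injective h).symm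
    obtain ⟨U, hU, hzU, hUsub⟩ := Real.isTopologicalBasis_Ioo_rat.exists_subset_of_mem_open
      hmem hopen
    simp only [Set.mem_iUnion, Set.mem_singleton_iff] at hU
    obtain ⟨a, b, hab, rfl⟩ := hU
    obtain ⟨n, hn⟩ := hf (a, b)
    have hIn : I n = Set.Ioo (a : ℝ) b := by simp [hI, hn]
    refine ⟨n, hz, hIn ▸ hzU, fun t ht1 ht2 hmem' => ?_⟩
    rw [hIn] at hmem'
    have := hUsub hmem'
    simp only [Set.mem_iInter] at this
    exact this t (Finset.mem_Ico.2 ⟨ht2, ht1⟩) rfl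
  -- Greedy choice: the points of `C n` that are not too close to those already selected are added,
  -- so every point of `C n` ends up near a selected one.
  let step : ℕ → Set Z → Set Z := fun n E =>
    E ∪ {z | z ∈ C n ∧ ∀ t : ℕ, t < M → act R t z ∉ E ∧ act R (-t) z ∉ E}
  let E : ℕ → Set Z := fun n => Nat.rec ∅ step n
  have hEs : ∀ n, E (n + 1) = step n (E n) := fun n => rfl
  have hEm : ∀ n, MeasurableSet (E n) := by
    intro n
    induction n with
    | zero => exact MeasurableSet.empty
    | succ n ih =>
      rw [hEs]
      refine ih.union ?_
      have h : {z | z ∈ C n ∧ ∀ t : ℕ, t < M → act R t z ∉ E n ∧ act R (-t) z ∉ E n} =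
          C n ∩ ⋂ t : ℕ, ⋂ (_ : t < M), ({z | act R t z ∈ E n}ᶜ ∩ {z | act R (-t) z ∈ E n}ᶜ) := by
        ext z
        simp only [Set.mem_ofPred_eq, Set.mem_inter_iff, Set.mem_iInter, Set.mem_compl_iff]
      rw [h]
      exact (hCm n).inter (MeasurableSet.iInter fun t => MeasurableSet.iInter fun _ =>
        (measurableSet_act R t ih).compl.inter (measurableSet_act R (-t) ih).compl)
  have hEmono : Monotone E := monotone_nat_of_le_succ fun n => Set.subset_union_left
  have hEA : ∀ n, E n ⊆ A := by
    intro n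
    induction n with
    | zero => exact Set.empty_subset _
    | succ n ih => exact Set.union_subset ih fun z hz => hz.1.1
  have hEsep : ∀ n, ∀ z ∈ E n, ∀ t : ℕ, 1 ≤ t → t < M → act R t z ∉ E n := by
    intro n
    induction n with
    | zero => exact fun z hz => absurd hz (Set.notMem_empty z)
    | succ n ih =>
      intro z hz t h1 ht hz'
      rcases hz with hz | hz <;> rcases hz' with hz' | hz'
      · exact ih z hz t h1 ht hz'
      · refine (hz'.2 t ht).2 ?_
        rwa [act_neg_act]
      · exact (hz.2 t ht).1 hz'
      · exact hz.1.2.2 t ht h1 hz'.1.2.1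
  refine ⟨⋃ n, E n, Set.iUnion_subset hEA, MeasurableSet.iUnion hEm, ?_, ?_⟩
  · intro z hz t h1 ht hz'
    obtain ⟨a, ha⟩ := Set.mem_iUnion.1 hz
    obtain ⟨b, hb⟩ := Set.mem_iUnion.1 hz'
    exact hEsep (max a b) z (hEmono (le_max_left _ _) ha) t h1 ht (hEmono (le_max_right _ _) hb)
  · intro z hz
    obtain ⟨n, hn⟩ := hcover z hz
    rcases Classical.em (∀ t : ℕ, t < M → act R t z ∉ E n ∧ act R (-t) z ∉ E n) with h | h
    · exact ⟨0, by omega, Or.inl (Set.mem_iUnion.2 ⟨n + 1, Or.inr ⟨hn, h⟩⟩)⟩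
    · push Not at h
      obtain ⟨t, ht, h'⟩ := h
      refine ⟨t, ht, ?_⟩
      rcases Classical.em (act R t z ∈ E n) with h2 | h2
      · exact Or.inl (Set.mem_iUnion.2 ⟨n, h2⟩)
      · exact Or.inr (Set.mem_iUnion.2 ⟨n, h' h2⟩)

/-- A relative version of the Rokhlin lemma: the base of the tower is a subset of a given set of
aperiodic points which is invariant under the power `R ^ H`. -/
theorem exists_tower [StandardBorelSpace Z] [IsProbabilityMeasure m] (R : MPMap m) {H : ℕ}
    (hH : 1 ≤ H) {A : Set Z} (hA : MeasurableSet A)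
    (hap : ∀ z ∈ A, ∀ k : ℕ, 1 ≤ k → act R k z ≠ z) (hinv : ∀ z, act R H z ∈ A ↔ z ∈ A)
    {ε : ℝ} (hε : 0 < ε) :
    ∃ E ⊆ A, MeasurableSet E ∧ (∀ z ∈ E, ∀ t : ℕ, 1 ≤ t → t < H → act R t z ∉ E) ∧
      m.real {z | (∃ k : ℕ, act R (-k) z ∈ A) ∧ ∀ a < H, act R (-(a : ℕ)) z ∉ E} ≤ ε := by
  obtain ⟨M₀, hM₀⟩ := exists_nat_gt (H / ε)
  set M := M₀ + 1 with hM
  obtain ⟨K, hKA, hKm, hKsep, hKcov⟩ := exists_marker R M hA hap (by omega)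
  have hKmeas : m.real K * H ≤ ε := by
    have h1 := mul_measureReal_le_one R hKm hKsep
    have h2 : (H : ℝ) ≤ ε * M := by
      rw [div_lt_iff₀ hε] at hM₀
      rw [hM]; push_cast; nlinarith
    have h3 : (0 : ℝ) < M := by rw [hM]; positivity
    have h4 := measureReal_nonneg (μ := m) (s := K)
    calc m.real K * H ≤ m.real K * (ε * M) := by gcongr
      _ = (M * m.real K) * ε := by ring
      _ ≤ 1 * ε := by gcongr
      _ = ε := one_mul ε
  have hinvj : ∀ (j : ℕ) z, act R ((H * j : ℕ) : ℤ) z ∈ A ↔ z ∈ A := by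
    intro j
    induction j with
    | zero => simp
    | succ j ih =>
      intro z
      rw [← ih z, ← hinv (act R ((H * j : ℕ) : ℤ) z), ← act_add]
      push_cast
      ring_nf
  -- The stretch after each marker is cut into blocks of length `H`, and a block is kept if no new
  -- marker interrupts it. Block starts lie at multiples of `H` after a marker, so invariance under
  -- `R ^ H` keeps them in `A`.
  set E : Set Z := {z | z ∈ A ∧ (∃ j : ℕ, act R (-(H * j : ℕ)) z ∈ K ∧
    ∀ u : ℕ, u < H * j → act R (-u) z ∉ K) ∧ ∀ t : ℕ, t < H → 1 ≤ t → act R t z ∉ K} with hE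
  have hEm : MeasurableSet E := by
    have h : E = A ∩ ((⋃ j : ℕ, ({z | act R (-(H * j : ℕ)) z ∈ K} ∩
        ⋂ u : ℕ, ⋂ (_ : u < H * j), {z | act R (-u) z ∈ K}ᶜ)) ∩
        ⋂ t : ℕ, ⋂ (_ : t < H), ⋂ (_ : 1 ≤ t), {z | act R t z ∈ K}ᶜ) := by
      ext z
      simp only [hE, Set.mem_ofPred_eq, Set.mem_inter_iff, Set.mem_iUnion, Set.mem_iInter,
        Set.mem_compl_iff]
    rw [h]
    refine hA.inter ((MeasurableSet.iUnion fun j => (measurableSet_act R _ hKm).inter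
      (MeasurableSet.iInter fun u => MeasurableSet.iInter fun _ =>
        (measurableSet_act R _ hKm).compl)).inter (MeasurableSet.iInter fun t =>
      MeasurableSet.iInter fun _ => MeasurableSet.iInter fun _ =>
        (measurableSet_act R _ hKm).compl))
  refine ⟨E, fun z hz => hz.1, hEm, ?_, ?_⟩
  · rintro z ⟨-, ⟨j, hj, hj'⟩, hfut⟩ t h1 ht ⟨-, ⟨j', hj1, hj1'⟩, -⟩
    rw [← act_add] at hj1
    rcases lt_or_ge (H * j') t with h | h
    · have h2 : (-((H * j' : ℕ) : ℤ) + (t : ℤ)) = ((t - H * j' : ℕ) : ℤ) := by omega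
      rw [h2] at hj1
      exact hfut _ (by omega) (by omega) hj1
    · have h2 : (-((H * j' : ℕ) : ℤ) + (t : ℤ)) = -((H * j' - t : ℕ) : ℤ) := by omega
      rw [h2] at hj1
      have h3 : H * j ≤ H * j' - t := by
        by_contra h'
        exact hj' _ (not_le.1 h') hj1
      have h4 : H * j' ≤ H * j + t := by
        by_contra h'
        refine hj1' (H * j + t) (not_le.1 h') ?_
        rw [← act_add]
        convert hj using 2
        push_cast
        ring
      -- Both counts refer to the same last marker, so `t` is a multiple of `H`, which is impossible
      -- for `1 ≤ t < H`.
      have h5 : H * j' = H * j + t := by omega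
      have h6 : H ∣ t := (Nat.dvd_add_right (dvd_mul_right H j)).1 (h5 ▸ dvd_mul_right H j')
      exact absurd (Nat.le_of_dvd (by omega) h6) (by omega)
  -- A point is missed only if its block is interrupted, that is, if a marker appears within `H`
  -- steps. Markers have measure at most `1 / M`, hence the choice of `M`.
  · have hsub : {z | (∃ k : ℕ, act R (-k) z ∈ A) ∧ ∀ a < H, act R (-(a : ℕ)) z ∉ E} ⊆
        ⋃ t ∈ Finset.range H, {z | act R t z ∈ K} := by
      rintro z ⟨⟨k, hk⟩, hz⟩
      have hpast : ∃ u : ℕ, act R (-u) z ∈ K := by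
        -- Going back a further `H * M ≥ M` steps ensures that the nearby marker, which may lie on
        -- either side, is in the past of `z`.
        have h1 : act R (-((H * M : ℕ) : ℤ)) (act R (-k) z) ∈ A := by
          rw [← hinvj M, act_act_neg]
          exact hk
        have h2 : M ≤ H * M := Nat.le_mul_of_pos_left M hH
        obtain ⟨t, ht, h | h⟩ := hKcov _ h1
        · refine ⟨H * M + k - t, ?_⟩
          rw [← act_add, ← act_add] at h
          convert h using 2
          omega
        · refine ⟨H * M + k + t, ?_⟩
          rw [← act_add, ← act_add] at h
          convert h using 2
          omega
      classical
      set q := Nat.find hpast with hq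
      have hqK : act R (-q) z ∈ K := Nat.find_spec hpast
      have hqmin : ∀ u : ℕ, u < q → act R (-u) z ∉ K := fun u hu => Nat.find_min hpast hu
      have hdm := Nat.div_add_mod q H
      have hlt : q % H < H := Nat.mod_lt _ (by omega)
      have hnot := hz (q % H) hlt
      have hA' : act R (-((q % H : ℕ) : ℤ)) z ∈ A := by
        have : act R (-((q % H : ℕ) : ℤ)) z = act R ((H * (q / H) : ℕ) : ℤ) (act R (-q) z) := by
          rw [← act_add]
          congr 1
          omega
        rw [this, hinvj]
        exact hKA hqK
      have hfail : ¬ ∀ t : ℕ, t < H → 1 ≤ t → act R t (act R (-((q % H : ℕ) : ℤ)) z) ∉ K := by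
        intro hfut
        refine hnot ⟨hA', ⟨q / H, ?_, fun u hu => ?_⟩, hfut⟩
        · rw [← act_add]
          convert hqK using 2
          omega
        · rw [← act_add]
          have : (-(u : ℤ) + -((q % H : ℕ) : ℤ)) = -((u + q % H : ℕ) : ℤ) := by omega
          rw [this]
          exact hqmin _ (by omega)
      push Not at hfail
      obtain ⟨t, ht, h1, htK⟩ := hfail
      rw [← act_add] at htK
      rcases le_or_gt t (q % H) with h | h
      · have : ((t : ℤ) + -((q % H : ℕ) : ℤ)) = -((q % H - t : ℕ) : ℤ) := by omega
        rw [this] at htK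
        exact absurd htK (hqmin _ (by omega))
      · refine Set.mem_biUnion (Finset.mem_coe.2 (Finset.mem_range.2
          (show t - q % H < H by omega))) ?_
        have : ((t : ℤ) + -((q % H : ℕ) : ℤ)) = ((t - q % H : ℕ) : ℤ) := by omega
        rw [this] at htK
        exact htK
    calc _ ≤ m.real (⋃ t ∈ Finset.range H, {z | act R t z ∈ K}) :=
          measureReal_mono hsub (measure_ne_top m _)
      _ ≤ ∑ t ∈ Finset.range H, m.real {z | act R t z ∈ K} := measureReal_biUnion_finset_le _ _
      _ = m.real K * H := by
        simp only [measureReal_act R _ hKm, Finset.sum_const, Finset.card_range, nsmul_eq_mul]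
        ring
      _ ≤ ε := hKmeas

end Orbits

/-! ### Periodic points -/

section Periodic

variable {Z : Type*} [MeasurableSpace Z] {m : Measure Z}

/-- The set of periodic points. -/
def periodicSet (R : MPMap m) : Set Z := {z | ∃ k : ℕ, 1 ≤ k ∧ act R k z = z}

theorem act_mul_of_act_eq {R : MPMap m} {z : Z} {k : ℤ} (h : act R k z = z) (j : ℤ) :
    act R (k * j) z = z := by
  have h' : act R (-k) z = z := by
    conv_lhs => rw [← h]
    exact act_neg_act R k z
  induction j with
  | zero => simp
  | succ j ih => rw [mul_add, mul_one, act_add, h, ih]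
  | pred j ih => rw [mul_sub, mul_one, sub_eq_add_neg, act_add, h', ih]

theorem act_eq_of_modEq {R : MPMap m} {z : Z} {k a b : ℤ} (h : act R k z = z) (hab : k ∣ a - b) :
    act R a z = act R b z := by
  obtain ⟨j, hj⟩ := hab
  rw [show a = b + k * j by omega, act_add, act_mul_of_act_eq h]

theorem act_mem_periodicSet_iff (R : MPMap m) (j : ℤ) (z : Z) :
    act R j z ∈ periodicSet R ↔ z ∈ periodicSet R := by
  refine exists_congr fun k => and_congr_right fun _ => ?_
  rw [← act_add, add_comm, act_add]
  exact (act_injective R j).eq_iff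

variable [StandardBorelSpace Z]

theorem measurableSet_act_eq (R : MPMap m) (k : ℤ) : MeasurableSet {z | act R k z = z} :=
  measurableSet_eq_fun (measurable_act R k) measurable_id

theorem measurableSet_periodicSet (R : MPMap m) : MeasurableSet (periodicSet R) := by
  have : periodicSet R = ⋃ k : ℕ, ⋃ (_ : 1 ≤ k), {z | act R k z = z} := by
    ext z
    simp only [periodicSet, Set.mem_ofPred_eq, Set.mem_iUnion, exists_prop]
  rw [this]
  exact MeasurableSet.iUnion fun k => MeasurableSet.iUnion fun _ => measurableSet_act_eq R k

/-- A set which meets each periodic orbit in exactly one point. -/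
def periodicDomain (R : MPMap m) : Set Z :=
  {z | z ∈ periodicSet R ∧ ∀ k : ℤ, embeddingReal Z z ≤ embeddingReal Z (act R k z)}

theorem measurableSet_periodicDomain (R : MPMap m) : MeasurableSet (periodicDomain R) := by
  have he : Measurable (embeddingReal Z) := (measurableEmbedding_embeddingReal Z).measurable
  have : periodicDomain R =
      periodicSet R ∩ ⋂ k : ℤ, {z | embeddingReal Z z ≤ embeddingReal Z (act R k z)} := by
    ext z
    simp only [periodicDomain, Set.mem_ofPred_eq, Set.mem_inter_iff, Set.mem_iInter]
  rw [this]
  exact (measurableSet_periodicSet R).inter (MeasurableSet.iInter fun k =>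
    measurableSet_le he (he.comp (measurable_act R k)))

/-- Both points minimise the same injective real coordinate along their common orbit. -/
theorem act_eq_of_mem_periodicDomain {R : MPMap m} {z : Z} {k : ℤ} (hz : z ∈ periodicDomain R)
    (hk : act R k z ∈ periodicDomain R) : act R k z = z := by
  refine (measurableEmbedding_embeddingReal Z).injective (le_antisymm ?_ (hz.2 k))
  have := hk.2 (-k)
  rwa [act_neg_act] at this

theorem exists_act_mem_periodicDomain {R : MPMap m} {z : Z} {k : ℕ} (h1 : 1 ≤ k)
    (hk : act R k z = z) : ∃ j : ℕ, j < k ∧ act R j z ∈ periodicDomain R := by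
  obtain ⟨j, hj, hmin⟩ := Finset.exists_min_image (Finset.range k)
    (fun j => embeddingReal Z (act R j z)) ⟨0, Finset.mem_range.2 h1⟩
  refine ⟨j, Finset.mem_range.1 hj, ?_, fun i => ?_⟩
  · rw [act_mem_periodicSet_iff]
    exact ⟨k, h1, hk⟩
  · have hk0 : (k : ℤ) ≠ 0 := by omega
    have h0 := Int.emod_nonneg (i + j) hk0
    have hlt := Int.emod_lt_of_pos (i + j) (show (0 : ℤ) < k by omega)
    have := hmin ((i + j) % k).toNat (Finset.mem_range.2 (by omega))
    rw [Int.toNat_of_nonneg h0] at this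
    rw [← act_add, act_eq_of_modEq (a := i + j) (b := (i + j) % k) hk (Int.dvd_self_sub_emod)]
    exact this

end Periodic

/-! ### Perturbing an extension into an aperiodic one -/

section Aperiodic

variable {X : Type*} [MeasurableSpace X] [StandardBorelSpace X] {μ : Measure X}
  [IsProbabilityMeasure μ]

theorem IsOver.act_fst {s : MPMap μ} {R : MPMap (μ.prod μ)} (hR : IsOver s R) (k : ℤ)
    (z : X × X) : (act R k z).1 = act s k z.1 := hR.zpow k z

/-- Any extension can be perturbed into an aperiodic one without moving the images and the
preimages of finitely many given sets. -/
theorem exists_aperiodic [NullSingletonClass μ] (A : DenseFamily (μ.prod μ)) {s : MPMap μ}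
    {R : MPMap (μ.prod μ)} (hR : IsOver s R) (K : ℕ) :
    ∃ T, IsOver s T ∧ (∀ i < K, halmosTerm A R T i = 0) ∧
      ∀ᵐ z ∂μ.prod μ, z ∉ periodicSet T := by
  classical
  obtain ⟨W, hW1, hW⟩ := exists_isOver_one_aperiodic μ
  set B := periodicDomain R with hB
  have hBm : MeasurableSet B := measurableSet_periodicDomain R
  -- A map preserving these colours can be composed with `R` without changing the images or
  -- preimages of the first `K` sets.
  let π : X × X → Prop × (Fin K → Prop) × (Fin K → Prop) := fun z =>
    (z ∈ B, fun i => z ∈ A.sets i, fun i => R.1 z ∈ A.sets i)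
  have hπ : Measurable π := by
    refine Measurable.prodMk (measurable_mem.2 hBm) (Measurable.prodMk ?_ ?_)
    · exact measurable_pi_lambda _ fun i => measurable_mem.2 (A.measurable i)
    · exact measurable_pi_lambda _ fun i =>
        (measurable_mem.2 (A.measurable i)).comp R.1.measurable
  obtain ⟨Φ, hΦW, hΦπ, hΦB, hΦr⟩ := exists_induced W {c | c.1} hπ
  have hΦB' : ∀ z, z ∉ B → Φ.1 z = z := hΦB
  have hΦr' : ∀ᵐ z ∂μ.prod μ, z ∈ B → ∃ t : ℕ, 1 ≤ t ∧ Φ.1 z = act W t z := by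
    filter_upwards [hΦr] with z hz hzB
    obtain ⟨t, h1, ht, -⟩ := hz hzB
    exact ⟨t, h1, ht⟩
  have hΦmem : ∀ z, Φ.1 z ∈ B ↔ z ∈ B := fun z => iff_of_eq (congrArg (fun c => c.1) (hΦπ z))
  have hΦA : ∀ z, ∀ i < K, Φ.1 z ∈ A.sets i ↔ z ∈ A.sets i := fun z i hi =>
    iff_of_eq (congrArg (fun c => c.2.1 ⟨i, hi⟩) (hΦπ z))
  have hΦRA : ∀ z, ∀ i < K, R.1 (Φ.1 z) ∈ A.sets i ↔ R.1 z ∈ A.sets i := fun z i hi =>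
    iff_of_eq (congrArg (fun c => c.2.2 ⟨i, hi⟩) (hΦπ z))
  have hΦ1 : IsOver 1 Φ := by
    intro z
    obtain ⟨k, hk⟩ := hΦW z
    rw [hk, hW1.act_fst, act, one_zpow]
  -- An aperiodic motion `Φ` of the fundamental domain `B` is inserted into every periodic orbit.
  -- After one turn around a periodic orbit of `R`, the new map lands at the `Φ`-image of its
  -- starting point in `B`.
  refine ⟨R * Φ, ?_, fun i hi => ?_, ?_⟩
  · have := hR.mul hΦ1
    rwa [mul_one] at this
  · have e1 : (R * Φ).1 '' A.sets i = R.1 '' A.sets i := by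
      have : Φ.1 '' A.sets i = A.sets i := by
        ext z
        constructor
        · rintro ⟨w, hw, rfl⟩
          exact (hΦA w i hi).2 hw
        · intro hz
          refine ⟨(Φ⁻¹).1 z, (hΦA _ i hi).1 ?_, apply_inv_self Φ z⟩
          rwa [apply_inv_self]
      conv_rhs => rw [← this, Set.image_image]
      rfl
    have e2 : (R * Φ).1.symm '' A.sets i = R.1.symm '' A.sets i := by
      rw [MeasurableEquiv.image_symm, MeasurableEquiv.image_symm]
      ext z
      exact hΦRA z i hi
    rw [halmosTerm, e1, e2, symmDiff_self, symmDiff_self]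
    simp
  · set T := R * Φ with hT
    have hTz : ∀ z, T.1 z = R.1 (Φ.1 z) := fun z => rfl
    have hgood : ∀ᵐ z ∂μ.prod μ, ∀ u j : ℕ,
        (act Φ j (act T u z) ∈ B → ∃ t : ℕ, 1 ≤ t ∧
          Φ.1 (act Φ j (act T u z)) = act W t (act Φ j (act T u z))) ∧
        ∀ k : ℕ, 1 ≤ k → act W k (act Φ j (act T u z)) ≠ act Φ j (act T u z) := by
      refine ae_all_iff.2 fun u => ae_all_iff.2 fun j => ?_
      have h := hΦr'.and hW
      have h2 := (quasiMeasurePreserving_act T u).ae ((quasiMeasurePreserving_act Φ j).ae h)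
      filter_upwards [h2] with z hz
      refine ⟨hz.1, fun k hk => ?_⟩
      rw [act_natCast]
      exact hz.2 k hk
    filter_upwards [hgood] with z hz
    rintro ⟨k, hk1, hk⟩
    -- the orbit of `z` meets `B`
    have hmeet : ∃ u : ℕ, act T u z ∈ B := by
      by_contra! hno
      have hagree : ∀ u : ℕ, act T u z = act R u z := by
        intro u
        induction u with
        | zero => simp
        | succ u ih =>
          rw [Nat.cast_succ, add_comm, act_add, act_add, act_one, act_one, ← ih, hTz,
            hΦB' _ (hno u)]
      rw [hagree] at hk
      obtain ⟨j, -, hj⟩ := exists_act_mem_periodicDomain hk1 hk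
      exact hno j (hagree j ▸ hj)
    obtain ⟨u, hu⟩ := hmeet
    set b := act T u z with hb
    have hbk : act T k b = b := by
      rw [hb, ← act_add, add_comm, act_add, hk]
    -- Starting in `B`, the new map applies `Φ` once and then follows `R` around the orbit of `Φ c`,
    -- which meets `B` only at `Φ c` itself.
    have hstep : ∀ c ∈ B, ∃ t : ℕ, act T t c = Φ.1 c := by
      intro c hc
      have hΦc : Φ.1 c ∈ B := (hΦmem c).2 hc
      have hper := hΦc.1
      set p := Nat.find hper
      obtain ⟨hp1, hp⟩ : 1 ≤ p ∧ act R p (Φ.1 c) = Φ.1 c := Nat.find_spec hper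
      have hpmin : ∀ v : ℕ, 1 ≤ v → v < p → act R v (Φ.1 c) ∉ B := by
        intro v hv1 hv hmem
        exact Nat.find_min hper hv ⟨hv1, act_eq_of_mem_periodicDomain hΦc hmem⟩
      have hind : ∀ v : ℕ, v < p → act T (v + 1 : ℕ) c = act R (v + 1 : ℕ) (Φ.1 c) := by
        intro v
        induction v with
        | zero => intro _; rw [zero_add, Nat.cast_one, act_one, act_one, hTz]
        | succ v ih =>
          intro hv
          rw [Nat.cast_succ, add_comm, act_add, act_one, ih (by omega), hTz,
            hΦB' _ (hpmin _ (by omega) hv), ← act_one, ← act_add]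
      refine ⟨p, ?_⟩
      have := hind (p - 1) (by omega)
      rw [Nat.sub_add_cancel hp1, hp] at this
      exact this
    have hΦj : ∀ j : ℕ, act Φ j b ∈ B ∧ ∃ t : ℕ, act T t b = act Φ j b := by
      intro j
      induction j with
      | zero => exact ⟨hu, 0, by simp⟩
      | succ j ih =>
        obtain ⟨hjB, t, ht⟩ := ih
        obtain ⟨t', ht'⟩ := hstep _ hjB
        have e : act Φ ((j + 1 : ℕ) : ℤ) b = Φ.1 (act Φ j b) := by
          rw [Nat.cast_succ, add_comm, act_add, act_one]
        rw [e]
        refine ⟨(hΦmem _).2 hjB, t' + t, ?_⟩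
        rw [Nat.cast_add, act_add, ht, ht']
    have hfin : ∀ j : ℕ, ∃ t : ℕ, t < k ∧ act T t b = act Φ j b := by
      intro j
      obtain ⟨t, ht⟩ := (hΦj j).2
      refine ⟨t % k, Nat.mod_lt _ (by omega), ?_⟩
      rw [← ht]
      refine act_eq_of_modEq hbk ?_
      rw [← dvd_neg, neg_sub, Int.natCast_mod]
      exact Int.dvd_self_sub_emod
    choose τ hτk hτ using hfin
    obtain ⟨i, j, hij, hτij⟩ := Finite.exists_ne_map_eq_of_infinite
      (fun j => (⟨τ j, hτk j⟩ : Fin k))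
    have hτij' : τ i = τ j := congrArg Fin.val hτij
    -- Each application of `Φ` is a positive power of `W`. A repetition among the points `act Φ j
    -- b`, forced by a finite `T`-orbit, would therefore be a period of `W`.
    have hWΦ : ∀ i j : ℕ, ∃ t : ℕ, j ≤ t ∧ act Φ (i + j : ℕ) b = act W t (act Φ i b) := by
      intro i j
      induction j with
      | zero => exact ⟨0, le_rfl, by simp⟩
      | succ j ih =>
        obtain ⟨t, ht, h⟩ := ih
        obtain ⟨t', ht', h'⟩ := (hz u (i + j)).1 (hΦj (i + j)).1
        refine ⟨t' + t, by omega, ?_⟩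
        have e : act Φ ((i + (j + 1) : ℕ) : ℤ) b = Φ.1 (act Φ ((i + j : ℕ) : ℤ) b) := by
          rw [← add_assoc, Nat.cast_succ, add_comm, act_add, act_one]
        rw [e, h', h, Nat.cast_add, act_add]
    have hcontra : ∀ i j : ℕ, i < j → τ i = τ j → False := by
      intro i j hij hτ'
      obtain ⟨t, ht, h⟩ := hWΦ i (j - i)
      refine (hz u i).2 t (by omega) ?_
      rw [← hb, ← h, show i + (j - i) = j by omega, ← hτ i, ← hτ j, hτ']
    rcases lt_or_gt_of_ne hij with h | h
    · exact hcontra i j h hτij'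
    · exact hcontra j i h hτij'.symm

end Aperiodic

/-! ### Cutting a tower into cycles of prescribed lengths -/

section Cycles

variable {Z : Type*} [MeasurableSpace Z] {m : Measure Z}

/-- Independence on the cells of a finite partition extends to unions of cells by additivity. -/
theorem measureReal_preimage_inter_eq_mul [IsFiniteMeasure m] {κ : Type*} [Finite κ]
    [MeasurableSpace κ] [MeasurableSingletonClass κ] {π : Z → κ} (hπ : Measurable π) {S : Set Z}
    (hS : MeasurableSet S) {c : ℝ} (h : ∀ k, m.real (π ⁻¹' {k} ∩ S) = c * m.real (π ⁻¹' {k}))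
    (V : Set κ) : m.real (π ⁻¹' V ∩ S) = c * m.real (π ⁻¹' V) := by
  classical
  have := Fintype.ofFinite κ
  have hp : ∀ k, MeasurableSet (π ⁻¹' {k}) := fun k => hπ (measurableSet_singleton k)
  have hdis : Pairwise (Function.onFun Disjoint fun k => π ⁻¹' {k}) := fun i j hij =>
    Disjoint.preimage _ (Set.disjoint_singleton.2 hij)
  have e : π ⁻¹' V = ⋃ k ∈ V.toFinset, π ⁻¹' {k} := by
    ext z
    simp
  have e' : π ⁻¹' V ∩ S = ⋃ k ∈ V.toFinset, π ⁻¹' {k} ∩ S := by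
    rw [e, Set.iUnion₂_inter]
  rw [e', e, measureReal_biUnion_finset (hdis.set_pairwise _) fun k _ => hp k,
    measureReal_biUnion_finset _ fun k _ => (hp k).inter hS, Finset.mul_sum]
  · exact Finset.sum_congr rfl fun k _ => h k
  · intro i _ j _ hij
    exact (hdis hij).mono Set.inter_subset_left Set.inter_subset_left

/-- The column above `e ∈ E` is closed up into a cycle of length `n - ι e`, with a random label `ι`
of law `w` independent of the `n`-step itinerary. On that cycle `T ^ n` acts as `T ^ ι e`, and
independence turns the random exponent into the average with weights `w`. The changes are confined
to `B`, which allows control of the base coordinate later. -/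
theorem exists_cycles [StandardBorelSpace Z] [IsProbabilityMeasure m] [NullSingletonClass m]
    (R : MPMap m) {E : Set Z} (hE : MeasurableSet E) {n d N : ℕ} (hnd : 2 * d < n)
    (hsep : ∀ z ∈ E, ∀ t : ℕ, 1 ≤ t → t < n → act R t z ∉ E) {w : ℕ → ℝ} (hw : ∀ i, 0 ≤ w i)
    (hd : ∑ i ∈ Finset.range (d + 1), w i = 1) (hd' : ∀ i > d, w i = 0) {L : Fin N → Set Z}
    (hL : ∀ k, MeasurableSet (L k)) :
    ∃ (T : MPMap m) (B : Set Z),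
      (∀ z ∈ B, z ∈ E ∨ ∃ i ≤ d, w i ≠ 0 ∧ act R (-((n : ℤ) - i)) z ∈ E) ∧
      (∀ z, T.1 z = R.1 z ∨ R.1 z ∈ B ∧ T.1 z ∈ B ∧ ∃ k : ℤ, T.1 z = act R k (R.1 z)) ∧
      m.real {z | T.1 z ≠ R.1 z} ≤ 2 * m.real E ∧
      ∀ k k' : Fin N, ∀ a : ℕ, a < n - 2 * d →
        m.real {z | act T n z ∈ L k ∧ z ∈ L k' ∧ act R (-a) z ∈ E} =
          ∑ i ∈ Finset.range (d + 1),
            w i * m.real {z | act T i z ∈ L k ∧ z ∈ L k' ∧ act R (-a) z ∈ E} := by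
  classical
  let π : Z → Prop × (Fin n → Fin N → Prop) := fun z => (z ∈ E, fun t k => act R (t : ℕ) z ∈ L k)
  have hπ : Measurable π := by
    refine Measurable.prodMk (measurable_mem.2 hE) (measurable_pi_lambda _ fun t =>
      measurable_pi_lambda _ fun k => measurable_mem.2 (measurableSet_act R _ (hL k)))
  obtain ⟨ι, hιm, hιw, hι⟩ := exists_split_partition m hπ hw hd hd'
  have hιd : ∀ z, ι z ≤ d := fun z => by
    by_contra h
    exact hιw z (hd' _ (not_le.1 h))
  have hιs : ∀ i, MeasurableSet (ι ⁻¹' {i}) := fun i => hιm (measurableSet_singleton i)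
  have hιV : ∀ i V, m.real (π ⁻¹' V ∩ ι ⁻¹' {i}) = w i * m.real (π ⁻¹' V) := fun i V =>
    measureReal_preimage_inter_eq_mul hπ (hιs i) (fun k => hι k i) V
  set F : ℕ → Set Z := fun i => {z | act R (-((n : ℤ) - i)) z ∈ E ∩ ι ⁻¹' {i}} with hF
  have hFm : ∀ i, MeasurableSet (F i) := fun i => measurableSet_act R _ (hE.inter (hιs i))
  -- The set `B` consists of the starting points of the cycles and of the points reached from them
  -- just after the cycle should close.
  set B : Set Z := E ∪ ⋃ i ∈ Finset.range (d + 1), F i with hB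
  have hBm : MeasurableSet B := hE.union (Finset.measurableSet_biUnion _ fun i _ => hFm i)
  have hBmem : ∀ z, z ∈ B ↔ z ∈ E ∨ ∃ i ≤ d, act R (-((n : ℤ) - i)) z ∈ E ∧
      ι (act R (-((n : ℤ) - i)) z) = i := by
    intro z
    simp only [hB, hF, Set.mem_union, Set.mem_iUnion, Finset.mem_range, Set.mem_ofPred_eq,
      Set.mem_inter_iff, Set.mem_preimage, Set.mem_singleton_iff, Nat.lt_succ_iff, exists_prop]
  have hEB : E ⊆ B := Set.subset_union_left
  have hBE : m.real B ≤ 2 * m.real E := by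
    have h1 : m.real (⋃ i ∈ Finset.range (d + 1), F i) ≤ m.real E := by
      refine (measureReal_biUnion_finset_le _ _).trans (le_of_eq ?_)
      have : ∀ i, m.real (F i) = w i * m.real E := fun i => by
        rw [hF, measureReal_act R _ (hE.inter (hιs i))]
        exact hιV i {c | c.1}
      rw [Finset.sum_congr rfl fun i _ => this i, ← Finset.sum_mul, hd, one_mul]
    have h2 := measureReal_union_le (μ := m) E (⋃ i ∈ Finset.range (d + 1), F i)
    rw [← hB] at h2
    linarith
  have hend : ∀ e ∈ E, act R ((n : ℤ) - ι e) e ∈ B := by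
    intro e he
    refine (hBmem _).2 (Or.inr ⟨ι e, hιd e, ?_⟩)
    rw [act_neg_act]
    exact ⟨he, rfl⟩
  have hnot : ∀ e ∈ E, ∀ t : ℕ, 1 ≤ t → (t : ℤ) < (n : ℤ) - ι e → act R t e ∉ B := by
    intro e he t h1 ht hmem
    rcases (hBmem _).1 hmem with h | ⟨i, hi, h, hi'⟩
    · exact hsep e he t h1 (by omega) h
    · rw [← act_add] at h hi'
      rcases lt_trichotomy (-((n : ℤ) - i) + t) 0 with h0 | h0 | h0
      · refine hsep _ h (((n : ℤ) - i) - t).toNat (by omega) (by omega) ?_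
        rw [← act_add, Int.toNat_of_nonneg (by omega),
          show ((n : ℤ) - i) - t + (-((n : ℤ) - i) + t) = 0 by ring, act_zero]
        exact he
      · rw [h0, act_zero] at hi'
        omega
      · refine hsep e he (-((n : ℤ) - i) + t).toNat (by omega) (by omega) ?_
        rw [Int.toNat_of_nonneg (by omega)]
        exact h
  obtain ⟨Φ, hΦR, hΦπ, hΦB, hΦr⟩ := exists_induced R {c : Prop | c}
    (π := fun z => z ∈ B) (measurable_mem.2 hBm)
  have hΦB' : ∀ z, z ∉ B → Φ.1 z = z := hΦB
  have hΦmem : ∀ z, Φ.1 z ∈ B ↔ z ∈ B := fun z => iff_of_eq (hΦπ z)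
  have hinvB : ∀ z, z ∉ B → (Φ⁻¹).1 z = z := fun z hz => by
    conv_lhs => rw [← hΦB' z hz]
    exact inv_apply_self Φ z
  have hinvmem : ∀ z, (Φ⁻¹).1 z ∈ B ↔ z ∈ B := fun z => by
    rw [← hΦmem, apply_inv_self]
  -- From `e ∈ E` the first return of `R` to `B` is the end point of its column, so `Φ⁻¹` sends that
  -- end point back to `e` and leaves the points between untouched.
  set T := Φ⁻¹ * R with hT
  have hTz : ∀ z, T.1 z = (Φ⁻¹).1 (R.1 z) := fun z => rfl
  have hΦE : ∀ᵐ e ∂m, e ∈ E → Φ.1 e = act R ((n : ℤ) - ι e) e := by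
    filter_upwards [hΦr] with e he heE
    obtain ⟨t, h1, ht, hu⟩ := he (hEB heE)
    have hιe := hιd e
    have hle : (t : ℤ) ≤ (n : ℤ) - ι e := by
      by_contra h
      refine hu (n - ι e) (by omega) (by omega) ?_
      rw [Nat.cast_sub (by omega)]
      exact propext (iff_of_true (hend e heE) (hEB heE))
    have hge : ¬ (t : ℤ) < (n : ℤ) - ι e := fun h =>
      hnot e heE t h1 h (ht ▸ (hΦmem e).2 (hEB heE))
    rw [ht]
    congr 1
    omega
  have hcyc : ∀ᵐ e ∂m, e ∈ E → (∀ t : ℕ, (t : ℤ) < (n : ℤ) - ι e → act T t e = act R t e) ∧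
      act T ((n : ℤ) - ι e) e = e := by
    filter_upwards [hΦE] with e he heE
    have hιe := hιd e
    have h1 : ∀ t : ℕ, (t : ℤ) < (n : ℤ) - ι e → act T t e = act R t e := by
      intro t
      induction t with
      | zero => simp
      | succ t ih =>
        intro ht
        have e1 : act R ((t + 1 : ℕ) : ℤ) e = R.1 (act R t e) := by
          rw [Nat.cast_succ, add_comm, act_add, act_one]
        rw [Nat.cast_succ, add_comm, act_add, act_one, ih (by omega), hTz, ← e1,
          hinvB _ (hnot e heE _ (by omega) ht), Nat.cast_succ, add_comm]
    refine ⟨h1, ?_⟩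
    have h2 := h1 (n - ι e - 1) (by omega)
    have e1 : (n : ℤ) - ι e = 1 + ((n - ι e - 1 : ℕ) : ℤ) := by omega
    have e2 : R.1 (act R ((n - ι e - 1 : ℕ) : ℤ) e) = Φ.1 e := by
      rw [he heE, e1, act_add, act_one]
    rw [e1, act_add, act_one, h2, hTz, e2, inv_apply_self]
  refine ⟨T, B, fun z hz => ?_, fun z => ?_, ?_, fun k k' a ha => ?_⟩
  · rcases (hBmem z).1 hz with h | ⟨i, hi, h, hi'⟩
    · exact Or.inl h
    · exact Or.inr ⟨i, hi, hi' ▸ hιw _, h⟩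
  · by_cases h : R.1 z ∈ B
    · refine Or.inr ⟨h, (hinvmem _).2 h, ?_⟩
      obtain ⟨k, hk⟩ := hΦR (T.1 z)
      refine ⟨-k, ?_⟩
      have : Φ.1 (T.1 z) = R.1 z := apply_inv_self Φ _
      rw [← this, hk, act_neg_act]
    · exact Or.inl (hinvB _ h)
  · have hsub : {z | T.1 z ≠ R.1 z} ⊆ {z | act R 1 z ∈ B} := by
      intro z hz
      by_contra h
      rw [Set.mem_ofPred_eq, act_one] at h
      exact hz (hinvB _ h)
    calc m.real {z | T.1 z ≠ R.1 z} ≤ m.real {z | act R 1 z ∈ B} :=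
          measureReal_mono hsub (measure_ne_top m _)
      _ = m.real B := measureReal_act R 1 hBm
      _ ≤ 2 * m.real E := hBE
  · set V : ℕ → Set (Prop × (Fin n → Fin N → Prop)) := fun i =>
      {c | c.1 ∧ (∀ h : i + a < n, c.2 ⟨i + a, h⟩ k) ∧ ∀ h : a < n, c.2 ⟨a, h⟩ k'} with hV
    have hVmem : ∀ i ≤ d, ∀ e, e ∈ π ⁻¹' V i ↔
        e ∈ E ∧ act R (i + a : ℕ) e ∈ L k ∧ act R a e ∈ L k' := by
      intro i hi e
      have h1 : i + a < n := by omega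
      have h2 : a < n := by omega
      constructor
      · rintro ⟨h, h', h''⟩
        exact ⟨h, h' h1, h'' h2⟩
      · rintro ⟨h, h', h''⟩
        exact ⟨h, fun _ => h', fun _ => h''⟩
    have hpull : ∀ j : ℤ, m.real {z | act T j z ∈ L k ∧ z ∈ L k' ∧ act R (-a) z ∈ E} =
        m.real {e | act T j (act R a e) ∈ L k ∧ act R a e ∈ L k' ∧ e ∈ E} := by
      intro j
      have hm : MeasurableSet {z | act T j z ∈ L k ∧ z ∈ L k' ∧ act R (-a) z ∈ E} :=
        (measurableSet_act T j (hL k)).inter ((hL k').inter (measurableSet_act R _ hE))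
      rw [← measureReal_act R a hm]
      simp only [Set.mem_ofPred_eq, act_neg_act]
    have hright : ∀ i ≤ d, m.real {z | act T i z ∈ L k ∧ z ∈ L k' ∧ act R (-a) z ∈ E} =
        m.real (π ⁻¹' V i) := by
      intro i hi
      rw [hpull]
      refine measureReal_congr ?_
      filter_upwards [hcyc] with e he
      refine propext (Iff.trans ?_ (hVmem i hi e).symm)
      change (act T i (act R a e) ∈ L k ∧ act R a e ∈ L k' ∧ e ∈ E) ↔ _
      have hιe := hιd e
      constructor
      · rintro ⟨h1, h2, h3⟩
        refine ⟨h3, ?_, h2⟩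
        obtain ⟨h4, -⟩ := he h3
        rwa [← h4 a (by omega), ← act_add, ← Nat.cast_add, h4 _ (by omega)] at h1
      · rintro ⟨h3, h1, h2⟩
        refine ⟨?_, h2, h3⟩
        obtain ⟨h4, -⟩ := he h3
        rwa [← h4 a (by omega), ← act_add, ← Nat.cast_add, h4 _ (by omega)]
    have hleft : m.real {z | act T n z ∈ L k ∧ z ∈ L k' ∧ act R (-a) z ∈ E} =
        m.real (⋃ i ∈ Finset.range (d + 1), π ⁻¹' V i ∩ ι ⁻¹' {i}) := by
      rw [hpull]
      refine measureReal_congr ?_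
      filter_upwards [hcyc] with e he
      have hιe := hιd e
      -- Removing one full cycle leaves `ι e + a` steps. They stay inside the column because `ι e +
      -- a < n - ι e`, which is why the top `2 * d` levels are excluded.
      have hpow : e ∈ E → act T n (act R a e) = act R (ι e + a : ℕ) e := by
        intro h3
        obtain ⟨h4, h5⟩ := he h3
        rw [← h4 a (by omega), ← act_add,
          show (n : ℤ) + a = ((ι e + a : ℕ) : ℤ) + ((n : ℤ) - ι e) by push_cast; ring,
          act_add, h5, h4 _ (by omega)]
      refine propext ?_
      change (act T n (act R a e) ∈ L k ∧ act R a e ∈ L k' ∧ e ∈ E) ↔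
        e ∈ ⋃ i ∈ Finset.range (d + 1), π ⁻¹' V i ∩ ι ⁻¹' {i}
      simp only [Set.mem_iUnion, Finset.mem_range, exists_prop]
      constructor
      · rintro ⟨h1, h2, h3⟩
        refine ⟨ι e, by omega, (hVmem _ hιe e).2 ⟨h3, ?_, h2⟩, rfl⟩
        rwa [hpow h3] at h1
      · rintro ⟨i, hi, hV', rfl⟩
        obtain ⟨h3, h1, h2⟩ := (hVmem _ hιe e).1 hV'
        refine ⟨?_, h2, h3⟩
        rwa [hpow h3]
    have hVm : ∀ i, MeasurableSet (π ⁻¹' V i) := fun i => hπ (Set.toFinite _).measurableSet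
    rw [hleft, measureReal_biUnion_finset _ fun i _ => (hVm i).inter (hιs i)]
    · refine Finset.sum_congr rfl fun i hi => ?_
      rw [hιV, hright i (by have := Finset.mem_range.1 hi; omega)]
    · intro i _ j _ hij
      refine Disjoint.mono Set.inter_subset_right Set.inter_subset_right ?_
      exact Disjoint.preimage _ (Set.disjoint_singleton.2 hij)

end Cycles

/-! ### Prescribing a power over the periodic part of the base -/

theorem act_mem_iff_of_invariant {Z : Type*} [MeasurableSpace Z] {m : Measure Z} {R : MPMap m}
    {Y : Set Z} (h : ∀ z, R.1 z ∈ Y ↔ z ∈ Y) (k : ℤ) (z : Z) : act R k z ∈ Y ↔ z ∈ Y := by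
  have h' : ∀ z, act R (-1) z ∈ Y ↔ z ∈ Y := fun z => by
    rw [← h, ← act_one, act_act_neg]
  induction k generalizing z with
  | zero => simp
  | succ k ih => rw [act_add]; exact (ih _).trans (by rw [act_one, h])
  | pred k ih => rw [sub_eq_add_neg, act_add]; exact (ih _).trans (h' z)

theorem abs_sub_sum_mul_le {d : ℕ} {w ρ : ℕ → ℝ} (hw : ∀ i, 0 ≤ w i)
    (hd : ∑ i ∈ Finset.range (d + 1), w i = 1) {η x : ℝ} (hρ0 : ∀ i, 0 ≤ ρ i) (hρ : ∀ i, ρ i ≤ η)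
    (hx0 : 0 ≤ x) (hx : x ≤ η) : |x - ∑ i ∈ Finset.range (d + 1), w i * ρ i| ≤ η := by
  have h0 : 0 ≤ ∑ i ∈ Finset.range (d + 1), w i * ρ i :=
    Finset.sum_nonneg fun i _ => mul_nonneg (hw i) (hρ0 i)
  have h1 : ∑ i ∈ Finset.range (d + 1), w i * ρ i ≤ η := by
    calc _ ≤ ∑ i ∈ Finset.range (d + 1), w i * η :=
          Finset.sum_le_sum fun i _ => mul_le_mul_of_nonneg_left (hρ i) (hw i)
      _ = η := by rw [← Finset.sum_mul, hd, one_mul]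
  rw [abs_le]
  constructor <;> linarith

section Periodic

variable {X : Type*} [MeasurableSpace X] [StandardBorelSpace X] {μ : Measure X}
  [IsProbabilityMeasure μ]

/-- The tower has its base over the fundamental domain of `s`, so that closing columns within that
set cannot alter the base map. Covering by the first `r` levels only costs the measure of the
remaining ones. -/
theorem exists_tower_over [NullSingletonClass μ] {s : MPMap μ} {R : MPMap (μ.prod μ)}
    (hR : IsOver s R) (hap : ∀ᵐ z ∂μ.prod μ, z ∉ periodicSet R) {Y : Set X} (hY : MeasurableSet Y)
    (hYs : ∀ x, s.1 x ∈ Y ↔ x ∈ Y) {q : ℕ} (hq1 : 1 ≤ q) (hq : ∀ x ∈ Y, act s q x = x) {n r : ℕ}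
    (hn : 1 ≤ n) (hr : r ≤ n) :
    ∃ E : Set (X × X), MeasurableSet E ∧ (∀ z ∈ E, z.1 ∈ periodicDomain s ∧ z.1 ∈ Y) ∧
      (∀ z ∈ E, ∀ t : ℕ, 1 ≤ t → t < n → act R t z ∉ E) ∧
      (μ.prod μ).real {z | z.1 ∈ Y ∧ ∀ a < r, act R (-(a : ℕ)) z ∉ E} ≤
        ((q : ℝ) + (n - r) + 1) / n := by
  have hYact := act_mem_iff_of_invariant hYs
  have hn0 : (0 : ℝ) < n := by exact_mod_cast hn
  -- A height divisible by `q` makes `s ^ H` the identity on `Y`, which gives the invariance of `A`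
  -- under `R ^ H` required for the tower.
  obtain ⟨H, hH, hHn, hHq⟩ : ∃ H : ℕ, q ∣ H ∧ n ≤ H ∧ H ≤ n + q := by
    refine ⟨q * (n / q + 1), dvd_mul_right _ _, ?_, ?_⟩
    · exact (Nat.lt_mul_div_succ n (by omega)).le
    · rw [mul_add, mul_one]
      exact Nat.add_le_add_right (Nat.mul_div_le n q) q
  set A : Set (X × X) := {z | (z.1 ∈ periodicDomain s ∧ z.1 ∈ Y) ∧ z ∉ periodicSet R} with hA
  have hAm : MeasurableSet A :=
    (measurable_fst ((measurableSet_periodicDomain s).inter hY)).inter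
      (measurableSet_periodicSet R).compl
  have hAap : ∀ z ∈ A, ∀ k : ℕ, 1 ≤ k → act R k z ≠ z := fun z hz k hk h => hz.2 ⟨k, hk, h⟩
  have hHY : ∀ x ∈ Y, act s H x = x := by
    intro x hx
    obtain ⟨j, rfl⟩ := hH
    rw [Nat.cast_mul]
    exact act_mul_of_act_eq (hq x hx) j
  have hAinv : ∀ z, act R H z ∈ A ↔ z ∈ A := by
    intro z
    simp only [hA, Set.mem_ofPred_eq, act_mem_periodicSet_iff, hR.act_fst, hYact]
    by_cases h : z.1 ∈ Y
    · rw [hHY _ h]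
    · simp only [h, and_false, false_and]
  obtain ⟨E, hEA, hE, hsep, hcov⟩ := exists_tower R (by omega : 1 ≤ H) hAm hAap hAinv
    (ε := 1 / n) (by positivity)
  have hmE : (μ.prod μ).real E ≤ 1 / n := by
    have h1 := mul_measureReal_le_one R hE hsep
    have h2 : (n : ℝ) ≤ H := by exact_mod_cast hHn
    rw [le_div_iff₀ hn0]
    nlinarith [measureReal_nonneg (μ := μ.prod μ) (s := E)]
  refine ⟨E, hE, fun z hz => (hEA hz).1, fun z hz t h1 ht => hsep z hz t h1 (by omega), ?_⟩
  set U : Set (X × X) := {z | (∃ k : ℕ, act R (-k) z ∈ A) ∧ ∀ a < H, act R (-(a : ℕ)) z ∉ E}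
  have hsub : ({z : X × X | z.1 ∈ Y ∧ ∀ a < r, act R (-(a : ℕ)) z ∉ E} : Set (X × X))
      ≤ᵐ[μ.prod μ] (U ∪ ⋃ a ∈ Finset.Ico r H, {z | act R (-(a : ℕ)) z ∈ E} : Set (X × X)) := by
    filter_upwards [hap] with z hz
    rintro ⟨hzY, hza⟩
    by_cases h : ∀ a < H, act R (-(a : ℕ)) z ∉ E
    · refine Or.inl ⟨?_, h⟩
      obtain ⟨j, hj, hjD⟩ := exists_act_mem_periodicDomain hq1 (hq _ hzY)
      -- Over `Y`, going back `q - j` steps has the same effect on the base as going forward `j`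
      -- steps.
      refine ⟨q - j, ?_, ?_⟩
      · rw [hR.act_fst, hYact, act_eq_of_modEq (b := j) (hq _ hzY)]
        · exact ⟨hjD, hzY⟩
        · exact ⟨-1, by omega⟩
      · rwa [act_mem_periodicSet_iff]
    · push Not at h
      obtain ⟨a, ha, haE⟩ := h
      refine Or.inr (Set.mem_biUnion (Finset.mem_coe.2 (Finset.mem_Ico.2 ⟨?_, ha⟩)) haE)
      by_contra h'
      exact hza a (not_le.1 h') haE
  have hle := ENNReal.toReal_mono (measure_ne_top (μ.prod μ) _) (measure_mono_ae hsub)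
  refine hle.trans ((measureReal_union_le _ _).trans ?_)
  have h1 : (μ.prod μ).real (⋃ a ∈ Finset.Ico r H, {z | act R (-(a : ℕ)) z ∈ E}) ≤
      (q + (n - r)) * (1 / n) := by
    refine (measureReal_biUnion_finset_le _ _).trans ?_
    rw [Finset.sum_congr rfl fun a _ => measureReal_act R (-(a : ℕ)) hE, Finset.sum_const,
      Nat.card_Ico, nsmul_eq_mul, Nat.cast_sub (by omega)]
    have h2 : (H : ℝ) ≤ n + q := by exact_mod_cast hHq
    have h3 : (r : ℝ) ≤ n := by exact_mod_cast hr
    refine mul_le_mul (by linarith) hmE measureReal_nonneg ?_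
    have : (0 : ℝ) ≤ q := Nat.cast_nonneg q
    linarith
  calc _ ≤ 1 / (n : ℝ) + (q + (n - r)) * (1 / n) := add_le_add hcov h1
    _ = _ := by ring

/-- The identity holds exactly on each of the first `n - 2 * d` levels; summing over them leaves
only the uncovered remainder, of measure at most `(q + 2 * d + 1) / n`. -/
theorem exists_prescribed_power [NullSingletonClass μ] {s : MPMap μ} {R : MPMap (μ.prod μ)}
    (hR : IsOver s R) (hap : ∀ᵐ z ∂μ.prod μ, z ∉ periodicSet R) {Y : Set X} (hY : MeasurableSet Y)
    (hYs : ∀ x, s.1 x ∈ Y ↔ x ∈ Y) {q : ℕ} (hq1 : 1 ≤ q) (hq : ∀ x ∈ Y, act s q x = x)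
    {n d N : ℕ} (hnd : 2 * d < n) {w : ℕ → ℝ} (hw : ∀ i, 0 ≤ w i)
    (hd : ∑ i ∈ Finset.range (d + 1), w i = 1) (hd' : ∀ i > d, w i = 0)
    (hwY : ∀ i ≤ d, w i ≠ 0 → ∀ x ∈ Y, act s ((n : ℤ) - i) x = x) {L : Fin N → Set (X × X)}
    (hL : ∀ k, MeasurableSet (L k)) :
    ∃ T, IsOver s T ∧ (μ.prod μ).real {z | T.1 z ≠ R.1 z} ≤ 2 * (((q : ℝ) + 2 * d + 1) / n) ∧
      ∀ k k' : Fin N, |(μ.prod μ).real {z | act T n z ∈ L k ∧ z ∈ L k' ∧ z.1 ∈ Y} -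
        ∑ i ∈ Finset.range (d + 1),
          w i * (μ.prod μ).real {z | act T i z ∈ L k ∧ z ∈ L k' ∧ z.1 ∈ Y}| ≤
        ((q : ℝ) + 2 * d + 1) / n := by
  have hYact := act_mem_iff_of_invariant hYs
  obtain ⟨E, hE, hED, hsep, hbad⟩ := exists_tower_over hR hap hY hYs hq1 hq (n := n)
    (r := n - 2 * d) (by omega) (by omega)
  obtain ⟨T, B, hB, hTB, hTR, hcyc⟩ := exists_cycles R hE hnd hsep hw hd hd' hL
  have hn0 : (0 : ℝ) < n := by
    have : 0 < n := by omega
    exact_mod_cast this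
  set η : ℝ := ((q : ℝ) + 2 * d + 1) / n with hη
  have hηr : ((q : ℝ) + (n - (n - 2 * d : ℕ)) + 1) / n = η := by
    rw [hη, Nat.cast_sub hnd.le]
    push_cast
    ring
  rw [hηr] at hbad
  -- End points of cycles lie over the same base point as their starting points, because `s ^ (n -
  -- i)` fixes `Y` for every label of positive weight.
  have hBD : ∀ z ∈ B, z.1 ∈ periodicDomain s := by
    intro z hz
    rcases hB z hz with h | ⟨i, hi, hwi, h⟩
    · exact (hED z h).1
    · have h1 := hED _ h
      have h2 := hwY i hi hwi _ h1.2
      rw [← hR.act_fst, act_act_neg] at h2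
      rw [h2]
      exact h1.1
  -- Where `T` differs from `R`, the two image points lie over the same `s`-orbit and both over the
  -- fundamental domain, hence over the same point.
  have hT : IsOver s T := by
    intro z
    rcases hTB z with h | ⟨h1, h2, k, h3⟩
    · rw [h, hR]
    · have h4 := hBD _ h1
      have h5 := hBD _ h2
      rw [h3, hR.act_fst] at h5
      rw [h3, hR.act_fst, act_eq_of_mem_periodicDomain h4 h5, hR]
  refine ⟨T, hT, ?_, fun k k' => ?_⟩
  · have h1 := mul_measureReal_le_one R hE hsep
    have h2 : (μ.prod μ).real E ≤ η := by
      rw [hη, le_div_iff₀ hn0]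
      have : (0 : ℝ) ≤ q + 2 * d := by positivity
      nlinarith
    linarith
  · set G : ℤ → Set (X × X) := fun j => {z | act T j z ∈ L k ∧ z ∈ L k'} with hG
    set Q : ℕ → Set (X × X) := fun a => {z | act R (-(a : ℕ)) z ∈ E} with hQ
    have hQm : ∀ a, MeasurableSet (Q a) := fun a => measurableSet_act R _ hE
    have hGm : ∀ j, MeasurableSet (G j) := fun j => (measurableSet_act T j (hL k)).inter (hL k')
    set r := n - 2 * d with hr
    have hdis : Set.PairwiseDisjoint (↑(Finset.range r) : Set ℕ) Q := by
      have key : ∀ a b : ℕ, b < r → a < b → ∀ z, z ∈ Q a → z ∈ Q b → False := by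
        intro a b hb hab z ha hb'
        refine hsep _ hb' (b - a) (by omega) (by omega) ?_
        rw [← act_add, show ((b - a : ℕ) : ℤ) + -(b : ℤ) = -(a : ℤ) by omega]
        exact ha
      intro a ha b hb hab
      refine Set.disjoint_left.2 fun z hza hzb => ?_
      rcases lt_or_gt_of_ne hab with h | h
      · exact key a b (Finset.mem_range.1 hb) h z hza hzb
      · exact key b a (Finset.mem_range.1 ha) h z hzb hza
    set Qr : Set (X × X) := ⋃ a ∈ Finset.range r, Q a with hQr
    have hQrm : MeasurableSet Qr := Finset.measurableSet_biUnion _ fun a _ => hQm a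
    set P : ℤ → ℝ := fun j => (μ.prod μ).real ((G j ∩ {z | z.1 ∈ Y}) \ Qr) with hP
    have hPη : ∀ j, P j ≤ η := by
      intro j
      refine le_trans (measureReal_mono ?_ (measure_ne_top _ _)) hbad
      rintro z ⟨⟨-, hz⟩, hzQ⟩
      refine ⟨hz, fun a ha haE => hzQ ?_⟩
      exact Set.mem_biUnion (Finset.mem_coe.2 (Finset.mem_range.2 ha)) haE
    have hdecomp : ∀ j, (μ.prod μ).real {z | act T j z ∈ L k ∧ z ∈ L k' ∧ z.1 ∈ Y} =
        ∑ a ∈ Finset.range r,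
          (μ.prod μ).real {z | act T j z ∈ L k ∧ z ∈ L k' ∧ act R (-(a : ℕ)) z ∈ E} + P j := by
      intro j
      have e1 : {z | act T j z ∈ L k ∧ z ∈ L k' ∧ z.1 ∈ Y} = G j ∩ {z | z.1 ∈ Y} := by
        ext z
        simp only [hG, Set.mem_ofPred_eq, Set.mem_inter_iff, and_assoc]
      have e2 : (G j ∩ {z | z.1 ∈ Y}) ∩ Qr = ⋃ a ∈ Finset.range r, G j ∩ Q a := by
        ext z
        simp only [hQr, Set.mem_inter_iff, Set.mem_iUnion, Set.mem_ofPred_eq, exists_prop]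
        constructor
        · rintro ⟨⟨h1, -⟩, a, ha, h2⟩
          exact ⟨a, ha, h1, h2⟩
        · rintro ⟨a, ha, h1, h2⟩
          refine ⟨⟨h1, ?_⟩, a, ha, h2⟩
          have := (hED _ h2).2
          rwa [hR.act_fst, hYact] at this
      have e3 : ∀ a, {z | act T j z ∈ L k ∧ z ∈ L k' ∧ act R (-(a : ℕ)) z ∈ E} = G j ∩ Q a := by
        intro a
        ext z
        simp only [hG, hQ, Set.mem_ofPred_eq, Set.mem_inter_iff, and_assoc]
      rw [e1, ← measureReal_inter_add_sdiff (s := G j ∩ {z | z.1 ∈ Y}) hQrm, e2,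
        measureReal_biUnion_finset _ fun a _ => (hGm j).inter (hQm a)]
      · simp only [e3, hP]
      · intro a ha b hb hab
        exact (hdis ha hb hab).mono Set.inter_subset_right Set.inter_subset_right
    simp only [hdecomp]
    have e4 : ∑ a ∈ Finset.range r,
        (μ.prod μ).real {z | act T n z ∈ L k ∧ z ∈ L k' ∧ act R (-(a : ℕ)) z ∈ E} =
        ∑ i ∈ Finset.range (d + 1), w i * ∑ a ∈ Finset.range r,
          (μ.prod μ).real {z | act T i z ∈ L k ∧ z ∈ L k' ∧ act R (-(a : ℕ)) z ∈ E} := by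
      rw [Finset.sum_congr rfl fun a ha => hcyc k k' a (Finset.mem_range.1 ha), Finset.sum_comm]
      exact Finset.sum_congr rfl fun i _ => (Finset.mul_sum _ _ _).symm
    rw [e4]
    simp only [mul_add, Finset.sum_add_distrib]
    rw [add_sub_add_left_eq_sub]
    exact abs_sub_sum_mul_le hw hd (fun i => measureReal_nonneg) (fun i => hPη i)
      measureReal_nonneg (hPη n)

end Periodic

/-! ### Fibrewise conjugation over the aperiodic part of the base -/

section Conjugation

theorem corr_conj {Z : Type*} [MeasurableSpace Z] {m : Measure Z} (J R : MPMap m) (n : ℕ)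
    {B C : Set Z} (hB : MeasurableSet B) (hC : MeasurableSet C) :
    (J * R * J⁻¹).corr n B C = R.corr n (J.1 ⁻¹' B) (J.1 ⁻¹' C) := by
  rw [MPMap.corr, MPMap.corr, conj_pow, ← measureReal_preimage J]
  · congr 1
    ext z
    simp only [Set.mem_preimage, Set.mem_inter_iff, mul_apply, inv_apply_self]
  · exact ((J * R ^ n * J⁻¹).1.measurable hB).inter hC

theorem AdmissibleFunction.corr_conj {Z : Type*} [MeasurableSpace Z] {m : Measure Z}
    (P : AdmissibleFunction) (J R : MPMap m) {B C : Set Z} (hB : MeasurableSet B)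
    (hC : MeasurableSet C) :
    P.corr (Aut.mk (J * R * J⁻¹)) B C = P.corr (Aut.mk R) (J.1 ⁻¹' B) (J.1 ⁻¹' C) := by
  simp only [AdmissibleFunction.corr, Aut.corr_mk, TypicalExt.corr_conj J R _ hB hC,
    measureReal_preimage J hB, measureReal_preimage J hC]

variable {X : Type*} [MeasurableSpace X] [StandardBorelSpace X] {μ : Measure X}
  [IsProbabilityMeasure μ]

/-- Over the aperiodic part of the base any two extensions are almost conjugate. -/
theorem exists_conjugate {s : MPMap μ} {R₀ R : MPMap (μ.prod μ)} (h₀ : IsOver s R₀)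
    (hR : IsOver s R) {ε : ℝ} (hε : 0 < ε) :
    ∃ J, IsOver 1 J ∧
      (μ.prod μ).real {z | z.1 ∉ periodicSet s ∧ (J * R₀ * J⁻¹).1 z ≠ R.1 z} ≤ ε := by
  classical
  obtain ⟨M₀, hM₀⟩ := exists_nat_gt (2 / ε)
  set M := M₀ + 1 with hM
  obtain ⟨E, hEA, hE, hsep, hbad⟩ := exists_tower s (H := M) (A := (periodicSet s)ᶜ) (by omega)
    (measurableSet_periodicSet s).compl (fun z hz k hk h => hz ⟨k, hk, h⟩)
    (fun z => not_congr (act_mem_periodicSet_iff s M z)) (half_pos hε)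
  have hmE : μ.real E ≤ ε / 2 := by
    have h1 := mul_measureReal_le_one s hE hsep
    rw [div_lt_iff₀ hε] at hM₀
    have h2 : (M : ℝ) = M₀ + 1 := by rw [hM]; push_cast; ring
    rw [h2] at h1
    have h4 := measureReal_nonneg (μ := μ) (s := E)
    by_contra! h3
    nlinarith
  -- The resulting function gives the level in the tower, with the value `M` off the tower.
  have hex : ∀ x, ∃ a : ℕ, (a < M ∧ act s (-a) x ∈ E) ∨ M ≤ a := fun x => ⟨M, Or.inr le_rfl⟩
  let k : X → ℕ := fun x => Nat.find (hex x)
  have hk : Measurable k := by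
    refine measurable_find hex fun a => ?_
    exact ((MeasurableSet.const _).inter (measurableSet_act s _ hE)).union (MeasurableSet.const _)
  have hka : ∀ x, ∀ a : ℕ, a < M → act s (-a) x ∈ E → k x = a := by
    intro x a ha haE
    refine (Nat.find_eq_iff _).2 ⟨Or.inl ⟨ha, haE⟩, ?_⟩
    rintro b hb (⟨-, hbE⟩ | hbM)
    · refine hsep _ haE (a - b) (by omega) (by omega) ?_
      rw [← act_add, show ((a - b : ℕ) : ℤ) + -(a : ℤ) = -(b : ℤ) by omega]
      exact hbE
    · omega
  -- On level `a` the conjugator goes down to the base of the tower by `R₀` and back up by `R`. It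
  -- intertwines the two maps except at the top level and off the tower.
  let G : ℕ → MPMap (μ.prod μ) := fun a => R ^ a * (R₀ ^ a)⁻¹
  have hG : ∀ a, IsOver 1 (G a) := fun a => by
    have := (hR.pow a).mul (h₀.pow a).inv
    rwa [mul_inv_cancel] at this
  have hGfst : ∀ a z, ((G a).1 z).1 = z.1 := fun a z => hG a z
  have hGifst : ∀ a z, (((G a)⁻¹).1 z).1 = z.1 := fun a z => by
    have := (hG a).inv z
    rwa [inv_one] at this
  obtain ⟨J, hJ⟩ := exists_mpMap_of_piecewise G (fun z => k z.1) (hk.comp measurable_fst) (by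
    refine Function.bijective_iff_has_inverse.2 ⟨fun z => ((G (k z.1))⁻¹).1 z, fun z => ?_,
      fun z => ?_⟩
    · simp only [hGfst, inv_apply_self]
    · simp only [hGifst, apply_inv_self])
  have hJ1 : IsOver 1 J := fun z => by
    rw [hJ, hGfst]
    rfl
  have hJfst : ∀ z, ((J⁻¹).1 z).1 = z.1 := fun z => by
    have := hJ1.inv z
    rwa [inv_one] at this
  refine ⟨J, hJ1, ?_⟩
  have hagree : ∀ z : X × X, k (s.1 z.1) = k z.1 + 1 → (J * R₀ * J⁻¹).1 z = R.1 z := by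
    intro z hz
    have h1 : J.1 (R₀.1 ((J⁻¹).1 z)) = (G (k z.1 + 1)).1 (R₀.1 ((J⁻¹).1 z)) := by
      rw [hJ, h₀, hJfst, hz]
    have h2 : (J⁻¹).1 z = ((G (k z.1))⁻¹).1 z := by
      apply J.1.injective
      rw [apply_inv_self, hJ, hGifst, apply_inv_self]
    have h3 : G (k z.1 + 1) * R₀ * (G (k z.1))⁻¹ = R := by
      simp only [G, pow_succ', mul_inv_rev, inv_inv]
      group
    rw [mul_apply, mul_apply, h1, h2]
    exact congrArg (fun T : MPMap (μ.prod μ) => T.1 z) h3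
  have hsub : {z : X × X | z.1 ∉ periodicSet s ∧ (J * R₀ * J⁻¹).1 z ≠ R.1 z} ⊆
      Prod.fst ⁻¹' ({x | (∃ k : ℕ, act s (-k) x ∈ (periodicSet s)ᶜ) ∧
        ∀ a < M, act s (-(a : ℕ)) x ∉ E} ∪ {x | act s (-M₀) x ∈ E}) := by
    rintro z ⟨hz, hne⟩
    by_cases h : ∀ a < M, act s (-(a : ℕ)) z.1 ∉ E
    · exact Or.inl ⟨⟨0, by simpa using hz⟩, h⟩
    · push Not at h
      obtain ⟨a, ha, haE⟩ := h
      refine Or.inr ?_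
      rcases eq_or_ne a M₀ with rfl | hne'
      · exact haE
      · refine absurd (hagree z ?_) hne
        rw [hka _ a ha haE]
        refine hka _ (a + 1) (by omega) ?_
        rw [← act_one, ← act_add, show (-((a + 1 : ℕ) : ℤ)) + 1 = -(a : ℤ) by push_cast; ring]
        exact haE
  refine (measureReal_mono hsub (measure_ne_top _ _)).trans ?_
  have hUm : MeasurableSet ({x | (∃ k : ℕ, act s (-k) x ∈ (periodicSet s)ᶜ) ∧
      ∀ a < M, act s (-(a : ℕ)) x ∉ E}) := by
    have : {x | (∃ k : ℕ, act s (-k) x ∈ (periodicSet s)ᶜ) ∧ ∀ a < M, act s (-(a : ℕ)) x ∉ E} =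
        (⋃ k : ℕ, {x | act s (-k) x ∈ (periodicSet s)ᶜ}) ∩
          ⋂ a : ℕ, ⋂ (_ : a < M), {x | act s (-(a : ℕ)) x ∈ E}ᶜ := by
      ext x
      simp only [Set.mem_ofPred_eq, Set.mem_inter_iff, Set.mem_iUnion, Set.mem_iInter,
        Set.mem_compl_iff]
    rw [this]
    exact (MeasurableSet.iUnion fun k => measurableSet_act s _
      (measurableSet_periodicSet s).compl).inter (MeasurableSet.iInter fun a =>
        MeasurableSet.iInter fun _ => (measurableSet_act s _ hE).compl)
  rw [measurePreserving_fst.measureReal_preimage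
    (hUm.union (measurableSet_act s _ hE)).nullMeasurableSet]
  refine (measureReal_union_le _ _).trans ?_
  rw [measureReal_act s _ hE]
  linarith

end Conjugation

/-! ### Arithmetic constraints on the powers along the periodic part of the base -/

section Arithmetic

variable {X : Type*} [MeasurableSpace X] {μ : Measure X} [IsProbabilityMeasure μ]

/-- Testing on cylinders over sets of the base shows that `s` itself has the same weak limit; only
this information about `R₀` is needed over the periodic part. -/
theorem tendsto_corr_base {s : MPMap μ} {R : MPMap (μ.prod μ)} (hR : IsOver s R)
    {P : AdmissibleFunction} {n : ℕ → ℕ}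
    (h : ∀ B C, MeasurableSet B → MeasurableSet C →
      Tendsto (fun j => (Aut.mk R).corr (n j) B C) atTop (𝓝 (P.corr (Aut.mk R) B C)))
    {B C : Set X} (hB : MeasurableSet B) (hC : MeasurableSet C) :
    Tendsto (fun j => (Aut.mk s).corr (n j) B C) atTop (𝓝 (P.corr (Aut.mk s) B C)) := by
  have hfst : ∀ {U : Set X}, MeasurableSet U → (μ.prod μ).real (Prod.fst ⁻¹' U) = μ.real U :=
    fun hU => measurePreserving_fst.measureReal_preimage hU.nullMeasurableSet
  have hcorr : ∀ i, (Aut.mk R).corr i (Prod.fst ⁻¹' B) (Prod.fst ⁻¹' C) =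
      (Aut.mk s).corr i B C := by
    intro i
    rw [Aut.corr_mk, Aut.corr_mk, MPMap.corr, MPMap.corr,
      ← hfst (((s ^ i).1.measurable hB).inter hC)]
    congr 1
    ext z
    simp only [Set.mem_inter_iff, Set.mem_preimage, (hR.pow i) z]
  have := h _ _ (measurable_fst hB) (measurable_fst hC)
  simpa only [AdmissibleFunction.corr, hcorr, hfst hB, hfst hC] using this

theorem coeff_mul_corr_le (P : AdmissibleFunction) (T : Aut μ) (B C : Set X) (i : ℕ) :
    P.coeff i * T.corr i B C ≤ P.corr T B C := by
  have h1 : Summable fun i => P.coeff i * T.corr i B C :=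
    P.summable_mul (fun i => T.corr_nonneg i B C) (fun i => T.corr_le_one i B C)
  have h2 := h1.le_tsum i fun j _ => mul_nonneg (P.coeff_nonneg j) (T.corr_nonneg j B C)
  have h3 : 0 ≤ P.c * (μ.real B * μ.real C) :=
    mul_nonneg P.c_nonneg (mul_nonneg measureReal_nonneg measureReal_nonneg)
  rw [AdmissibleFunction.corr]
  linarith

theorem c_mul_le_corr (P : AdmissibleFunction) (T : Aut μ) (B C : Set X) :
    P.c * (μ.real B * μ.real C) ≤ P.corr T B C :=
  le_add_of_nonneg_right (tsum_nonneg fun i =>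
    mul_nonneg (P.coeff_nonneg i) (T.corr_nonneg i B C))

variable [StandardBorelSpace X]

/-- The set `Y` is covered by the countably many preimages of its part in the fundamental domain. -/
theorem measure_inter_periodicDomain_pos (s : MPMap μ) {Y : Set X}
    (hYs : ∀ x, s.1 x ∈ Y ↔ x ∈ Y) (hYp : Y ⊆ periodicSet s) (hY : μ Y ≠ 0) :
    μ (Y ∩ periodicDomain s) ≠ 0 := by
  intro h0
  refine hY (measure_mono_null (t := ⋃ j : ℤ, act s j ⁻¹' (Y ∩ periodicDomain s)) ?_
    (measure_iUnion_null fun j => (quasiMeasurePreserving_act s j).preimage_null h0))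
  intro x hx
  obtain ⟨k, hk1, hk⟩ := hYp hx
  obtain ⟨j, -, hj⟩ := exists_act_mem_periodicDomain hk1 hk
  exact Set.mem_iUnion.2 ⟨j, (act_mem_iff_of_invariant hYs j x).2 hx, hj⟩

/-- Periodic points of positive measure prevent ergodicity: the orbits of half of the fundamental
domain form an invariant set `B` with `B` and `Bᶜ` both of positive measure. The correlations of `B`
and `Bᶜ` vanish, whereas the limit is at least `c μ(B) μ(Bᶜ)`. -/
theorem c_eq_zero_of_periodicSet [NullSingletonClass μ] {s : MPMap μ} {P : AdmissibleFunction}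
    {n : ℕ → ℕ}
    (h : ∀ B C, MeasurableSet B → MeasurableSet C →
      Tendsto (fun j => (Aut.mk s).corr (n j) B C) atTop (𝓝 (P.corr (Aut.mk s) B C)))
    (hs : μ (periodicSet s) ≠ 0) : P.c = 0 := by
  set D := periodicDomain s with hD
  have hDm : MeasurableSet D := measurableSet_periodicDomain s
  have hD0 : 0 < μ.real D := by
    have h1 := measure_inter_periodicDomain_pos s (Y := periodicSet s)
      (fun x => by rw [← act_one, act_mem_periodicSet_iff]) subset_rfl hs
    refine ENNReal.toReal_pos (fun h0 => h1 (measure_mono_null Set.inter_subset_right h0))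
      (measure_ne_top μ _)
  obtain ⟨ι, hι, -, hιD⟩ := exists_split (μ.restrict D) (w := fun i => if i < 2 then 1 / 2 else 0)
    (fun i => by split_ifs <;> norm_num) (d := 1) (by norm_num [Finset.sum_range_succ])
    (fun i hi => if_neg (by omega))
  have hhalf : ∀ i < 2, 0 < μ.real (ι ⁻¹' {i} ∩ D) := by
    intro i hi
    have h1 := hιD i
    rw [measureReal_restrict_apply (hι (measurableSet_singleton i)),
      measureReal_restrict_apply MeasurableSet.univ, Set.univ_inter, if_pos hi] at h1
    rw [h1]
    positivity
  set B : Set X := ⋃ j : ℤ, {x | act s j x ∈ ι ⁻¹' {0} ∩ D} with hB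
  have hBm : MeasurableSet B := MeasurableSet.iUnion fun j =>
    measurableSet_act s j ((hι (measurableSet_singleton 0)).inter hDm)
  have hBs : ∀ x, s.1 x ∈ B ↔ x ∈ B := by
    intro x
    simp only [hB, Set.mem_iUnion, Set.mem_ofPred_eq, ← act_one, ← act_add]
    constructor
    · rintro ⟨j, hj⟩
      exact ⟨j + 1, hj⟩
    · rintro ⟨j, hj⟩
      exact ⟨j - 1, by rwa [sub_add_cancel]⟩
  have h0 : ∀ j, (Aut.mk s).corr (n j) B Bᶜ = 0 := by
    intro j
    rw [Aut.corr_mk, MPMap.corr]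
    convert measureReal_empty
    ext x
    simp only [Set.mem_inter_iff, Set.mem_preimage, Set.mem_compl_iff, Set.mem_empty_iff_false,
      iff_false, not_and, not_not]
    intro hx
    rwa [← act_natCast, act_mem_iff_of_invariant hBs] at hx
  have hlim := h B Bᶜ hBm hBm.compl
  simp only [h0] at hlim
  have h1 := tendsto_nhds_unique hlim tendsto_const_nhds
  have h2 := c_mul_le_corr P (Aut.mk s) B Bᶜ
  rw [h1] at h2
  have h3 : 0 < μ.real B := (hhalf 0 (by norm_num)).trans_le (measureReal_mono
    (fun x hx => Set.mem_iUnion.2 ⟨0, hx⟩) (measure_ne_top _ _))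
  have h4 : 0 < μ.real Bᶜ := by
    refine (hhalf 1 (by norm_num)).trans_le (measureReal_mono ?_ (measure_ne_top _ _))
    rintro x ⟨hx1, hxD⟩ hxB
    obtain ⟨j, hj0, hjD⟩ := Set.mem_iUnion.1 hxB
    rw [Set.mem_preimage, act_eq_of_mem_periodicDomain hxD hjD] at hj0
    have : (0 : ℕ) = 1 := hj0.symm.trans hx1
    omega
  have h5 := P.c_nonneg
  by_contra h6
  have h7 : 0 < P.c := lt_of_le_of_ne h5 (Ne.symm h6)
  have := mul_pos h7 (mul_pos h3 h4)
  linarith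

/-- If a residue `r` of `n j - i` moved a non-null set of points of period `q`, its part `D` in the
fundamental domain would satisfy `P.corr ≥ coeff i * μ(D) > 0` against its preimage under `s ^ i`.
Then `s ^ r` would send some point of `D` into `D`, hence fix it, a contradiction. There are only
finitely many residues modulo `q`. -/
theorem eventually_act_sub_eq {s : MPMap μ} {P : AdmissibleFunction} {n : ℕ → ℕ}
    (h : ∀ B C, MeasurableSet B → MeasurableSet C →
      Tendsto (fun j => (Aut.mk s).corr (n j) B C) atTop (𝓝 (P.corr (Aut.mk s) B C)))
    {i : ℕ} (hi : P.coeff i ≠ 0) {q : ℕ} (hq : 1 ≤ q) :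
    ∀ᶠ j in atTop, μ {x | act s q x = x ∧ act s ((n j : ℤ) - i) x ≠ x} = 0 := by
  have key : ∀ r : ℤ, ∀ᶠ j in atTop, (q : ℤ) ∣ (n j : ℤ) - i - r →
      μ {x | act s q x = x ∧ act s r x ≠ x} = 0 := by
    intro r
    set V : Set X := {x | act s q x = x ∧ act s r x ≠ x} with hV
    by_cases hV0 : μ V = 0
    · exact Eventually.of_forall fun _ _ => hV0
    have hVm : MeasurableSet V := (measurableSet_act_eq s q).inter (measurableSet_act_eq s r).compl
    have hcomm : ∀ (a : ℤ) x, act s a (s.1 x) = s.1 (act s a x) := fun a x => by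
      rw [← act_one, ← act_one, ← act_add, ← act_add, add_comm]
    have hVs : ∀ x, s.1 x ∈ V ↔ x ∈ V := by
      intro x
      simp only [hV, Set.mem_ofPred_eq, hcomm, s.1.injective.eq_iff, ne_eq]
    set D := V ∩ periodicDomain s with hD
    have hDm : MeasurableSet D := hVm.inter (measurableSet_periodicDomain s)
    have hD0 : 0 < μ.real D := ENNReal.toReal_pos
      (measure_inter_periodicDomain_pos s hVs (fun x hx => ⟨q, hq, hx.1⟩) hV0) (measure_ne_top _ _)
    have hCm : MeasurableSet {x | act s i x ∈ D} := measurableSet_act s i hDm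
    have hlim := h D {x | act s i x ∈ D} hDm hCm
    have hpos : 0 < P.corr (Aut.mk s) D {x | act s i x ∈ D} := by
      refine lt_of_lt_of_le ?_ (coeff_mul_corr_le P (Aut.mk s) D _ i)
      refine mul_pos (lt_of_le_of_ne (P.coeff_nonneg i) (Ne.symm hi)) ?_
      have : (s ^ i).1 ⁻¹' D ∩ {x | act s i x ∈ D} = {x | act s i x ∈ D} := by
        ext x
        simp only [Set.mem_inter_iff, Set.mem_preimage, act_natCast, Set.mem_ofPred_eq, and_self]
      rw [Aut.corr_mk, MPMap.corr, this, measureReal_act s i hDm]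
      exact hD0
    filter_upwards [hlim.eventually (lt_mem_nhds hpos)] with j hj hdvd
    exfalso
    rw [Aut.corr_mk, MPMap.corr] at hj
    obtain ⟨x, hx1, hx2⟩ := nonempty_of_measureReal_ne_zero hj.ne'
    rw [Set.mem_preimage, ← act_natCast] at hx1
    set y := act s i x with hy
    have hxy : act s (n j) x = act s r y := by
      rw [← act_eq_of_modEq (a := (n j : ℤ) - i) hx2.1.1 hdvd, ← act_add, sub_add_cancel]
    rw [hxy] at hx1
    exact hx2.1.2 (act_eq_of_mem_periodicDomain hx2.2 hx1.2)
  have hall : ∀ᶠ j in atTop, ∀ r ∈ Finset.range q, (q : ℤ) ∣ (n j : ℤ) - i - r →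
      μ {x | act s q x = x ∧ act s r x ≠ x} = 0 :=
    (eventually_all_finset _).2 fun r _ => key r
  filter_upwards [hall] with j hj
  have hq0 : (q : ℤ) ≠ 0 := by omega
  have h0 := Int.emod_nonneg ((n j : ℤ) - i) hq0
  have hlt := Int.emod_lt_of_pos ((n j : ℤ) - i) (show (0 : ℤ) < q by omega)
  have h1 := hj (((n j : ℤ) - i) % q).toNat (Finset.mem_range.2 (by omega))
  rw [Int.toNat_of_nonneg h0] at h1
  refine measure_mono_null ?_ (h1 Int.dvd_self_sub_emod)
  rintro x ⟨hx1, hx2⟩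
  refine ⟨hx1, ?_⟩
  rwa [← act_eq_of_modEq hx1 Int.dvd_self_sub_emod]

/-- Every period divides all sufficiently large factorials, so the exceptional sets for `k!`
decrease to the empty set. -/
theorem exists_common_period (s : MPMap μ) {ε : ℝ} (hε : 0 < ε) :
    ∃ q : ℕ, 1 ≤ q ∧ μ.real (periodicSet s \ {x | act s q x = x}) < ε := by
  set U : ℕ → Set X := fun k => periodicSet s \ {x | act s (k.factorial : ℕ) x = x} with hU
  have hUm : ∀ k, MeasurableSet (U k) := fun k =>
    (measurableSet_periodicSet s).diff (measurableSet_act_eq s _)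
  have hanti : Antitone U := by
    intro a b hab
    refine Set.sdiff_subset_sdiff_right fun x hx => ?_
    obtain ⟨c, hc⟩ := Nat.factorial_dvd_factorial hab
    rw [Set.mem_ofPred_eq, hc, Nat.cast_mul]
    exact act_mul_of_act_eq hx _
  have hempty : ⋂ k, U k = ∅ := by
    refine Set.eq_empty_of_forall_notMem fun x hx => ?_
    rw [Set.mem_iInter] at hx
    obtain ⟨k, hk1, hk⟩ := (hx 0).1
    refine (hx k).2 ?_
    obtain ⟨c, hc⟩ := Nat.dvd_factorial hk1 le_rfl
    rw [Set.mem_ofPred_eq, hc, Nat.cast_mul]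
    exact act_mul_of_act_eq hk _
  have hlim := tendsto_measure_iInter_atTop (μ := μ) (fun k => (hUm k).nullMeasurableSet) hanti
    ⟨0, measure_ne_top _ _⟩
  rw [hempty, measure_empty] at hlim
  have hlim' : Tendsto (fun k => μ.real (U k)) atTop (𝓝 0) :=
    (ENNReal.tendsto_toReal ENNReal.zero_ne_top).comp hlim
  obtain ⟨k, hk⟩ := (hlim'.eventually (gt_mem_nhds hε)).exists
  exact ⟨k.factorial, Nat.factorial_pos k, hk⟩

end Arithmetic

/-! ### Density -/

/-- The tail mass is moved to one index `i₀` with nonzero coefficient. The support must not grow,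
because the arithmetic constraint is only known for nonzero coefficients. -/
theorem AdmissibleFunction.exists_truncation (P : AdmissibleFunction) (hc : P.c = 0) {η : ℝ}
    (hη : 0 < η) :
    ∃ (d : ℕ) (w : ℕ → ℝ), (∀ i, 0 ≤ w i) ∧ ∑ i ∈ Finset.range (d + 1), w i = 1 ∧
      (∀ i > d, w i = 0) ∧ (∀ i, w i ≠ 0 → P.coeff i ≠ 0) ∧
      ∀ u : ℕ → ℝ, (∀ i, 0 ≤ u i) → (∀ i, u i ≤ 1) →
        |∑ i ∈ Finset.range (d + 1), w i * u i - ∑' i, P.coeff i * u i| ≤ η := by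
  have hsum : HasSum P.coeff 1 := by
    have := P.hasSum_coeff
    rwa [hc, sub_zero] at this
  obtain ⟨i₀, hi₀⟩ : ∃ i, P.coeff i ≠ 0 := by
    by_contra! h
    rw [funext h] at hsum
    exact zero_ne_one (hasSum_zero.unique hsum)
  obtain ⟨D, hD⟩ := eventually_atTop.1
    (hsum.tendsto_sum_nat.eventually (lt_mem_nhds (show 1 - η < 1 by linarith)))
  set d := max D i₀ with hd
  set t := 1 - ∑ i ∈ Finset.range (d + 1), P.coeff i with ht
  have ht0 : 0 ≤ t := sub_nonneg.2 (sum_le_hasSum _ (fun i _ => P.coeff_nonneg i) hsum)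
  have htη : t ≤ η := by
    have := hD (d + 1) (by omega)
    linarith
  have hmem : i₀ ∈ Finset.range (d + 1) := Finset.mem_range.2 (by omega)
  set w : ℕ → ℝ := fun i =>
    if i ∈ Finset.range (d + 1) then P.coeff i + (if i = i₀ then t else 0) else 0 with hw
  have hwu : ∀ u : ℕ → ℝ, ∑ i ∈ Finset.range (d + 1), w i * u i =
      ∑ i ∈ Finset.range (d + 1), P.coeff i * u i + t * u i₀ := by
    intro u
    have : ∀ i ∈ Finset.range (d + 1), w i * u i =
        P.coeff i * u i + if i = i₀ then t * u i else 0 := by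
      intro i hi
      simp only [hw, if_pos hi, add_mul, ite_mul, zero_mul]
    rw [Finset.sum_congr rfl this, Finset.sum_add_distrib, Finset.sum_ite_eq' _ i₀, if_pos hmem]
  refine ⟨d, w, fun i => ?_, ?_, fun i hi => ?_, fun i hi => ?_, fun u h0 h1 => ?_⟩
  · have := P.coeff_nonneg i
    simp only [hw]
    split_ifs <;> linarith
  · have := hwu fun _ => 1
    simp only [mul_one] at this
    rw [this]
    linarith
  · exact if_neg (by rw [Finset.mem_range]; omega)
  · intro h
    rcases eq_or_ne i i₀ with rfl | hne
    · exact hi₀ h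
    · refine hi ?_
      simp only [hw, h, if_neg hne, add_zero, ite_self]
  · have hs : Summable fun i => P.coeff i * u i := P.summable_mul h0 h1
    have hsplit := hs.sum_add_tsum_nat_add (d + 1)
    have hsplit' := hsum.summable.sum_add_tsum_nat_add (d + 1)
    rw [hsum.tsum_eq] at hsplit'
    have h2 : 0 ≤ ∑' i, P.coeff (i + (d + 1)) * u (i + (d + 1)) :=
      tsum_nonneg fun i => mul_nonneg (P.coeff_nonneg _) (h0 _)
    have h3 : ∑' i, P.coeff (i + (d + 1)) * u (i + (d + 1)) ≤ ∑' i, P.coeff (i + (d + 1)) :=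
      ((summable_nat_add_iff (d + 1)).2 hs).tsum_le_tsum
        (fun i => mul_le_of_le_one_right (P.coeff_nonneg _) (h1 _))
        ((summable_nat_add_iff (d + 1)).2 hsum.summable)
    have h4 : 0 ≤ t * u i₀ := mul_nonneg ht0 (h0 _)
    have h5 : t * u i₀ ≤ t := mul_le_of_le_one_right ht0 (h1 _)
    rw [hwu, abs_le]
    constructor <;> linarith

section Density

variable {X : Type*} [MeasurableSpace X] [StandardBorelSpace X] {μ : Measure X}
  [IsProbabilityMeasure μ]

/-- Two extensions can be glued along an invariant set of the base. -/
theorem exists_glue {s : MPMap μ} {T₁ T₂ : MPMap (μ.prod μ)} (h₁ : IsOver s T₁)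
    (h₂ : IsOver s T₂) {Y : Set X} (hY : MeasurableSet Y) (hYs : ∀ x, s.1 x ∈ Y ↔ x ∈ Y) :
    ∃ T, IsOver s T ∧ ∀ (i : ℕ) (z : X × X),
      (z.1 ∈ Y → act T i z = act T₂ i z) ∧ (z.1 ∉ Y → act T i z = act T₁ i z) := by
  classical
  let G : Prop → MPMap (μ.prod μ) := fun p => if p then T₂ else T₁
  have hG : ∀ p, IsOver s (G p) := fun p => by
    by_cases h : p
    · simpa only [G, if_pos h] using h₂
    · simpa only [G, if_neg h] using h₁
  have hYi : ∀ x, (s⁻¹).1 x ∈ Y ↔ x ∈ Y := fun x => by rw [← hYs, apply_inv_self]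
  obtain ⟨T, hT⟩ := exists_mpMap_of_piecewise G (fun z => z.1 ∈ Y)
    ((measurable_mem.2 hY).comp measurable_fst) (by
      refine Function.bijective_iff_has_inverse.2 ⟨fun z => ((G (z.1 ∈ Y))⁻¹).1 z, fun z => ?_,
        fun z => ?_⟩
      · simp only [hG _ z, hYs, inv_apply_self]
      · simp only [(hG _).inv z, hYi, apply_inv_self])
  have hTs : IsOver s T := fun z => by rw [hT, hG]
  refine ⟨T, hTs, fun i => ?_⟩
  have hYact := act_mem_iff_of_invariant hYs
  induction i with
  | zero => simp
  | succ i ih =>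
    intro z
    simp only [Nat.cast_succ, add_comm _ (1 : ℤ), act_add, act_one]
    refine ⟨fun h => ?_, fun h => ?_⟩
    · rw [(ih z).1 h, hT, h₂.act_fst, hYact]
      simp only [G, if_pos h]
    · rw [(ih z).2 h, hT, h₁.act_fst, hYact]
      simp only [G, if_neg h]

/-- The map is the conjugate of `R₀` off the set `Y` of points with a common period, and the map
with prescribed power over `Y`. One power `n j` serves both parts. -/
theorem exists_mem_nearSet [NullSingletonClass μ] (A : DenseFamily (μ.prod μ)) {s : MPMap μ}
    {R₀ R : MPMap (μ.prod μ)} (h₀ : IsOver s R₀) (hR : IsOver s R)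
    (hap : ∀ᵐ z ∂μ.prod μ, z ∉ periodicSet R) {P : AdmissibleFunction}
    {n : ℕ → ℕ} (hn : Tendsto n atTop atTop)
    (h : ∀ B C, MeasurableSet B → MeasurableSet C →
      Tendsto (fun j => (Aut.mk R₀).corr (n j) B C) atTop (𝓝 (P.corr (Aut.mk R₀) B C)))
    (N : ℕ) {ε : ℝ} (hε : 0 < ε) :
    ∃ T, IsOver s T ∧ Aut.mk T ∈ nearSet A P N ∧ (μ.prod μ).real {z | T.1 z ≠ R.1 z} ≤ ε := by
  classical
  obtain ⟨J, hJ1, hJ⟩ := exists_conjugate h₀ hR (show 0 < ε / 4 by linarith)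
  set T₁ := J * R₀ * J⁻¹ with hT₁
  have hT₁s : IsOver s T₁ := by
    have := (hJ1.mul h₀).mul hJ1.inv
    rwa [one_mul, inv_one, mul_one] at this
  have hlim : ∀ B C, MeasurableSet B → MeasurableSet C →
      Tendsto (fun j => (Aut.mk T₁).corr (n j) B C) atTop (𝓝 (P.corr (Aut.mk T₁) B C)) := by
    intro B C hB hC
    simp only [hT₁, Aut.corr_mk, corr_conj J R₀ _ hB hC, P.corr_conj J R₀ hB hC]
    exact h _ _ (J.1.measurable hB) (J.1.measurable hC)
  set τ : ℝ := 1 / (N + 1 : ℝ) with hτ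
  have hτ0 : 0 < τ := by positivity
  have hnear : ∀ C : Set (X × X), MeasurableSet C → ∀ δ > 0, ∀ᶠ j in atTop, ∀ a < N, ∀ b < N,
      |(Aut.mk T₁).corr (n j) (A.sets a) (A.sets b ∩ C) -
        P.corr (Aut.mk T₁) (A.sets a) (A.sets b ∩ C)| < δ := by
    intro C hC δ hδ
    have := (eventually_all_finset (Finset.range N)).2 fun a _ =>
      (eventually_all_finset (Finset.range N)).2 fun b _ =>
        Metric.tendsto_nhds.1 (hlim _ _ (A.measurable a) ((A.measurable b).inter hC)) δ hδ
    simpa only [Finset.mem_range, Real.dist_eq] using this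
  have hper := measurableSet_periodicSet s
  have hfst : ∀ {U : Set X}, MeasurableSet U → (μ.prod μ).real (Prod.fst ⁻¹' U) = μ.real U :=
    fun hU => measurePreserving_fst.measureReal_preimage hU.nullMeasurableSet
  -- Without periodic points in the base the conjugate alone suffices; this is the only case in
  -- which `c` may be nonzero.
  by_cases hs : μ (periodicSet s) = 0
  · refine ⟨T₁, hT₁s, ?_, ?_⟩
    · obtain ⟨j, hj, hjN⟩ := ((hnear _ MeasurableSet.univ τ hτ0).and
        (hn.eventually_ge_atTop N)).exists
      simp only [Set.inter_univ] at hj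
      exact ⟨n j, hjN, hj⟩
    · have hsub : {z | T₁.1 z ≠ R.1 z} ⊆ {z | z.1 ∉ periodicSet s ∧ T₁.1 z ≠ R.1 z} ∪
          Prod.fst ⁻¹' periodicSet s := by
        intro z hz
        by_cases h : z.1 ∈ periodicSet s
        · exact Or.inr h
        · exact Or.inl ⟨h, hz⟩
      have h1 := (measureReal_mono hsub (measure_ne_top (μ.prod μ) _)).trans
        (measureReal_union_le _ _)
      rw [hfst hper, measureReal_def μ, hs, ENNReal.toReal_zero] at h1
      linarith
  have hbase := fun B C hB hC => tendsto_corr_base h₀ h (B := B) (C := C) hB hC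
  have hc := c_eq_zero_of_periodicSet hbase hs
  obtain ⟨q, hq1, hq⟩ := exists_common_period s (show 0 < ε / 4 by linarith)
  obtain ⟨d, w, hw0, hwsum, hwd, hwc, hwu⟩ := P.exists_truncation hc
    (show 0 < τ / 4 by linarith)
  set Y₀ : Set X := {x | act s q x = x} with hY₀
  have hY₀m : MeasurableSet Y₀ := measurableSet_act_eq s q
  have hηlim : Tendsto (fun j => ((q : ℝ) + 2 * d + 1) / n j) atTop (𝓝 0) :=
    (tendsto_natCast_atTop_atTop.comp hn).const_div_atTop _
  -- Convergence is required over `Y₀ᶜ`, which does not depend on `j`. The set `Y` used for gluing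
  -- does depend on `j`, but differs from `Y₀` by a null set.
  obtain ⟨j, hjN, hjd, hjη, hjw, hjnear⟩ := ((hn.eventually_ge_atTop N).and
    ((hn.eventually_gt_atTop (2 * d)).and
    ((hηlim.eventually (gt_mem_nhds (show 0 < min (τ / 4) (ε / 4) by positivity))).and
    (((eventually_all_finset (Finset.range (d + 1))).2 fun i _ =>
      (show ∀ᶠ j in atTop, w i ≠ 0 →
        μ {x | act s q x = x ∧ act s ((n j : ℤ) - i) x ≠ x} = 0 from by
          by_cases hwi : w i = 0
          · exact Eventually.of_forall fun _ h => absurd hwi h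
          · filter_upwards [eventually_act_sub_eq hbase (hwc i hwi) hq1] with j hj _ using hj)).and
    (hnear (Prod.fst ⁻¹' Y₀ᶜ) (measurable_fst hY₀m.compl) (τ / 4) (by linarith)))))).exists
  set Y : Set X := Y₀ ∩ ⋂ i ∈ Finset.range (d + 1), {x | w i ≠ 0 → act s ((n j : ℤ) - i) x = x}
    with hY
  have hYw : ∀ i, {x | w i ≠ 0 → act s ((n j : ℤ) - i) x = x} =
      if w i ≠ 0 then {x | act s ((n j : ℤ) - i) x = x} else Set.univ := by
    intro i
    by_cases hwi : w i ≠ 0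
    · simp only [hwi, if_true, forall_const, ne_eq, not_false_eq_true]
    · simp only [hwi, if_false, false_imp_iff]
      rfl
  have hYm : MeasurableSet Y := by
    refine hY₀m.inter (Finset.measurableSet_biInter _ fun i _ => ?_)
    rw [hYw]
    split_ifs
    · exact measurableSet_act_eq s _
    · exact MeasurableSet.univ
  have hcomm : ∀ (a : ℤ) x, act s a (s.1 x) = s.1 (act s a x) := fun a x => by
    rw [← act_one, ← act_one, ← act_add, ← act_add, add_comm]
  have hYs : ∀ x, s.1 x ∈ Y ↔ x ∈ Y := by
    intro x
    simp only [hY, hY₀, Set.mem_inter_iff, Set.mem_iInter, Set.mem_ofPred_eq, hcomm,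
      s.1.injective.eq_iff]
  have hYY₀ : μ (Y₀ \ Y) = 0 := by
    refine measure_mono_null (t := ⋃ i ∈ Finset.range (d + 1),
      {x | w i ≠ 0 ∧ act s q x = x ∧ act s ((n j : ℤ) - i) x ≠ x}) ?_ ?_
    · rintro x ⟨hx0, hx⟩
      by_contra hno
      refine hx ⟨hx0, ?_⟩
      simp only [Set.mem_iInter, Set.mem_iUnion, Set.mem_ofPred_eq, exists_prop, not_exists,
        not_and, not_not] at hno ⊢
      exact fun i hi hwi => hno i hi hwi hx0
    · refine (measure_biUnion_null_iff (Finset.countable_toSet _)).2 fun i hi => ?_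
      by_cases hwi : w i = 0
      · simp only [hwi, ne_eq, not_true_eq_false, false_and]
        exact measure_empty
      · exact measure_mono_null (fun x hx => hx.2) (hjw i hi hwi)
  obtain ⟨T₂, hT₂s, hT₂R, hT₂⟩ := exists_prescribed_power hR hap hYm hYs hq1
    (fun x hx => hx.1) hjd hw0 hwsum hwd (fun i hi hwi x hx => by
      have := hx.2
      simp only [Set.mem_iInter, Set.mem_ofPred_eq] at this
      exact this i (Finset.mem_range.2 (by omega)) hwi)
    (L := fun k : Fin N => A.sets k) fun k => A.measurable k
  obtain ⟨T, hTs, hT⟩ := exists_glue hT₁s hT₂s hYm hYs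
  obtain ⟨hjη1, hjη2⟩ := lt_min_iff.1 hjη
  refine ⟨T, hTs, ⟨n j, hjN, fun a ha b hb => ?_⟩, ?_⟩
  · set f : ℕ → ℝ := fun i =>
      (μ.prod μ).real {z | act T₂ i z ∈ A.sets a ∧ z ∈ A.sets b ∧ z.1 ∈ Y} with hf
    set g : ℕ → ℝ := fun i => (Aut.mk T₁).corr i (A.sets a) (A.sets b ∩ Prod.fst ⁻¹' Y₀ᶜ) with hg
    have hYae : ∀ᵐ z ∂μ.prod μ, (z.1 ∈ Y ↔ z.1 ∈ Y₀) := by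
      have h1 : ∀ᵐ x ∂μ, x ∉ Y₀ \ Y := measure_eq_zero_iff_ae_notMem.1 hYY₀
      filter_upwards [measurePreserving_fst.quasiMeasurePreserving.ae h1] with z hz
      exact ⟨fun h => h.1, fun h => by_contra fun h' => hz ⟨h, h'⟩⟩
    have hfg : ∀ i, (Aut.mk T).corr i (A.sets a) (A.sets b) = f i + g i := by
      intro i
      have hm : MeasurableSet {z : X × X | z.1 ∈ Y} := measurable_fst hYm
      rw [Aut.corr_mk, MPMap.corr,
        ← measureReal_inter_add_sdiff (s := (T ^ i).1 ⁻¹' A.sets a ∩ A.sets b) hm]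
      congr 1
      · rw [hf]
        congr 1
        ext z
        simp only [Set.mem_inter_iff, Set.mem_preimage, ← act_natCast, Set.mem_ofPred_eq]
        constructor
        · rintro ⟨⟨h1, h2⟩, h3⟩
          exact ⟨(hT i z).1 h3 ▸ h1, h2, h3⟩
        · rintro ⟨h1, h2, h3⟩
          exact ⟨⟨((hT i z).1 h3).symm ▸ h1, h2⟩, h3⟩
      · rw [hg]
        simp only [Aut.corr_mk, MPMap.corr]
        refine measureReal_congr ?_
        filter_upwards [hYae] with z hz
        refine propext ?_
        change (((T ^ i).1 z ∈ A.sets a ∧ z ∈ A.sets b) ∧ z.1 ∉ Y) ↔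
          ((T₁ ^ i).1 z ∈ A.sets a ∧ z ∈ A.sets b ∧ z.1 ∉ Y₀)
        rw [← hz, and_assoc]
        refine and_congr_left fun h3 => ?_
        rw [← act_natCast, ← act_natCast, (hT i z).2 h3.2]
    have hf0 : ∀ i, 0 ≤ f i := fun i => measureReal_nonneg
    have hf1 : ∀ i, f i ≤ 1 := fun i => measureReal_le_one
    have hPT : P.corr (Aut.mk T) (A.sets a) (A.sets b) =
        ∑' i, P.coeff i * f i + P.corr (Aut.mk T₁) (A.sets a) (A.sets b ∩ Prod.fst ⁻¹' Y₀ᶜ) := by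
      rw [AdmissibleFunction.corr, AdmissibleFunction.corr, hc, zero_mul, zero_add, zero_mul,
        zero_add, ← (P.summable_mul hf0 hf1).tsum_add (P.summable_mul
          (fun i => Aut.corr_nonneg _ i _ _) (fun i => Aut.corr_le_one _ i _ _))]
      exact tsum_congr fun i => by rw [hfg, mul_add]
    -- Three errors of at most `τ / 4` each: the uncovered part of the tower, the truncation of `P`,
    -- and the convergence for the conjugate.
    have e1 : |f (n j) - ∑ i ∈ Finset.range (d + 1), w i * f i| ≤
        ((q : ℝ) + 2 * d + 1) / n j := hT₂ ⟨a, ha⟩ ⟨b, hb⟩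
    have e2 := hwu f hf0 hf1
    have e3 := hjnear a ha b hb
    rw [hfg, hPT, hg]
    rw [abs_le] at e1 e2
    rw [abs_lt] at e3 ⊢
    constructor <;> linarith
  -- The budget is `ε / 2` for the cycles, `ε / 4` for the conjugation, and `ε / 4` for periodic
  -- points without the common period `q`.
  · have hsub : {z | T.1 z ≠ R.1 z} ⊆ ({z | T₂.1 z ≠ R.1 z} ∪
        {z | z.1 ∉ periodicSet s ∧ T₁.1 z ≠ R.1 z}) ∪
        Prod.fst ⁻¹' (periodicSet s \ Y₀ ∪ Y₀ \ Y) := by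
      intro z hz
      have h1 := hT 1 z
      simp only [Nat.cast_one, act_one] at h1
      by_cases hzY : z.1 ∈ Y
      · exact Or.inl (Or.inl (by rwa [Set.mem_ofPred_eq, ← h1.1 hzY]))
      · by_cases hzp : z.1 ∈ periodicSet s
        · refine Or.inr ?_
          by_cases hz0 : z.1 ∈ Y₀
          · exact Or.inr ⟨hz0, hzY⟩
          · exact Or.inl ⟨hzp, hz0⟩
        · exact Or.inl (Or.inr ⟨hzp, by rwa [← h1.2 hzY]⟩)
    have h1 := (measureReal_mono hsub (measure_ne_top (μ.prod μ) _)).trans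
      ((measureReal_union_le _ _).trans (add_le_add (measureReal_union_le _ _) le_rfl))
    rw [hfst ((hper.diff hY₀m).union (hY₀m.diff hYm))] at h1
    have h2 := measureReal_union_le (μ := μ) (periodicSet s \ Y₀) (Y₀ \ Y)
    rw [measureReal_def μ (Y₀ \ Y), hYY₀, ENNReal.toReal_zero] at h2
    linarith

theorem exists_mem_nearSet_dist_lt [NullSingletonClass μ] (A : DenseFamily (μ.prod μ))
    {S : Aut μ} {P : AdmissibleFunction}
    (hP : ∃ R₀ ∈ Ext S, IsWeakLimitOfPowers R₀ (P.eval R₀)) (N : ℕ) {R : Aut (μ.prod μ)}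
    (hR : R ∈ Ext S) {ε : ℝ} (hε : 0 < ε) :
    ∃ T ∈ Ext S, T ∈ nearSet A P N ∧ (halmosMetric A).dist R T < ε := by
  obtain ⟨s, rfl⟩ := Quotient.exists_rep S
  change R ∈ Ext (Aut.mk s) at hR
  obtain ⟨R₀', hR₀, hlim⟩ := hP
  change R₀' ∈ Ext (Aut.mk s) at hR₀
  obtain ⟨R₀, h₀, rfl⟩ := exists_isOver_of_mem_ext hR₀
  obtain ⟨R₁, h₁, rfl⟩ := exists_isOver_of_mem_ext hR
  obtain ⟨n, hn, hcorr⟩ := hlim.exists_tendsto_corr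
  obtain ⟨K, hK⟩ := exists_pow_lt_of_lt_one (show 0 < ε / 4 by linarith)
    (show (1 / 2 : ℝ) < 1 by norm_num)
  -- The passage to `R₂` costs nothing in the first `K` terms, and the later terms are negligible by
  -- the choice of `K`. It may be a large change pointwise, so it is measured by these terms and not
  -- by the measure of the disagreement set.
  obtain ⟨R₂, h₂, hR₂, hap⟩ := exists_aperiodic A h₁ K
  obtain ⟨T, hT, hTN, hTR⟩ := exists_mem_nearSet A h₀ h₂ hap hn hcorr N
    (show 0 < ε / 8 by linarith)
  refine ⟨Aut.mk T, hT.mk_mem_ext, hTN, ?_⟩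
  have hdist : halmosDist A R₁ T ≤ ε / 4 + 2 * (1 / 2) ^ K := by
    refine halmosDist_le A R₁ T K (fun i hi => ?_) (by linarith)
    have e1 := halmosTerm_triangle A R₁ R₂ T i
    have e2 := halmosTerm_le_of_ne A T R₂ i
    rw [show halmosTerm A T R₂ i = halmosTerm A R₂ T i by
      simp only [halmosTerm, symmDiff_comm]] at e2
    rw [hR₂ i hi] at e1
    linarith
  calc (halmosMetric A).dist (Aut.mk R₁) (Aut.mk T) = halmosDist A R₁ T := rfl
    _ < ε := by linarith

end Density

end TypicalExt

theorem mainTheorem10 {X : Type*} [MeasurableSpace X] [StandardBorelSpace X]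
    (μ : MeasureTheory.Measure X) [MeasureTheory.IsProbabilityMeasure μ]
    [MeasureTheory.NullSingletonClass μ] (A : TypicalExt.DenseFamily (μ.prod μ)) (S : TypicalExt.Aut μ) :
    (∀ P : TypicalExt.AdmissibleFunction,
      (∃ R₀ ∈ TypicalExt.Ext S, TypicalExt.IsWeakLimitOfPowers R₀ (P.eval R₀)) →
        TypicalExt.IsTypicalExt A S {R | TypicalExt.IsWeakLimitOfPowers R (P.eval R)}) ∧
    (∀ F : Set TypicalExt.AdmissibleFunction,
      (∀ P ∈ F, ∃ R₀ ∈ TypicalExt.Ext S, TypicalExt.IsWeakLimitOfPowers R₀ (P.eval R₀)) →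
        TypicalExt.IsTypicalExt A S
          {R | ∀ P ∈ F, TypicalExt.IsWeakLimitOfPowers R (P.eval R)}) := by
  have key : ∀ F : Set TypicalExt.AdmissibleFunction,
      (∀ P ∈ F, ∃ R₀ ∈ TypicalExt.Ext S, TypicalExt.IsWeakLimitOfPowers R₀ (P.eval R₀)) →
        TypicalExt.IsTypicalExt A S
          {R | ∀ P ∈ F, TypicalExt.IsWeakLimitOfPowers R (P.eval R)} := fun F hF =>
    TypicalExt.isTypicalExt_of_dense A S F fun P hP N R hR ε hε =>
      TypicalExt.exists_mem_nearSet_dist_lt A (hF P hP) N hR hε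
  refine ⟨fun P hP => ?_, key⟩
  have h := key {P} fun Q hQ => hQ ▸ hP
  simpa only [Set.mem_singleton_iff, forall_eq] using h
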